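/- Feedback Arc Set is the following problem: given a simple directed graph $G=(V,A)$ (no loops, no parallel arcs; opposite arcs $(u,v)$, $(v,u)$ may both be present) with $n$ vertices, find an ordering $\pi$ of $V$ (a bijection from $V$ to the $n$ positions) that minimizes the number of backward arcs, i.e. of arcs $(u,v)\in A$ that do not satisfy $\pi(u)<\pi(v)$. Let $\omega$ be the matrix multiplication exponent, i.e. the infimum of all real $\tau$ such that the product of two $N\times N$ rational matrices can be computed by a bilinear algorithm with $O(N^{\tau})$ essential multiplications (equivalently, the tensor $\langle N,N,N\rangle$ has rank $O(N^\tau)$ over $\mathbb{Q}$). Theorem. Feedback Arc Set can be $2$-approximated in $O^*(2^{\omega n/3})$ time; as $\omega$ is an infimum, the bound is understood up to an arbitrarily small loss in the exponent. That is, for every $\varepsilon>0$ there are a deterministic random access machine program with logarithmic cost measure and constants $C,k$ such that, for every $n$ and every simple directed graph $G$ on $n$ vertices given by its adjacency matrix, the program halts after at most $$C\,(n+1)^k\,2^{(\omega+\varepsilon)n/3}$$ time steps and outputs an ordering of the vertices whose number of backward arcs is at most twice the minimum number of backward arcs over all orderings. -/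

import Mathlib

/-! ### Random access machines with logarithmic cost

A machine has registers and a random access memory, both indexed by `ℕ` and holding natural
numbers. A program is a finite text (so it mentions finitely many registers) built from
assignments, memory writes, sequencing, tests and loops. Every elementary operation is charged
one plus the bit lengths of the numbers (memory addresses included) that it handles. -/

namespace RAM

/-- Memory contents of a machine. -/
structure State where
  reg : ℕ → ℕ
  mem : ℕ → ℕ

/-- Arithmetic expressions over the registers and the memory. -/
inductive Term where
  | const (c : ℕ)
  | reg (i : ℕ)
  | load (addr : Term)
  | add (a b : Term)
  | sub (a b : Term)
  | mul (a b : Term)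
  | div (a b : Term)

/-- The value of an expression. Subtraction is truncated at `0`, division rounds down
(and `x / 0 = 0`). -/
def Term.eval (s : State) : Term → ℕ
  | const c => c
  | reg i => s.reg i
  | load a => s.mem (a.eval s)
  | add a b => a.eval s + b.eval s
  | sub a b => a.eval s - b.eval s
  | mul a b => a.eval s * b.eval s
  | div a b => a.eval s / b.eval s

/-- The cost of evaluating an expression; `Nat.size` is the bit length. -/
def Term.cost (s : State) : Term → ℕ
  | const c => 1 + c.size
  | reg i => 1 + (s.reg i).size
  | load a => a.cost s + (1 + (a.eval s).size + (s.mem (a.eval s)).size)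
  | add a b => a.cost s + b.cost s + (1 + (a.eval s).size + (b.eval s).size)
  | sub a b => a.cost s + b.cost s + (1 + (a.eval s).size + (b.eval s).size)
  | mul a b => a.cost s + b.cost s + (1 + (a.eval s).size + (b.eval s).size)
  | div a b => a.cost s + b.cost s + (1 + (a.eval s).size + (b.eval s).size)

/-- Programs. -/
inductive Prog where
  | skip
  | assign (i : ℕ) (a : Term)
  | store (addr a : Term)
  | seq (p q : Prog)
  | cond (a : Term) (p q : Prog)
  | loop (a : Term) (p : Prog)

/-- `Run p s t s'`: started in state `s`, the program `p` halts in state `s'` after time `t`.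
Tests (in `cond` and `loop`) ask whether the value of the expression is nonzero;
`loop a p` is "while `a ≠ 0` do `p`". -/
inductive Run : Prog → State → ℕ → State → Prop
  | skip (s : State) : Run .skip s 1 s
  | assign (s : State) (i : ℕ) (a : Term) :
      Run (.assign i a) s (a.cost s + (1 + (a.eval s).size))
        { s with reg := Function.update s.reg i (a.eval s) }
  | store (s : State) (b a : Term) :
      Run (.store b a) s (b.cost s + a.cost s + (1 + (b.eval s).size + (a.eval s).size))
        { s with mem := Function.update s.mem (b.eval s) (a.eval s) }
  | seq {p q : Prog} {s s' s'' : State} {t t' : ℕ} (hp : Run p s t s') (hq : Run q s' t' s'') :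
      Run (.seq p q) s (t + t') s''
  | cond_true {a : Term} {p q : Prog} {s s' : State} {t : ℕ} (ha : a.eval s ≠ 0)
      (hp : Run p s t s') : Run (.cond a p q) s (a.cost s + 1 + t) s'
  | cond_false {a : Term} {p q : Prog} {s s' : State} {t : ℕ} (ha : a.eval s = 0)
      (hq : Run q s t s') : Run (.cond a p q) s (a.cost s + 1 + t) s'
  | loop_false {a : Term} {p : Prog} {s : State} (ha : a.eval s = 0) :
      Run (.loop a p) s (a.cost s + 1) s
  | loop_true {a : Term} {p : Prog} {s s' s'' : State} {t t' : ℕ} (ha : a.eval s ≠ 0)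
      (hp : Run p s t s') (hl : Run (.loop a p) s' t' s'') :
      Run (.loop a p) s (a.cost s + 1 + t + t') s''

end RAM

/-! ### The exponent of matrix multiplication -/

/-- Two `N × N` rational matrices can be multiplied by a bilinear algorithm with `r` essential
multiplications, that is, the tensor `⟨N, N, N⟩` has rank at most `r`. -/
def HasBilinearMatMul (N r : ℕ) : Prop :=
  ∃ (f g : Fin r → (Matrix (Fin N) (Fin N) ℚ →ₗ[ℚ] ℚ)) (W : Fin r → Matrix (Fin N) (Fin N) ℚ),
    ∀ A B : Matrix (Fin N) (Fin N) ℚ, A * B = ∑ i, (f i A * g i B) • W i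

/-- The matrix multiplication exponent `ω`: the infimum of all `τ` such that the rank of the
tensor `⟨N, N, N⟩` is `O(N ^ τ)`. -/
noncomputable def matMulExponent : ℝ :=
  sInf {τ : ℝ | ∃ C : ℝ, ∀ N : ℕ, 1 ≤ N →
    ∃ r : ℕ, HasBilinearMatMul N r ∧ (r : ℝ) ≤ C * (N : ℝ) ^ τ}

/-! ### Feedback Arc Set as a vertex ordering problem -/

/-- The number of arcs that are backward with respect to the ordering `π`. -/
noncomputable def numBackward {n : ℕ} (G : Digraph (Fin n)) (π : Fin n ≃ Fin n) : ℕ :=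
  {a : Fin n × Fin n | G.Adj a.1 a.2 ∧ ¬ π a.1 < π a.2}.ncard

open Classical in
/-- The machine state that encodes a digraph: register `0` holds the number `n` of vertices, the
memory holds the adjacency matrix row by row, and everything else is `0`. -/
noncomputable def encodeDigraph {n : ℕ} (G : Digraph (Fin n)) : RAM.State where
  reg i := if i = 0 then n else 0
  mem a := if ∃ u v : Fin n, a = u.val * n + v.val ∧ G.Adj u v then 1 else 0

/-- The program `P` is an `α`-approximation algorithm for Feedback Arc Set with running time at
most `T n` on digraphs with `n` vertices (simple: no loops): it always halts, leaving in memory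
cell `v` the position of vertex `v` in an ordering whose number of backward arcs is at most `α`
times that of every ordering. -/
def ApproximatesFAS (P : RAM.Prog) (α : ℝ) (T : ℕ → ℝ) : Prop :=
  ∀ (n : ℕ) (G : Digraph (Fin n)), (∀ v, ¬ G.Adj v v) →
    ∃ (t : ℕ) (s : RAM.State) (π : Fin n ≃ Fin n),
      RAM.Run P (encodeDigraph G) t s ∧ (t : ℝ) ≤ T n ∧
      (∀ v : Fin n, s.mem v.val = (π v).val) ∧
      ∀ σ : Fin n ≃ Fin n, (numBackward G π : ℝ) ≤ α * (numBackward G σ : ℝ)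

/-! ### Bit lengths -/

/-! Approximation. Choose a vertex set S of about half the vertices such that no set of the same
size has fewer entering arcs, order S and its complement optimally, and put S first. The backward
arcs of the result are the arcs entering S together with those inside the two sides. In any ordering
σ, the first |S| vertices form a set of the same size whose entering arcs are all backward, so the
cut costs at most the cost of σ. The arcs inside the two sides cost at most what σ pays there.
Together this is at most twice the optimum (`backwardArcs_le_two_mul`).

Finding S. A cut receives `K = n² + 1` for every separated pair and loses one for every entering
arc. The reward dominates, so a cut of maximum weight is balanced, and it has the fewest entering
arcs for its size (`card_bitSet_of_maximal`, `cutSize_le_of_maximal`). The vertices are split into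
three blocks of size m, about n/3. The weight becomes a sum of terms depending on the choices (x,
y), (y, z) and (x, z) in two blocks each (`cutWeight_joinBlocks`), so maximizing over y is a
max-plus product of matrices of size `L = 2^m`. The weights are polynomially small. Storing w as
`Z^w` with `Z = L + 1` turns this into an ordinary product, whose entries reveal the maximum
exponent (`sum_indicator_pow_le`). One scan over the pairs (x, z) and one over y then recover the
cut (`mask_maximal`).

Matrix product. For a constant N = 2^e, a bilinear algorithm of rank r at most N^(ω+ε) is fixed; the
constant hidden in the O of the rank is absorbed by taking N large (`exists_rank_le`). Denominators
are cleared, which scales the product by D. The k-th Kronecker power, with N^k = L, is applied by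
Yates' algorithm (`yates`, `kron_matMul`). The computation is done modulo `M = D^k * Z^wd`, which
exceeds every scaled entry, so intermediate numbers stay short and the result is exact
(`prodLevel_eq`).

Orderings. Each side has at most n/2 + 1 vertices, so dynamic programming over its subsets fills at
most 2 L² cells, and L² is at most r^k because a bilinear algorithm for N × N matrices has rank at
least N² (`HasBilinearMatMul.mul_self_le`).

Machine. All values are stored in arrays of at most `H` cells, where `H` is r^k up to a polynomial
factor. Each cell is given by an expression with polynomially many iterations on numbers of
polynomial bit length. Such expressions compile to programs with a polynomial time bound
(`Exp.correct`), and an array is filled by a loop in which a cell may read earlier cells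
(`exec_fill`). The total time is r^k, at most 2^((ω+ε)n/3) up to a constant, times a polynomial
(`exists_time_le`). -/

theorem Nat.size_le_self (n : ℕ) : n.size ≤ n := Nat.size_le.2 Nat.lt_two_pow_self

theorem Nat.size_mul_le (a b : ℕ) : (a * b).size ≤ a.size + b.size := by
  rw [Nat.size_le, pow_add]
  exact Nat.mul_lt_mul'' (Nat.lt_size_self a) (Nat.lt_size_self b)

theorem Nat.size_add_le (a b : ℕ) : (a + b).size ≤ a.size + b.size + 1 := by
  rw [Nat.size_le]
  have ha := Nat.lt_size_self a
  have hb := Nat.lt_size_self b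
  have h1 : 2 ^ a.size ≤ 2 ^ (a.size + b.size) := Nat.pow_le_pow_right (by norm_num) (by omega)
  have h2 : 2 ^ b.size ≤ 2 ^ (a.size + b.size) := Nat.pow_le_pow_right (by norm_num) (by omega)
  rw [pow_succ]
  omega

theorem Nat.size_pow_le (a k : ℕ) : (a ^ k).size ≤ k * a.size + 1 := by
  induction k with
  | zero => simp
  | succ k ih =>
    rw [pow_succ]
    have := Nat.size_mul_le (a ^ k) a
    rw [Nat.succ_mul]
    omega

/-! ### Polynomially bounded functions -/

/-- A function on the natural numbers that is bounded by a polynomial. -/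
def PolyBounded (f : ℕ → ℕ) : Prop := ∃ c d : ℕ, ∀ b, f b ≤ c * (b + 1) ^ d

namespace PolyBounded

theorem const (c : ℕ) : PolyBounded fun _ => c := ⟨c, 0, fun b => by simp⟩

theorem id : PolyBounded fun b => b := ⟨1, 1, fun b => by simp⟩

theorem mono {f g : ℕ → ℕ} (hg : PolyBounded g) (h : ∀ b, f b ≤ g b) : PolyBounded f := by
  obtain ⟨c, d, hc⟩ := hg
  exact ⟨c, d, fun b => (h b).trans (hc b)⟩

theorem add {f g : ℕ → ℕ} (hf : PolyBounded f) (hg : PolyBounded g) :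
    PolyBounded fun b => f b + g b := by
  obtain ⟨c, d, hc⟩ := hf
  obtain ⟨c', d', hc'⟩ := hg
  refine ⟨c + c', d + d', fun b => (add_le_add (hc b) (hc' b)).trans ?_⟩
  rw [add_mul]
  have h1 : (b + 1) ^ d ≤ (b + 1) ^ (d + d') := Nat.pow_le_pow_right (by omega) (by omega)
  have h2 : (b + 1) ^ d' ≤ (b + 1) ^ (d + d') := Nat.pow_le_pow_right (by omega) (by omega)
  gcongr

theorem mul {f g : ℕ → ℕ} (hf : PolyBounded f) (hg : PolyBounded g) :
    PolyBounded fun b => f b * g b := by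
  obtain ⟨c, d, hc⟩ := hf
  obtain ⟨c', d', hc'⟩ := hg
  refine ⟨c * c', d + d', fun b => (Nat.mul_le_mul (hc b) (hc' b)).trans (le_of_eq ?_)⟩
  rw [pow_add]
  ring

theorem pow {f : ℕ → ℕ} (hf : PolyBounded f) (k : ℕ) : PolyBounded fun b => f b ^ k := by
  induction k with
  | zero => simpa using const 1
  | succ k ih => simpa [pow_succ] using ih.mul hf

theorem comp {f g : ℕ → ℕ} (hf : PolyBounded f) (hg : PolyBounded g) :
    PolyBounded fun b => f (g b) := by
  obtain ⟨c, d, hc⟩ := hf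
  exact mono ((const c).mul ((hg.add (const 1)).pow d)) fun b => hc (g b)

end PolyBounded

namespace RAM

/-! ### Total correctness with time bounds -/

/-- Started in `s`, the program `p` halts within time `T` in a state that satisfies `Q`. -/
def RunsTo (p : Prog) (s : State) (T : ℕ) (Q : State → Prop) : Prop :=
  ∃ t s', Run p s t s' ∧ t ≤ T ∧ Q s'

theorem RunsTo.mono {p : Prog} {s : State} {T T' : ℕ} {Q Q' : State → Prop}
    (h : RunsTo p s T Q) (hT : T ≤ T') (hQ : ∀ s', Q s' → Q' s') : RunsTo p s T' Q' := by
  obtain ⟨t, s', hr, ht, hq⟩ := h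
  exact ⟨t, s', hr, ht.trans hT, hQ s' hq⟩

theorem RunsTo.seq {p q : Prog} {s : State} {T₁ T₂ : ℕ} {Q : State → Prop}
    (h : RunsTo p s T₁ fun s' => RunsTo q s' T₂ Q) : RunsTo (.seq p q) s (T₁ + T₂) Q := by
  obtain ⟨t, s', hr, ht, t', s'', hr', ht', hq⟩ := h
  exact ⟨_, _, .seq hr hr', add_le_add ht ht', hq⟩

theorem RunsTo.assign {s : State} {i : ℕ} {a : Term} {T : ℕ} {Q : State → Prop}
    (hT : a.cost s + (1 + (a.eval s).size) ≤ T)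
    (hQ : Q { s with reg := Function.update s.reg i (a.eval s) }) : RunsTo (.assign i a) s T Q :=
  ⟨_, _, .assign s i a, hT, hQ⟩

theorem RunsTo.store {s : State} {b a : Term} {T : ℕ} {Q : State → Prop}
    (hT : b.cost s + a.cost s + (1 + (b.eval s).size + (a.eval s).size) ≤ T)
    (hQ : Q { s with mem := Function.update s.mem (b.eval s) (a.eval s) }) :
    RunsTo (.store b a) s T Q :=
  ⟨_, _, .store s b a, hT, hQ⟩

/-- The invariant is indexed by the number of completed passes and the number `L` of passes is known
beforehand, so termination and the time bound come from the same induction on the passes that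
remain. -/
theorem RunsTo.loop {a : Term} {p : Prog} {L T₁ T₂ : ℕ} (I : ℕ → State → Prop)
    (hc : ∀ i ≤ L, ∀ s, I i s → a.cost s ≤ T₁) (ht : ∀ i < L, ∀ s, I i s → a.eval s ≠ 0)
    (hf : ∀ s, I L s → a.eval s = 0) (hp : ∀ i < L, ∀ s, I i s → RunsTo p s T₂ (I (i + 1)))
    {s : State} (h0 : I 0 s) : RunsTo (.loop a p) s ((L + 1) * (T₁ + 1) + L * T₂) (I L) := by
  suffices H : ∀ j ≤ L, ∀ s, I (L - j) s →
      RunsTo (.loop a p) s ((j + 1) * (T₁ + 1) + j * T₂) (I L) by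
    exact H L le_rfl s (by simpa using h0)
  intro j
  induction j with
  | zero =>
    intro _ s hs
    rw [Nat.sub_zero] at hs
    refine ⟨_, _, .loop_false (hf s hs), ?_, hs⟩
    have := hc L le_rfl s hs
    omega
  | succ j ih =>
    intro hj s hs
    obtain ⟨t, s', hr, ht', hs'⟩ := hp (L - (j + 1)) (by omega) s hs
    rw [show L - (j + 1) + 1 = L - j by omega] at hs'
    obtain ⟨t', s'', hr', ht'', hs''⟩ := ih (by omega) s' hs'
    refine ⟨_, _, .loop_true (ht _ (by omega) s hs) hr hr', ?_, hs''⟩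
    have := hc _ (by omega) s hs
    rw [show (j + 1 + 1) * (T₁ + 1) = (j + 1) * (T₁ + 1) + (T₁ + 1) by ring,
      show (j + 1) * T₂ = j * T₂ + T₂ by ring]
    omega

/-! ### Expressions with bounded iteration -/

/-- Binary operations that cost a bounded number of machine operations. -/
inductive BinOp where
  | add | sub | mul | div | max

/-- The function denoted by a binary operation. -/
def BinOp.fn : BinOp → ℕ → ℕ → ℕ
  | add, a, b => a + b
  | sub, a, b => a - b
  | mul, a, b => a * b
  | div, a, b => a / b
  | max, a, b => Max.max a b

/-- The machine term for a binary operation. -/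
def BinOp.term : BinOp → Term → Term → Term
  | add, a, b => .add a b
  | sub, a, b => .sub a b
  | mul, a, b => .mul a b
  | div, a, b => .div a b
  -- Truncated subtraction makes a + (b - a) the maximum. The operand `a` is duplicated, but
  -- compilation uses this only on registers, so the cost stays bounded.
  | max, a, b => .add a (.sub b a)

theorem BinOp.eval_term (o : BinOp) (a b : Term) (s : State) :
    (o.term a b).eval s = o.fn (a.eval s) (b.eval s) := by
  cases o <;> simp only [term, fn, Term.eval]
  omega

theorem BinOp.size_fn_le (o : BinOp) (a b : ℕ) : (o.fn a b).size ≤ a.size + b.size + 1 := by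
  cases o <;> simp only [fn]
  · exact Nat.size_add_le a b
  · exact (Nat.size_le_size (Nat.sub_le a b)).trans (by omega)
  · exact (Nat.size_mul_le a b).trans (by omega)
  · exact (Nat.size_le_size (Nat.div_le_self a b)).trans (by omega)
  · rcases max_choice a b with h | h <;> rw [h] <;> omega

theorem BinOp.cost_term_le (o : BinOp) (i j : ℕ) (s : State) :
    (o.term (.reg i) (.reg j)).cost s ≤ 8 * ((s.reg i).size + (s.reg j).size + 1) := by
  have := Nat.size_le_size (Nat.sub_le (s.reg j) (s.reg i))
  cases o <;> simp only [term, Term.cost, Term.eval] <;> omega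

/-- Expressions. `big o u x y e` folds the operation `o`, from `u` on, over the values of `e` for
`x = 0, …, y - 1`; `bind x a e` is the value of `e` for `x = a`. -/
inductive Exp where
  | const (c : ℕ)
  | var (i : ℕ)
  | load (a : Exp)
  | bin (o : BinOp) (a b : Exp)
  | big (o : BinOp) (u x y : ℕ) (e : Exp)
  | bind (x : ℕ) (a e : Exp)

namespace Exp

/-- The value of an expression. -/
def eval (μ : ℕ → ℕ) : Exp → (ℕ → ℕ) → ℕ
  | const c, _ => c
  | var i, env => env i
  | load a, env => μ (a.eval μ env)
  | bin o a b, env => o.fn (a.eval μ env) (b.eval μ env)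
  | big o u x y e, env =>
    Nat.rec u (fun i acc => o.fn acc (e.eval μ (Function.update env x i))) (env y)
  | bind x a e, env => e.eval μ (Function.update env x (a.eval μ env))

/-- Well-formedness: the variables are among the first `32` registers, and the bounds of
iterations are iteration variables or belong to `Y`. -/
def WF : Exp → List ℕ → Prop
  | const _, _ => True
  | var i, _ => i < 32
  | load a, Y => a.WF Y
  | bin _ a b, Y => a.WF Y ∧ b.WF Y
  | big _ _ x y e, Y => x < 32 ∧ y < 32 ∧ y ∈ Y ∧ e.WF (x :: Y)
  | bind x a e, Y => x < 32 ∧ x ∉ Y ∧ a.WF Y ∧ e.WF Y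

/-- A bound for the bit length of the value when the variables and the memory hold numbers with
at most `b` bits and iterations have length at most `b`. -/
def bits : Exp → ℕ → ℕ
  | const c, _ => c.size
  | var _, b => b
  | load _, b => b
  | bin _ x y, b => x.bits b + y.bits b + 1
  | big _ u _ _ e, b => u.size + b * (e.bits b + 1)
  -- The bound variable may be longer than all previous numbers, so the body is estimated with an
  -- enlarged bit bound.
  | bind _ a e, b => e.bits (b + a.bits b)

/-- A bound for the running time under the same conditions. -/
def time : Exp → ℕ → ℕ
  | const c, _ => 2 * (1 + c.size)
  | var _, b => 2 * (1 + b)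
  | load a, b => a.time b + 4 * (a.bits b + b + 1)
  | bin _ x y, b => x.time b + y.time b + 10 * (x.bits b + y.bits b + 1)
  | big _ u _ _ e, b =>
    b * (e.time b) + (b + 2) * (60 * (u.size + b * (e.bits b + 1) + e.bits b + b + 1))
  | bind _ a e, b =>
    a.time b + e.time (b + a.bits b) + 10 * (a.bits b + b + e.bits (b + a.bits b) + 1)

theorem bits_polyBounded (e : Exp) : PolyBounded e.bits := by
  induction e with
  | const c => exact .const _
  | var i => exact .id
  | load a => exact .id
  | bin o x y hx hy => exact (hx.add hy).add (.const 1)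
  | big o u x y e he => exact (PolyBounded.const _).add (PolyBounded.id.mul (he.add (.const 1)))
  | bind x a e ha he => exact he.comp (PolyBounded.id.add ha)

theorem time_polyBounded (e : Exp) : PolyBounded e.time := by
  induction e with
  | const c => exact .const _
  | var i => exact (PolyBounded.const 2).mul ((PolyBounded.const 1).add .id)
  | load a ha =>
    exact ha.add ((PolyBounded.const 4).mul ((a.bits_polyBounded.add .id).add (.const 1)))
  | bin o x y hx hy =>
    exact (hx.add hy).add ((PolyBounded.const 10).mul
      ((x.bits_polyBounded.add y.bits_polyBounded).add (.const 1)))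
  | big o u x y e he =>
    have h := e.bits_polyBounded
    exact (PolyBounded.id.mul he).add ((PolyBounded.id.add (.const 2)).mul
      ((PolyBounded.const 60).mul (((((PolyBounded.const _).add
        (PolyBounded.id.mul (h.add (.const 1)))).add h).add .id).add (.const 1))))
  | bind x a e ha he =>
    have h := a.bits_polyBounded
    exact (ha.add (he.comp (PolyBounded.id.add h))).add ((PolyBounded.const 10).mul
      (((h.add .id).add (e.bits_polyBounded.comp (PolyBounded.id.add h))).add (.const 1)))

/-- The variables and the memory hold numbers with at most `b` bits, the variables in `Y` hold
numbers that are at most `b`. -/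
structure Bounded (b : ℕ) (Y : List ℕ) (env μ : ℕ → ℕ) : Prop where
  env_size : ∀ i < 32, (env i).size ≤ b
  small : ∀ i ∈ Y, env i ≤ b
  mem_size : ∀ a, (μ a).size ≤ b

/-- A counter stays below a small bound and is therefore small itself, so it may in turn bound an
inner iteration. -/
theorem Bounded.loop {b : ℕ} {Y : List ℕ} {env μ : ℕ → ℕ} (h : Bounded b Y env μ) {y i : ℕ}
    (hy : y ∈ Y) (hi : i ≤ env y) (x : ℕ) : Bounded b (x :: Y) (Function.update env x i) μ := by
  have hib : i ≤ b := hi.trans (h.small y hy)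
  refine ⟨fun j hj => ?_, fun j hj => ?_, h.mem_size⟩
  · rcases eq_or_ne j x with rfl | hne
    · simpa using (Nat.size_le_self i).trans hib
    · simpa [hne] using h.env_size j hj
  · rcases eq_or_ne j x with rfl | hne
    · simpa using hib
    · simpa [hne] using h.small j (by simpa [hne] using hj)

/-- The new value is controlled only in bit length and may be exponentially large, hence `x` must
not be a variable that bounds iterations. -/
theorem Bounded.update {b c : ℕ} {Y : List ℕ} {env μ : ℕ → ℕ} (h : Bounded b Y env μ) {x v : ℕ}
    (hx : x ∉ Y) (hbc : b ≤ c) (hv : v.size ≤ c) : Bounded c Y (Function.update env x v) μ := by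
  refine ⟨fun j hj => ?_, fun j hj => ?_, fun a => (h.mem_size a).trans hbc⟩
  · rcases eq_or_ne j x with rfl | hne
    · simpa using hv
    · simpa [hne] using (h.env_size j hj).trans hbc
  · rcases eq_or_ne j x with rfl | hne
    · exact absurd hj hx
    · simpa [hne] using (h.small j hj).trans hbc

/-- Every operation, multiplication included, adds at most the bit length of its second operand plus
one, so a single linear estimate serves sums, products and maxima. -/
theorem size_fold_le (o : BinOp) (u c : ℕ) (f : ℕ → ℕ) (i : ℕ) (hf : ∀ j < i, (f j).size ≤ c) :
    (Nat.rec u (fun j acc => o.fn acc (f j)) i : ℕ).size ≤ u.size + i * (c + 1) := by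
  induction i with
  | zero => simp
  | succ i ih =>
    have h1 := o.size_fn_le (Nat.rec u (fun j acc => o.fn acc (f j)) i) (f i)
    have h2 := ih fun j hj => hf j (by omega)
    have h3 := hf i (by omega)
    rw [Nat.succ_mul]
    simp only
    omega

theorem size_eval_le (e : Exp) : ∀ {b : ℕ} {Y : List ℕ} {env μ : ℕ → ℕ}, e.WF Y →
    Bounded b Y env μ → (e.eval μ env).size ≤ e.bits b := by
  induction e with
  | const c => intros; exact le_rfl
  | var i => intro b Y env μ hw hb; exact hb.env_size i hw
  | load a => intro b Y env μ hw hb; exact hb.mem_size _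
  | bin o x y hx hy =>
    intro b Y env μ hw hb
    have h1 := o.size_fn_le (x.eval μ env) (y.eval μ env)
    have h2 := hx hw.1 hb
    have h3 := hy hw.2 hb
    simp only [eval, bits]
    omega
  | big o u x y e he =>
    intro b Y env μ hw hb
    obtain ⟨-, -, hy, hw⟩ := hw
    refine (size_fold_le o u (e.bits b) _ _ fun j hj => he hw (hb.loop hy hj.le x)).trans ?_
    exact Nat.add_le_add_left (Nat.mul_le_mul_right _ (hb.small y hy)) _
  | bind x a e ha he =>
    intro b Y env μ hw hb
    obtain ⟨-, hx, hwa, hwe⟩ := hw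
    exact he hwe (hb.update hx (by omega) ((ha hwa hb).trans (by omega)))

/-- The program that leaves the value of the expression in register `d`, using as scratch
registers only those from `d` on. -/
def compile : Exp → ℕ → Prog
  | const c, d => .assign d (.const c)
  | var i, d => .assign d (.reg i)
  | load a, d => .seq (a.compile d) (.assign d (.load (.reg d)))
  | bin o a b, d => .seq (a.compile d) (.seq (b.compile (d + 1))
      (.assign d (o.term (.reg d) (.reg (d + 1)))))
  -- Register `d` accumulates, `d + 1` saves `x`, `d + 2` holds the bound and `d + 3` receives the
  -- value of the body. The bound is copied before `x` is reset because `x` and `y` may coincide.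
  | big o u x y e, d => .seq (.assign d (.const u)) (.seq (.assign (d + 1) (.reg x))
      (.seq (.assign (d + 2) (.reg y)) (.seq (.assign x (.const 0))
      (.seq (.loop (.sub (.reg (d + 2)) (.reg x)) (.seq (e.compile (d + 3))
        (.seq (.assign d (o.term (.reg d) (.reg (d + 3))))
          (.assign x (.add (.reg x) (.const 1))))))
      (.assign x (.reg (d + 1)))))))
  | bind x a e, d => .seq (a.compile d) (.seq (.assign (d + 1) (.reg x))
      (.seq (.assign x (.reg d)) (.seq (e.compile (d + 2))
      (.seq (.assign d (.reg (d + 2))) (.assign x (.reg (d + 1)))))))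

/-- What the compiled expression does to the state. -/
def Computed (d v : ℕ) (s s' : State) : Prop :=
  s'.mem = s.mem ∧ s'.reg d = v ∧ ∀ i < d, s'.reg i = s.reg i

/-- The correctness of the compiled expression. -/
def Correct (e : Exp) : Prop :=
  ∀ {b : ℕ} {Y : List ℕ} {env μ : ℕ → ℕ} {d : ℕ} {s : State}, e.WF Y → Bounded b Y env μ →
    32 ≤ d → (∀ i < 32, s.reg i = env i) → s.mem = μ →
      RunsTo (e.compile d) s (e.time b) (Computed d (e.eval μ env) s)

theorem correct_load {a : Exp} (ha : a.Correct) : (load a).Correct := by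
  intro b Y env μ d s hw hb hd hs hm
  refine (RunsTo.seq (T₂ := 4 * (a.bits b + b + 1))
    ((ha hw hb hd hs hm).mono le_rfl ?_))
  rintro s₁ ⟨hm₁, hv₁, hr₁⟩
  have hsz := a.size_eval_le hw hb
  have hsz' := hb.mem_size (a.eval μ env)
  refine RunsTo.assign ?_ ⟨hm₁, ?_, fun i hi => ?_⟩
  · simp only [Term.cost, Term.eval, hv₁, hm₁, hm]
    omega
  · simp [Term.eval, hv₁, hm₁, hm, eval]
  · simp [hi.ne, hr₁ i hi]

theorem correct_bin {o : BinOp} {x y : Exp} (hx : x.Correct) (hy : y.Correct) :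
    (bin o x y).Correct := by
  intro b Y env μ d s hw hb hd hs hm
  refine (RunsTo.seq (T₂ := y.time b + 10 * (x.bits b + y.bits b + 1))
    ((hx hw.1 hb hd hs hm).mono le_rfl ?_)).mono (by simp only [time]; omega) fun _ h => h
  rintro s₁ ⟨hm₁, hv₁, hr₁⟩
  refine RunsTo.seq ((hy hw.2 hb (d := d + 1) (by omega)
    (fun i hi => (hr₁ i (by omega)).trans (hs i hi)) (hm₁.trans hm)).mono le_rfl ?_)
  rintro s₂ ⟨hm₂, hv₂, hr₂⟩
  have h1 := x.size_eval_le hw.1 hb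
  have h2 := y.size_eval_le hw.2 hb
  have hd₂ : s₂.reg d = x.eval μ env := (hr₂ d (by omega)).trans hv₁
  refine RunsTo.assign ?_ ⟨hm₂.trans hm₁, ?_, fun i hi => ?_⟩
  · have h3 := o.cost_term_le d (d + 1) s₂
    have h4 := o.size_fn_le (x.eval μ env) (y.eval μ env)
    rw [BinOp.eval_term]
    simp only [Term.eval, hd₂, hv₂] at h3 h4 ⊢
    omega
  · simp [BinOp.eval_term, Term.eval, hd₂, hv₂, eval]
  · simp [hi.ne, hr₂ i (by omega), hr₁ i hi]

theorem correct_bind {x : ℕ} {a e : Exp} (ha : a.Correct) (he : e.Correct) :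
    (bind x a e).Correct := by
  intro b Y env μ d s hw hb hd hs hm
  obtain ⟨hx32, hxY, hwa, hwe⟩ := hw
  set B := a.bits b + b + e.bits (b + a.bits b) + 1 with hB
  have hsa := a.size_eval_le hwa hb
  have hb' : Bounded (b + a.bits b) Y (Function.update env x (a.eval μ env)) μ :=
    hb.update hxY (by omega) (hsa.trans (by omega))
  have hse := e.size_eval_le hwe hb'
  have hsx : (s.reg x).size ≤ b := by rw [hs x hx32]; exact hb.env_size x hx32
  refine RunsTo.mono (T := a.time b + (2 * B + (2 * B + (e.time (b + a.bits b) +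
    (2 * B + 2 * B))))) (RunsTo.seq ((ha hwa hb hd hs hm).mono le_rfl ?_))
    (by simp only [time]; omega) fun _ h => h
  rintro s₁ ⟨hm₁, hv₁, hr₁⟩
  refine RunsTo.seq (RunsTo.assign ?_ ?_)
  · simp only [Term.cost, Term.eval, hr₁ x (by omega)]
    omega
  refine RunsTo.seq (RunsTo.assign ?_ ?_)
  · simp [Term.cost, Term.eval, hv₁]
    omega
  refine RunsTo.seq ((he hwe hb' (d := d + 2) (by omega) (fun i hi => ?_)
    (by exact hm₁.trans hm)).mono le_rfl ?_)
  · rcases eq_or_ne i x with rfl | hne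
    · simp [Term.eval, hv₁]
    · have : i ≠ d + 1 := by omega
      simp [hne, this, hr₁ i (by omega), hs i hi]
  rintro s₂ ⟨hm₂, hv₂, hr₂⟩
  have hx₂ : s₂.reg (d + 1) = s.reg x := by
    rw [hr₂ (d + 1) (by omega)]
    have : d + 1 ≠ x := by omega
    simp [this, Term.eval, hr₁ x (by omega)]
  refine RunsTo.seq (RunsTo.assign ?_ (RunsTo.assign ?_ ⟨hm₂.trans hm₁, ?_, fun i hi => ?_⟩))
  · simp only [Term.cost, Term.eval, hv₂]
    omega
  · have : d + 1 ≠ d := by omega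
    simp only [Term.cost, Term.eval, Function.update_of_ne this, hx₂]
    omega
  · have : d ≠ x := by omega
    simp [this, Term.eval, hv₂, eval]
  · rcases eq_or_ne i x with rfl | hne
    · simp [Term.eval, hx₂]
    · have h1 : i ≠ d := by omega
      have h2 : i ≠ d + 1 := by omega
      simp [hne, h1, h2, hr₂ i (by omega), hr₁ i hi]

theorem correct_big {o : BinOp} {u x y : ℕ} {e : Exp} (he : e.Correct) :
    (big o u x y e).Correct := by
  intro b Y env μ d s hw hb hd hs hm
  obtain ⟨hx32, hy32, hyY, hwe⟩ := hw
  set B := u.size + b * (e.bits b + 1) + e.bits b + b + 1 with hB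
  set f : ℕ → ℕ := fun i =>
    Nat.rec u (fun i acc => o.fn acc (e.eval μ (Function.update env x i))) i with hf
  have hyb : env y ≤ b := hb.small y hyY
  have hsz : ∀ j < env y, (e.eval μ (Function.update env x j)).size ≤ e.bits b :=
    fun j hj => e.size_eval_le hwe (hb.loop hyY hj.le x)
  have hfs : ∀ i ≤ env y, (f i).size ≤ B := fun i hi =>
    (size_fold_le o u (e.bits b) _ i fun j hj => hsz j (by omega)).trans (by
      have := Nat.mul_le_mul_right (e.bits b + 1) (hi.trans hyb)
      omega)
  have hsx : (s.reg x).size ≤ b := by rw [hs x hx32]; exact hb.env_size x hx32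
  have hsy : (env y).size ≤ b := hb.env_size y hy32
  have hxd : x ≠ d := by omega
  have hxd1 : x ≠ d + 1 := by omega
  have hxd2 : x ≠ d + 2 := by omega
  have hyx : y ≠ d ∧ y ≠ d + 1 := by omega
  refine RunsTo.mono (T := 2 * B + (2 * B + (2 * B + (2 * B + (((env y + 1) * (5 * B + 1) +
    env y * (e.time b + (26 * B + 6 * B))) + 2 * B))))) ?_ ?_ fun _ h => h
  · refine RunsTo.seq (RunsTo.assign (by simp only [Term.cost, Term.eval]; omega) ?_)
    refine RunsTo.seq (RunsTo.assign ?_ ?_)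
    · simp [Term.cost, Term.eval, hxd]
      omega
    refine RunsTo.seq (RunsTo.assign ?_ ?_)
    · simp [Term.cost, Term.eval, hyx, hs y hy32]
      omega
    refine RunsTo.seq (RunsTo.assign ?_ ?_)
    · simp [Term.cost, Term.eval]
      omega
    -- Register `x` is exempt from preservation while it serves as the counter; the assignment after
    -- the loop restores it from register `d + 1`.
    let I : ℕ → State → Prop := fun i s' => s'.mem = s.mem ∧ s'.reg x = i ∧ s'.reg d = f i ∧
      s'.reg (d + 1) = s.reg x ∧ s'.reg (d + 2) = env y ∧ ∀ j < d, j ≠ x → s'.reg j = s.reg j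
    refine RunsTo.seq (RunsTo.mono (RunsTo.loop (L := env y) (T₁ := 5 * B)
      (T₂ := e.time b + (26 * B + 6 * B)) I ?_ ?_ ?_ ?_ ?_) le_rfl ?_)
    · rintro i hi s' ⟨-, hi', -, -, hy', -⟩
      have h1 : i.size ≤ b := (Nat.size_le_self i).trans (by omega)
      simp only [Term.cost, Term.eval, hi', hy']
      omega
    · rintro i hi s' ⟨-, hi', -, -, hy', -⟩
      simp only [Term.eval, hi', hy']
      omega
    · rintro s' ⟨-, hi', -, -, hy', -⟩
      simp [Term.eval, hi', hy']
    · rintro i hi s' ⟨hm', hi', hd', hd1', hy', hr'⟩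
      refine RunsTo.seq ((he hwe (hb.loop hyY hi.le x) (d := d + 3) (by omega) (fun j hj => ?_)
        (hm'.trans hm)).mono le_rfl ?_)
      · rcases eq_or_ne j x with rfl | hne
        · simp [hi']
        · simp [hne, hr' j (by omega) hne, hs j hj]
      rintro s₁ ⟨hm₁, hv₁, hr₁⟩
      have hsd := hfs i hi.le
      have hse := hsz i hi
      refine RunsTo.seq (RunsTo.assign ?_ (RunsTo.assign ?_
        ⟨hm₁.trans hm', ?_, ?_, ?_, ?_, fun j hj hne => ?_⟩))
      · have h3 := o.cost_term_le d (d + 3) s₁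
        have h4 := o.size_fn_le (f i) (e.eval μ (Function.update env x i))
        rw [BinOp.eval_term]
        simp only [Term.eval, hr₁ d (by omega), hd', hv₁] at h3 h4 ⊢
        omega
      · have h1 : i.size ≤ b := (Nat.size_le_self i).trans (by omega)
        have h2 := Nat.size_add_le i 1
        simp [Term.cost, Term.eval, hxd, hr₁ x (by omega), hi'] at h2 ⊢
        omega
      · simp [Term.eval, hxd, hr₁ x (by omega), hi']
      · simp [hxd.symm, BinOp.eval_term, Term.eval, hr₁ d (by omega), hd', hv₁, hf]
      · simp [hxd1.symm, hr₁ (d + 1) (by omega), hd1']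
      · simp [hxd2.symm, hr₁ (d + 2) (by omega), hy']
      · have : j ≠ d := by omega
        simp [hne, this, hr₁ j (by omega), hr' j hj hne]
    · refine ⟨rfl, ?_, ?_, ?_, ?_, fun j hj hne => ?_⟩
      · simp [Term.eval]
      · simp [hxd.symm, Term.eval, hf]
      · simp [hxd1.symm, hxd, Term.eval]
      · simp [hxd2.symm, Term.eval, hyx, hs y hy32]
      · have h1 : j ≠ d := by omega
        have h2 : j ≠ d + 1 := by omega
        have h3 : j ≠ d + 2 := by omega
        simp [hne, h1, h2, h3]
    · rintro s' ⟨hm', hi', hd', hd1', hy', hr'⟩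
      refine RunsTo.assign ?_ ⟨hm', ?_, fun j hj => ?_⟩
      · simp only [Term.cost, Term.eval, hd1']
        omega
      · simp [hxd.symm, hd', hf, eval]
      · rcases eq_or_ne j x with rfl | hne
        · simp [Term.eval, hd1']
        · simp [hne, hr' j hj hne]
  · have h1 : (env y + 1) * (5 * B + 1) ≤ (b + 1) * (6 * B) :=
      Nat.mul_le_mul (by omega) (by omega)
    have h2 : env y * (e.time b + (26 * B + 6 * B)) ≤ b * (e.time b + 32 * B) :=
      Nat.mul_le_mul hyb (by omega)
    simp only [time]
    rw [← hB]
    nlinarith [Nat.zero_le (b * B)]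

theorem correct (e : Exp) : e.Correct := by
  induction e with
  | const c =>
    intro b Y env μ d s hw hb hd hs hm
    refine RunsTo.assign ?_ ⟨rfl, ?_, fun i hi => ?_⟩
    · simp only [Term.cost, Term.eval, time]; omega
    · simp [Term.eval, eval]
    · simp [hi.ne]
  | var i =>
    intro b Y env μ d s hw hb hd hs hm
    have := hb.env_size i hw
    refine RunsTo.assign ?_ ⟨rfl, ?_, fun i hi => ?_⟩
    · simp only [Term.cost, Term.eval, time, hs i hw]; omega
    · simp [Term.eval, eval, hs i hw]
    · simp [hi.ne]
  | load a ha => exact correct_load ha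
  | bin o x y hx hy => exact correct_bin hx hy
  | big o u x y e he => exact correct_big he
  | bind x a e ha he => exact correct_bind ha he

end Exp

end RAM

namespace RAM

/-! ### Straight-line programs that fill arrays -/

/-- The machine state holds the values `env` in its first `32` registers, and the memory `μ`. -/
def Matches (env μ : ℕ → ℕ) (s : State) : Prop :=
  (∀ i < 32, s.reg i = env i) ∧ s.mem = μ

/-- The program transforms registers and memory as described, within time `T`. -/
def Exec (p : Prog) (env μ : ℕ → ℕ) (T : ℕ) (env' μ' : ℕ → ℕ) : Prop :=
  ∀ s, Matches env μ s → RunsTo p s T (Matches env' μ')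

theorem Exec.seq {p q : Prog} {env μ env₁ μ₁ env₂ μ₂ : ℕ → ℕ} {T₁ T₂ : ℕ}
    (h₁ : Exec p env μ T₁ env₁ μ₁) (h₂ : Exec q env₁ μ₁ T₂ env₂ μ₂) :
    Exec (.seq p q) env μ (T₁ + T₂) env₂ μ₂ := fun s hs =>
  RunsTo.seq ((h₁ s hs).mono le_rfl fun s' hs' => h₂ s' hs')

theorem Exec.mono {p : Prog} {env μ env₁ μ₁ : ℕ → ℕ} {T T' : ℕ}
    (h : Exec p env μ T env₁ μ₁) (hT : T ≤ T') : Exec p env μ T' env₁ μ₁ := fun s hs =>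
  (h s hs).mono hT fun _ h => h

/-- Assign the value of an expression to a register. -/
def setReg (x : ℕ) (e : Exp) : Prog := .seq (e.compile 32) (.assign x (.reg 32))

/-- A bound for the running time of `setReg`. -/
def setTime (e : Exp) (b : ℕ) : ℕ := e.time b + 2 * (e.bits b + 1)

theorem setTime_polyBounded (e : Exp) : PolyBounded (setTime e) :=
  e.time_polyBounded.add ((PolyBounded.const 2).mul (e.bits_polyBounded.add (.const 1)))

theorem exec_setReg {x : ℕ} {e : Exp} {b : ℕ} {Y : List ℕ} {env μ : ℕ → ℕ} (hw : e.WF Y)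
    (hb : Exp.Bounded b Y env μ) :
    Exec (setReg x e) env μ (setTime e b) (Function.update env x (e.eval μ env)) μ := by
  rintro s ⟨hs, hm⟩
  refine RunsTo.seq ((e.correct hw hb le_rfl hs hm).mono le_rfl ?_)
  rintro s₁ ⟨hm₁, hv₁, hr₁⟩
  have := e.size_eval_le hw hb
  refine RunsTo.assign ?_ ⟨fun i hi => ?_, hm₁.trans hm⟩
  · simp only [Term.cost, Term.eval, hv₁]
    omega
  · rcases eq_or_ne i x with rfl | hne
    · simp [Term.eval, hv₁]
    · simp [hne, hr₁ i hi, hs i hi]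

/-- The memory `μ` with `v 0, …, v (len - 1)` written from address `lo` on. -/
def overlay (μ : ℕ → ℕ) (lo len : ℕ) (v : ℕ → ℕ) : ℕ → ℕ := fun a =>
  if lo ≤ a ∧ a < lo + len then v (a - lo) else μ a

theorem overlay_apply_of_lt {μ : ℕ → ℕ} {lo len i : ℕ} {v : ℕ → ℕ} (h : i < len) :
    overlay μ lo len v (lo + i) = v i := by
  simp [overlay, h]

theorem overlay_apply_of_not {μ : ℕ → ℕ} {lo len a : ℕ} {v : ℕ → ℕ}
    (h : a < lo ∨ lo + len ≤ a) : overlay μ lo len v a = μ a := by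
  rw [overlay, if_neg (by omega)]

theorem overlay_succ (μ : ℕ → ℕ) (lo i : ℕ) (v : ℕ → ℕ) :
    Function.update (overlay μ lo i v) (lo + i) (v i) = overlay μ lo (i + 1) v := by
  funext a
  rcases eq_or_ne a (lo + i) with rfl | hne
  · simp [overlay]
  · rw [Function.update_of_ne hne, overlay, overlay]
    by_cases h : lo ≤ a ∧ a < lo + i
    · rw [if_pos h, if_pos (by omega)]
    · rw [if_neg h, if_neg (by omega)]

theorem overlay_zero (μ : ℕ → ℕ) (lo : ℕ) (v : ℕ → ℕ) : overlay μ lo 0 v = μ := by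
  funext a
  rw [overlay, if_neg (by omega)]

theorem size_overlay_le {μ : ℕ → ℕ} {lo len b : ℕ} {v : ℕ → ℕ} (hμ : ∀ a, (μ a).size ≤ b)
    (hv : ∀ i < len, (v i).size ≤ b) (a : ℕ) : (overlay μ lo len v a).size ≤ b := by
  rw [overlay]
  split_ifs with h
  · exact hv _ (by omega)
  · exact hμ a

/-- For `x = 0, …, len - 1`, write the value of `e` to memory cell `lo + x`. -/
def fill (lo len : Exp) (x : ℕ) (e : Exp) : Prog :=
  .seq (lo.compile 32) (.seq (len.compile 33) (.seq (.assign 34 (.reg x))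
    (.seq (.assign x (.const 0)) (.seq (.loop (.sub (.reg 33) (.reg x)) (.seq (e.compile 35)
      (.seq (.store (.add (.reg 32) (.reg x)) (.reg 35)) (.assign x (.add (.reg x) (.const 1))))))
    (.assign x (.reg 34))))))

/-- A bound for the running time of `fill` per cell. -/
def fillTime (lo len e : Exp) (b : ℕ) : ℕ :=
  lo.time b + len.time b + e.time b + 60 * (lo.bits b + len.bits b + b + 1)

theorem fillTime_polyBounded (lo len e : Exp) : PolyBounded (fillTime lo len e) :=
  ((lo.time_polyBounded.add len.time_polyBounded).add e.time_polyBounded).add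
    ((PolyBounded.const 60).mul (((lo.bits_polyBounded.add len.bits_polyBounded).add .id).add
      (.const 1)))

/-- Cell `i` is evaluated in the memory where cells `0, …, i - 1` of the same array are already
written, as `hev` records. This lets an array be defined by a recursion on its index: levels of
Yates' algorithm, running maxima, tables over subsets. -/
theorem exec_fill {lo len e : Exp} {x b l L : ℕ} {Y : List ℕ} {env μ : ℕ → ℕ} (v : ℕ → ℕ)
    (hlo : lo.WF Y) (hlen : len.WF Y) (he : e.WF Y) (hx : x < 32) (hxY : x ∉ Y)
    (hb : Exp.Bounded b Y env μ) (hl : lo.eval μ env = l) (hL : len.eval μ env = L)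
    (hLb : L.size ≤ b) (hv : ∀ i < L, (v i).size ≤ b)
    (hev : ∀ i < L, e.eval (overlay μ l i v) (Function.update env x i) = v i) :
    Exec (fill lo len x e) env μ ((L + 1) * fillTime lo len e b) env (overlay μ l L v) := by
  rintro s ⟨hs, hm⟩
  set B := lo.bits b + len.bits b + b + 1 with hB
  have hsl := lo.size_eval_le hlo hb
  have hsL := len.size_eval_le hlen hb
  rw [hl] at hsl
  rw [hL] at hsL
  have hsx := hb.env_size x hx
  refine RunsTo.mono (T := lo.time b + (len.time b + (2 * B + (2 * B + (((L + 1) * (5 * B + 1) +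
    L * (e.time b + (10 * B + 8 * B))) + 2 * B))))) ?_ ?_ fun _ h => h
  · refine RunsTo.seq ((lo.correct hlo hb le_rfl hs hm).mono le_rfl ?_)
    rintro s₁ ⟨hm₁, hv₁, hr₁⟩
    refine RunsTo.seq ((len.correct hlen hb (d := 33) (by norm_num)
      (fun i hi => (hr₁ i hi).trans (hs i hi)) (hm₁.trans hm)).mono le_rfl ?_)
    rintro s₂ ⟨hm₂, hv₂, hr₂⟩
    have h32 : s₂.reg 32 = l := (hr₂ 32 (by norm_num)).trans (hv₁.trans hl)
    have h33 : s₂.reg 33 = L := hv₂.trans hL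
    have hr : ∀ i < 32, s₂.reg i = env i := fun i hi =>
      (hr₂ i (by omega)).trans ((hr₁ i hi).trans (hs i hi))
    have hx32 : x ≠ 32 := by omega
    have hx33 : x ≠ 33 := by omega
    have hx34 : x ≠ 34 := by omega
    refine RunsTo.seq (RunsTo.assign ?_ ?_)
    · simp only [Term.cost, Term.eval, hr x hx]
      omega
    refine RunsTo.seq (RunsTo.assign ?_ ?_)
    · simp [Term.cost, Term.eval]
      omega
    let I : ℕ → State → Prop := fun i s' => s'.mem = overlay μ l i v ∧ s'.reg x = i ∧
      s'.reg 32 = l ∧ s'.reg 33 = L ∧ s'.reg 34 = env x ∧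
      ∀ j < 32, j ≠ x → s'.reg j = env j
    refine RunsTo.seq (RunsTo.mono (RunsTo.loop (L := L) (T₁ := 5 * B)
      (T₂ := e.time b + (10 * B + 8 * B)) I ?_ ?_ ?_ ?_ ?_) le_rfl ?_)
    · rintro i hi s' ⟨-, hi', -, hy', -, -⟩
      have h1 : i.size ≤ L.size := Nat.size_le_size hi
      simp only [Term.cost, Term.eval, hi', hy']
      omega
    · rintro i hi s' ⟨-, hi', -, hy', -, -⟩
      simp only [Term.eval, hi', hy']
      omega
    · rintro s' ⟨-, hi', -, hy', -, -⟩
      simp [Term.eval, hi', hy']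
    · rintro i hi s' ⟨hm', hi', hl', hL', hx', hr'⟩
      have hib : i.size ≤ b := (Nat.size_le_size hi.le).trans hLb
      have hb' : Exp.Bounded b Y (Function.update env x i) (overlay μ l i v) := by
        have h := hb.update (v := i) hxY le_rfl hib
        exact ⟨h.env_size, h.small, size_overlay_le hb.mem_size fun j hj => hv j (by omega)⟩
      refine RunsTo.seq ((e.correct he hb' (d := 35) (by norm_num) (fun j hj => ?_)
        hm').mono le_rfl ?_)
      · rcases eq_or_ne j x with rfl | hne
        · simp [hi']
        · simp [hne, hr' j (by omega) hne]
      rintro s₃ ⟨hm₃, hv₃, hr₃⟩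
      rw [hev i hi] at hv₃
      have hvi := hv i hi
      have h1 := Nat.size_add_le l i
      have h2 := Nat.size_add_le i 1
      have g32 := (hr₃ 32 (by norm_num)).trans hl'
      have gx := (hr₃ x (by omega)).trans hi'
      refine RunsTo.seq (RunsTo.store ?_ (RunsTo.assign ?_ ⟨?_, ?_, ?_, ?_, ?_, fun j hj hne => ?_⟩))
      · simp only [Term.cost, Term.eval, hv₃, g32, gx]
        omega
      · simp only [Term.cost, Term.eval, gx, Nat.size_one] at h2 ⊢
        omega
      · simp only [Term.eval, g32, gx, hv₃, hm₃, hm']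
        exact overlay_succ μ l i v
      · simp [Term.eval, gx]
      · simp [hx32.symm, g32]
      · simp [hx33.symm, hr₃ 33 (by norm_num), hL']
      · simp [hx34.symm, hr₃ 34 (by norm_num), hx']
      · simp [hne, hr₃ j (by omega), hr' j hj hne]
    · refine ⟨?_, ?_, ?_, ?_, ?_, fun j hj hne => ?_⟩
      · rw [overlay_zero]
        exact hm₂.trans (hm₁.trans hm)
      · simp [Term.eval]
      · simp [hx32.symm, h32]
      · simp [hx33.symm, h33]
      · simp [hx34.symm, Term.eval, hr x hx]
      · have : j ≠ 34 := by omega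
        simp [hne, this, hr j hj]
    · rintro s' ⟨hm', hi', hd', hd1', hy', hr'⟩
      refine RunsTo.assign ?_ ⟨fun j hj => ?_, hm'⟩
      · simp only [Term.cost, Term.eval, hy']
        omega
      · rcases eq_or_ne j x with rfl | hne
        · simp [Term.eval, hy']
        · simp [hne, hr' j hj hne]
  · simp only [fillTime]
    rw [← hB]
    nlinarith [Nat.zero_le (L * (lo.time b + len.time b)), Nat.zero_le (L * B)]

/-! ### Evaluation of derived expressions -/

namespace Exp

instance : Add Exp := ⟨bin .add⟩
instance : Sub Exp := ⟨bin .sub⟩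
instance : Mul Exp := ⟨bin .mul⟩
instance : Div Exp := ⟨bin .div⟩
instance : Max Exp := ⟨bin .max⟩
instance (c : ℕ) : OfNat Exp c := ⟨const c⟩

variable (μ env : ℕ → ℕ) (Y : List ℕ) (a b c e : Exp)

@[simp] theorem eval_add : (a + b).eval μ env = a.eval μ env + b.eval μ env := rfl
@[simp] theorem eval_sub : (a - b).eval μ env = a.eval μ env - b.eval μ env := rfl
@[simp] theorem eval_mul : (a * b).eval μ env = a.eval μ env * b.eval μ env := rfl
@[simp] theorem eval_div : (a / b).eval μ env = a.eval μ env / b.eval μ env := rfl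
@[simp] theorem eval_max : (max a b).eval μ env = max (a.eval μ env) (b.eval μ env) := rfl
@[simp] theorem eval_const (n : ℕ) : (const n).eval μ env = n := rfl
@[simp] theorem eval_ofNat (n : ℕ) : (ofNat(n) : Exp).eval μ env = n := rfl
@[simp] theorem eval_zero : (0 : Exp).eval μ env = 0 := rfl
@[simp] theorem eval_one : (1 : Exp).eval μ env = 1 := rfl
@[simp] theorem eval_var (i : ℕ) : (var i).eval μ env = env i := rfl
@[simp] theorem eval_load : (load a).eval μ env = μ (a.eval μ env) := rfl
@[simp] theorem eval_bind (x : ℕ) :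
    (bind x a e).eval μ env = e.eval μ (Function.update env x (a.eval μ env)) := rfl

@[simp] theorem wf_add : (a + b).WF Y ↔ a.WF Y ∧ b.WF Y := Iff.rfl
@[simp] theorem wf_sub : (a - b).WF Y ↔ a.WF Y ∧ b.WF Y := Iff.rfl
@[simp] theorem wf_mul : (a * b).WF Y ↔ a.WF Y ∧ b.WF Y := Iff.rfl
@[simp] theorem wf_div : (a / b).WF Y ↔ a.WF Y ∧ b.WF Y := Iff.rfl
@[simp] theorem wf_max : (max a b).WF Y ↔ a.WF Y ∧ b.WF Y := Iff.rfl
@[simp] theorem wf_const (n : ℕ) : (const n).WF Y := trivial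
@[simp] theorem wf_ofNat (n : ℕ) : (ofNat(n) : Exp).WF Y := trivial
@[simp] theorem wf_var (i : ℕ) : (var i).WF Y ↔ i < 32 := Iff.rfl
@[simp] theorem wf_load : (load a).WF Y ↔ a.WF Y := Iff.rfl
@[simp] theorem wf_bind (x : ℕ) :
    (bind x a e).WF Y ↔ x < 32 ∧ x ∉ Y ∧ a.WF Y ∧ e.WF Y := Iff.rfl

/-- The sum of the values of `e` for `x = 0, …, y - 1`. -/
def sum (x y : ℕ) (e : Exp) : Exp := big .add 0 x y e

/-- The product of the values of `e` for `x = 0, …, y - 1`. -/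
def prod (x y : ℕ) (e : Exp) : Exp := big .mul 1 x y e

/-- The maximum of the values of `e` for `x = 0, …, y - 1`. -/
def sup (x y : ℕ) (e : Exp) : Exp := big .max 0 x y e

@[simp] theorem eval_sum (x y : ℕ) : (sum x y e).eval μ env =
    ∑ i ∈ Finset.range (env y), e.eval μ (Function.update env x i) := by
  simp only [sum, eval]
  induction env y with
  | zero => rfl
  | succ n ih => rw [Finset.sum_range_succ, ← ih]; rfl

@[simp] theorem eval_prod (x y : ℕ) : (prod x y e).eval μ env =
    ∏ i ∈ Finset.range (env y), e.eval μ (Function.update env x i) := by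
  simp only [prod, eval]
  induction env y with
  | zero => rfl
  | succ n ih => rw [Finset.prod_range_succ, ← ih]; rfl

@[simp] theorem eval_sup (x y : ℕ) : (sup x y e).eval μ env =
    (Finset.range (env y)).sup fun i => e.eval μ (Function.update env x i) := by
  simp only [sup, eval]
  induction env y with
  | zero => rfl
  | succ n ih => rw [Finset.range_add_one, Finset.sup_insert, ← ih, sup_comm]; rfl

@[simp] theorem wf_sum (x y : ℕ) :
    (sum x y e).WF Y ↔ x < 32 ∧ y < 32 ∧ y ∈ Y ∧ e.WF (x :: Y) := Iff.rfl
@[simp] theorem wf_prod (x y : ℕ) :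
    (prod x y e).WF Y ↔ x < 32 ∧ y < 32 ∧ y ∈ Y ∧ e.WF (x :: Y) := Iff.rfl
@[simp] theorem wf_sup (x y : ℕ) :
    (sup x y e).WF Y ↔ x < 32 ∧ y < 32 ∧ y ∈ Y ∧ e.WF (x :: Y) := Iff.rfl

/-- The remainder of a division. -/
def mod : Exp := a - a / b * b

/-- The truth value of `a < b`. -/
def lt : Exp := 1 - (1 - (b - a))

/-- The truth value of `a = b`. -/
def eq : Exp := 1 - ((a - b) + (b - a))

/-- Choice between two values. -/
def ite (c a b : Exp) : Exp := (1 - (1 - c)) * a + (1 - c) * b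

@[simp] theorem eval_mod : (mod a b).eval μ env = a.eval μ env % b.eval μ env := by
  have := Nat.div_add_mod' (a.eval μ env) (b.eval μ env)
  simp only [mod, eval_sub, eval_mul, eval_div]
  omega

@[simp] theorem eval_lt :
    (lt a b).eval μ env = if a.eval μ env < b.eval μ env then 1 else 0 := by
  simp only [lt, eval_sub, eval_one]
  split_ifs <;> omega

@[simp] theorem eval_eq :
    (eq a b).eval μ env = if a.eval μ env = b.eval μ env then 1 else 0 := by
  simp only [eq, eval_sub, eval_one, eval_add]
  split_ifs <;> omega

@[simp] theorem eval_ite :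
    (ite c a b).eval μ env = if c.eval μ env = 0 then b.eval μ env else a.eval μ env := by
  simp only [ite, eval_sub, eval_one, eval_add, eval_mul]
  split_ifs with h
  · simp [h]
  · have : 1 - c.eval μ env = 0 := by omega
    simp [this]

@[simp] theorem wf_mod : (mod a b).WF Y ↔ a.WF Y ∧ b.WF Y := by simp [mod]
@[simp] theorem wf_lt : (lt a b).WF Y ↔ a.WF Y ∧ b.WF Y := by simp [lt]; tauto
@[simp] theorem wf_eq : (eq a b).WF Y ↔ a.WF Y ∧ b.WF Y := by simp [eq]; tauto
@[simp] theorem wf_ite : (ite c a b).WF Y ↔ c.WF Y ∧ a.WF Y ∧ b.WF Y := by simp [ite]; tauto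

/-- The entry with index `a` of the list `f 0, …, f (l - 1)`. -/
def table (f : ℕ → ℕ) : ℕ → Exp
  | 0 => 0
  | l + 1 => table f l + eq a (const l) * const (f l)

@[simp] theorem eval_table (f : ℕ → ℕ) (l : ℕ) :
    (table a f l).eval μ env = if a.eval μ env < l then f (a.eval μ env) else 0 := by
  induction l with
  | zero => simp [table]
  | succ l ih =>
    simp only [table, eval_add, ih, eval_mul, eval_eq, eval_const]
    rcases lt_trichotomy (a.eval μ env) l with h | h | h
    · simp [h, h.ne, h.trans (Nat.lt_succ_self l)]
    · simp [h]
    · have h1 : ¬ a.eval μ env < l := by omega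
      have h2 : ¬ a.eval μ env < l + 1 := by omega
      simp [h1, h2, h.ne']

theorem wf_table (f : ℕ → ℕ) (l : ℕ) (h : a.WF Y) : (table a f l).WF Y := by
  induction l with
  | zero => simp [table]
  | succ l ih => simp [table, h, ih]

/-- `a ^ min b y`, where `a` and `b` may not depend on the auxiliary variable `x`. -/
def pow (x y : ℕ) : Exp := prod x y (ite (lt (var x) b) a 1)

/-- The product has `env y` factors, of which the first `B` are `A` and the others are 1. This
allows exponents that may not bound an iteration themselves, as long as they are below a register
that may. -/
theorem eval_pow (x y A B : ℕ) (ha : ∀ i, a.eval μ (Function.update env x i) = A)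
    (hb : ∀ i, b.eval μ (Function.update env x i) = B) (hB : B ≤ env y) :
    (pow a b x y).eval μ env = A ^ B := by
  simp only [pow, eval_prod, eval_ite, eval_lt, eval_var, Function.update_self, ha, hb, eval_one]
  have : ∀ i, (if (if i < B then 1 else 0) = 0 then 1 else A) = if i < B then A else 1 := by
    intro i; split_ifs <;> simp_all
  simp only [this]
  rw [Finset.prod_ite, Finset.prod_const, Finset.prod_const_one, mul_one]
  congr 1
  rw [show (Finset.range (env y)).filter (· < B) = Finset.range B by ext i; simp; omega]
  simp

@[simp] theorem wf_pow (x y : ℕ) : (pow a b x y).WF Y ↔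
    x < 32 ∧ y < 32 ∧ y ∈ Y ∧ a.WF (x :: Y) ∧ b.WF (x :: Y) := by
  simp [pow]
  tauto

end Exp

end RAM

/-! ### Bilinear algorithms with integer coefficients -/

/-- Since A = A · 1 is recovered from the numbers `f i A`, these define an injective linear map from
a space of dimension N². The bound keeps arrays of about L² cells within the cost of the matrix
product. -/
theorem HasBilinearMatMul.mul_self_le {N r : ℕ} (h : HasBilinearMatMul N r) : N * N ≤ r := by
  obtain ⟨f, g, W, h⟩ := h
  let φ : Matrix (Fin N) (Fin N) ℚ →ₗ[ℚ] (Fin r → ℚ) := LinearMap.pi f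
  have hφ : Function.Injective φ := by
    rw [← LinearMap.ker_eq_bot, LinearMap.ker_eq_bot']
    intro A hA
    have h1 := h A 1
    rw [mul_one] at h1
    rw [h1]
    refine Finset.sum_eq_zero fun i _ => ?_
    have : f i A = 0 := congrFun hA i
    simp [this]
  have := LinearMap.finrank_le_finrank_of_injective hφ
  simpa [Module.finrank_matrix] using this

/-- The schoolbook algorithm. It is needed only to know that the infimum defining the exponent is
taken over a nonempty set. -/
theorem hasBilinearMatMul_cube (N : ℕ) : HasBilinearMatMul N (N * N * N) := by
  classical
  let e : Fin (N * N * N) ≃ (Fin N × Fin N) × Fin N :=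
    (finProdFinEquiv.symm).trans (Equiv.prodCongr finProdFinEquiv.symm (Equiv.refl _))
  refine ⟨fun q => Matrix.entryLinearMap ℚ ℚ (e q).1.1 (e q).1.2,
    fun q => Matrix.entryLinearMap ℚ ℚ (e q).1.2 (e q).2,
    fun q => Matrix.single (e q).1.1 (e q).2 1, fun A B => ?_⟩
  rw [Equiv.sum_comp e fun t => (Matrix.entryLinearMap ℚ ℚ t.1.1 t.1.2 A *
    Matrix.entryLinearMap ℚ ℚ t.1.2 t.2 B) • Matrix.single t.1.1 t.2 (1 : ℚ)]
  ext i j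
  simp only [Fintype.sum_prod_type, Matrix.entryLinearMap_apply, Matrix.sum_apply,
    Matrix.smul_apply, Matrix.single_apply, Matrix.mul_apply, smul_eq_mul, mul_ite, mul_one,
    mul_zero]
  symm
  rw [Finset.sum_eq_single i]
  · refine Finset.sum_congr rfl fun l _ => ?_
    rw [Finset.sum_eq_single j] <;> simp +contextual
  · intro b _ hb
    simp [hb]
  · simp

theorem exists_common_denominator {ι : Type*} [Fintype ι] (q : ι → ℚ) :
    ∃ D : ℕ, 0 < D ∧ ∀ i, ∃ z : ℤ, (z : ℚ) = D * q i := by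
  classical
  refine ⟨∏ i, (q i).den, Finset.prod_pos fun i _ => (q i).den_pos, fun i => ?_⟩
  refine ⟨(q i).num * ∏ j ∈ Finset.univ.erase i, ((q j).den : ℤ), ?_⟩
  rw [← Finset.mul_prod_erase _ _ (Finset.mem_univ i)]
  push_cast
  have := Rat.mul_den_eq_num (q i)
  rw [← this]
  ring

/-- A bilinear algorithm for matrix multiplication, scaled to integer coefficients, with matrix
entries numbered row by row. -/
def IsMatMulScheme (N r D : ℕ) (F G W : ℕ → ℕ → ℤ) : Prop :=
  ∀ a < N * N, ∀ b < N * N, ∀ c < N * N, ∑ q ∈ Finset.range r, F q a * G q b * W c q =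
    if a / N = c / N ∧ a % N = b / N ∧ b % N = c % N then (D : ℤ) else 0

/-- The algorithm is evaluated on pairs of matrix units, where it becomes a system of equations
between coefficients. The denominators of the three families are cleared separately, and `D` is the
product of the three common denominators. -/
theorem HasBilinearMatMul.exists_scheme {N r : ℕ} (hN : 0 < N) (h : HasBilinearMatMul N r) :
    ∃ (D : ℕ) (F G W : ℕ → ℕ → ℤ), 0 < D ∧ IsMatMulScheme N r D F G W := by
  classical
  obtain ⟨f, g, W, h⟩ := h
  have hdiv : ∀ {a}, a < N * N → a / N < N := fun ha => Nat.div_lt_of_lt_mul ha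
  have hmod : ∀ a, a % N < N := fun a => Nat.mod_lt a hN
  let E : Fin N × Fin N → Matrix (Fin N) (Fin N) ℚ := fun t => Matrix.single t.1 t.2 1
  obtain ⟨D₁, hD₁, hF⟩ := exists_common_denominator fun t : Fin r × (Fin N × Fin N) => f t.1 (E t.2)
  obtain ⟨D₂, hD₂, hG⟩ := exists_common_denominator fun t : Fin r × (Fin N × Fin N) => g t.1 (E t.2)
  obtain ⟨D₃, hD₃, hW⟩ := exists_common_denominator fun t : Fin r × (Fin N × Fin N) =>
    W t.1 t.2.1 t.2.2
  choose F hF using hF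
  choose G hG using hG
  choose Z hZ using hW
  let ent : ∀ a, a < N * N → Fin N × Fin N := fun a ha => (⟨a / N, hdiv ha⟩, ⟨a % N, hmod a⟩)
  refine ⟨D₁ * D₂ * D₃,
    fun q a => if hq : q < r ∧ a < N * N then F (⟨q, hq.1⟩, ent a hq.2) else 0,
    fun q a => if hq : q < r ∧ a < N * N then G (⟨q, hq.1⟩, ent a hq.2) else 0,
    fun a q => if hq : q < r ∧ a < N * N then Z (⟨q, hq.1⟩, ent a hq.2) else 0,
    by positivity, fun a ha b hb c hc => ?_⟩
  have key := congrFun (congrFun (h (E (ent a ha)) (E (ent b hb))) (ent c hc).1) (ent c hc).2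
  have hcast : ∀ x y : ℤ, (x : ℚ) = y → x = y := fun x y => by exact_mod_cast id
  apply hcast
  rw [Finset.sum_range]
  push_cast
  have : ∀ q : Fin r, ((if hq : (q : ℕ) < r ∧ a < N * N then F (⟨q, hq.1⟩, ent a hq.2) else 0 : ℤ) : ℚ)
      * ((if hq : (q : ℕ) < r ∧ b < N * N then G (⟨q, hq.1⟩, ent b hq.2) else 0 : ℤ) : ℚ)
      * ((if hq : (q : ℕ) < r ∧ c < N * N then Z (⟨q, hq.1⟩, ent c hq.2) else 0 : ℤ) : ℚ)
      = (D₁ * D₂ * D₃) * ((f q (E (ent a ha)) * g q (E (ent b hb))) •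
        W q (ent c hc).1 (ent c hc).2) := by
    intro q
    rw [dif_pos ⟨q.2, ha⟩, dif_pos ⟨q.2, hb⟩, dif_pos ⟨q.2, hc⟩, hF, hG, hZ, smul_eq_mul]
    ring
  rw [Finset.sum_congr rfl fun q _ => this q, ← Finset.mul_sum]
  simp only [Matrix.sum_apply, Matrix.smul_apply] at key
  rw [← key]
  simp only [E, ent]
  by_cases h1 : a % N = b / N
  · have e1 : (⟨b / N, hdiv hb⟩ : Fin N) = ⟨a % N, hmod a⟩ := by simp [h1]
    rw [e1, Matrix.single_mul_single_same, Matrix.single_apply]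
    simp only [h1, Fin.mk.injEq, true_and, mul_ite, mul_one, mul_zero]
  · rw [Matrix.single_mul_single_of_ne]
    · simp [h1]
    · simpa [Fin.ext_iff] using h1

/-! ### Yates' algorithm for Kronecker powers -/

theorem Finset.sum_range_mul_split {R : Type*} [AddCommMonoid R] (n d : ℕ) (g : ℕ → R) :
    ∑ p ∈ Finset.range (n * d), g p =
      ∑ a ∈ Finset.range n, ∑ i ∈ Finset.range d, g (a * d + i) := by
  induction n with
  | zero => simp
  | succ n ih => rw [Nat.succ_mul, Finset.sum_range_add, ih, Finset.sum_range_succ]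

section Kronecker

variable {R : Type*} [CommRing R]

/-- Entry `(q, p)` of the `k`-th Kronecker power of a `dout × din` matrix. -/
def kron (F : ℕ → ℕ → R) (dout din : ℕ) : ℕ → ℕ → ℕ → R
  | 0, _, _ => 1
  | k + 1, q, p => F (q % dout) (p % din) * kron F dout din k (q / dout) (p / din)

/-- At level `j` an index consists of the input digits not yet processed, forming `t`, followed by
`j` output digits, forming `q`. One level removes the most significant input digit `i`, sums over
it, and appends an output digit at the least significant place. -/
theorem yates_level {F : ℕ → ℕ → R} {dout din k : ℕ} (hin : 0 < din) (hout : 0 < dout)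
    (u : ℕ → ℕ → R)
    (hu : ∀ j < k, ∀ p < din ^ (k - 1 - j) * dout ^ (j + 1), u (j + 1) p =
      ∑ i ∈ Finset.range din, F (p % dout) i * u j (i * (din ^ (k - 1 - j) * dout ^ j) + p / dout))
    (j : ℕ) (hj : j ≤ k) (t : ℕ) (ht : t < din ^ (k - j)) (q : ℕ) (hq : q < dout ^ j) :
    u j (t * dout ^ j + q) =
      ∑ p ∈ Finset.range (din ^ j), kron F dout din j q p * u 0 (p * din ^ (k - j) + t) := by
  induction j generalizing t q with
  | zero =>
    obtain rfl : q = 0 := by simpa using hq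
    simp [kron]
  | succ j ih =>
    have hk : k - (j + 1) = k - 1 - j := by omega
    have hlt : t * dout ^ (j + 1) + q < din ^ (k - 1 - j) * dout ^ (j + 1) := by
      rw [hk] at ht
      calc t * dout ^ (j + 1) + q < (t + 1) * dout ^ (j + 1) := by rw [Nat.succ_mul]; omega
        _ ≤ _ := Nat.mul_le_mul_right _ ht
    rw [hu j (by omega) _ hlt, pow_succ din, Finset.sum_range_mul_split, Finset.sum_comm]
    refine Finset.sum_congr rfl fun i hi => ?_
    rw [Finset.mem_range] at hi
    have h1 : (t * dout ^ (j + 1) + q) % dout = q % dout := by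
      rw [pow_succ, ← mul_assoc, Nat.add_comm, Nat.add_mul_mod_self_right]
    have h2 : (t * dout ^ (j + 1) + q) / dout = t * dout ^ j + q / dout := by
      rw [pow_succ, ← mul_assoc, Nat.add_comm, Nat.add_mul_div_right _ _ hout, Nat.add_comm]
    have h3 : i * (din ^ (k - 1 - j) * dout ^ j) + (t * dout ^ j + q / dout) =
        (i * din ^ (k - 1 - j) + t) * dout ^ j + q / dout := by ring
    have h4 : i * din ^ (k - 1 - j) + t < din ^ (k - j) := by
      rw [show k - j = k - 1 - j + 1 by omega, pow_succ']
      rw [hk] at ht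
      calc i * din ^ (k - 1 - j) + t < (i + 1) * din ^ (k - 1 - j) := by rw [Nat.succ_mul]; omega
        _ ≤ _ := Nat.mul_le_mul_right _ hi
    have h5 : q / dout < dout ^ j := Nat.div_lt_of_lt_mul (by rwa [← pow_succ'])
    rw [h1, h2, h3, ih (by omega) _ h4 _ h5, Finset.mul_sum]
    refine Finset.sum_congr rfl fun p _ => ?_
    have h6 : (p * din + i) % din = i := by
      rw [Nat.add_comm, Nat.add_mul_mod_self_right, Nat.mod_eq_of_lt hi]
    have h7 : (p * din + i) / din = p := by
      rw [Nat.add_comm, Nat.add_mul_div_right _ _ hin, Nat.div_eq_of_lt hi, Nat.zero_add]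
    have h8 : (p * din + i) * din ^ (k - (j + 1)) + t =
        p * din ^ (k - j) + (i * din ^ (k - 1 - j) + t) := by
      rw [hk, show k - j = k - 1 - j + 1 by omega, pow_succ']
      ring
    rw [kron, h6, h7, h8]
    ring

theorem yates {F : ℕ → ℕ → R} {dout din k : ℕ} (hin : 0 < din) (hout : 0 < dout)
    (u : ℕ → ℕ → R)
    (hu : ∀ j < k, ∀ p < din ^ (k - 1 - j) * dout ^ (j + 1), u (j + 1) p =
      ∑ i ∈ Finset.range din, F (p % dout) i * u j (i * (din ^ (k - 1 - j) * dout ^ j) + p / dout))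
    (q : ℕ) (hq : q < dout ^ k) :
    u k q = ∑ p ∈ Finset.range (din ^ k), kron F dout din k q p * u 0 p := by
  simpa using yates_level hin hout u hu k le_rfl 0 (by simp) q hq

/-! ### Interleaved indices and Kronecker powers of the matrix multiplication tensor -/

/-- The row of entry `p` of an `N ^ k × N ^ k` matrix in interleaved order. -/
def rowIndex (N : ℕ) : ℕ → ℕ → ℕ
  | 0, _ => 0
  | k + 1, p => rowIndex N k (p / (N * N)) * N + p % (N * N) / N

/-- The column of entry `p` of an `N ^ k × N ^ k` matrix in interleaved order. -/
def colIndex (N : ℕ) : ℕ → ℕ → ℕ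
  | 0, _ => 0
  | k + 1, p => colIndex N k (p / (N * N)) * N + p % (N * N) % N

theorem rowIndex_eq_sum (N k p : ℕ) : rowIndex N k p =
    ∑ j ∈ Finset.range k, p / (N * N) ^ j % (N * N) / N * N ^ j := by
  induction k generalizing p with
  | zero => simp [rowIndex]
  | succ k ih =>
    rw [rowIndex, ih, Finset.sum_range_succ', Finset.sum_mul]
    congr 1
    · refine Finset.sum_congr rfl fun j _ => ?_
      rw [pow_succ' (N * N), Nat.div_div_eq_div_mul p (N * N), pow_succ N, mul_assoc]
    · simp

theorem colIndex_eq_sum (N k p : ℕ) : colIndex N k p =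
    ∑ j ∈ Finset.range k, p / (N * N) ^ j % (N * N) % N * N ^ j := by
  induction k generalizing p with
  | zero => simp [colIndex]
  | succ k ih =>
    rw [colIndex, ih, Finset.sum_range_succ', Finset.sum_mul]
    congr 1
    · refine Finset.sum_congr rfl fun j _ => ?_
      rw [pow_succ' (N * N), Nat.div_div_eq_div_mul p (N * N), pow_succ N, mul_assoc]
    · simp

theorem mul_add_lt_pow_succ {N k x y : ℕ} (hx : x < N ^ k) (hy : y < N) :
    x * N + y < N ^ (k + 1) := by
  rw [pow_succ]
  calc x * N + y < (x + 1) * N := by rw [Nat.succ_mul]; omega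
    _ ≤ _ := Nat.mul_le_mul_right _ hx

theorem rowIndex_lt {N : ℕ} (hN : 0 < N) (k p : ℕ) : rowIndex N k p < N ^ k := by
  induction k generalizing p with
  | zero => simp [rowIndex]
  | succ k ih =>
    exact mul_add_lt_pow_succ (ih _) (Nat.div_lt_of_lt_mul (Nat.mod_lt _ (Nat.mul_pos hN hN)))

theorem colIndex_lt {N : ℕ} (hN : 0 < N) (k p : ℕ) : colIndex N k p < N ^ k := by
  induction k generalizing p with
  | zero => simp [colIndex]
  | succ k ih => exact mul_add_lt_pow_succ (ih _) (Nat.mod_lt _ hN)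

/-- Each digit of `p` in base N² is a pair of base N digits, so `p` corresponds bijectively to its
row and column; the induction splits off the lowest digit. -/
theorem sum_rowIndex_colIndex {M : Type*} [AddCommMonoid M] {N : ℕ} (hN : 0 < N) (k : ℕ)
    (g : ℕ → ℕ → M) :
    ∑ p ∈ Finset.range ((N * N) ^ k), g (rowIndex N k p) (colIndex N k p) =
      ∑ i ∈ Finset.range (N ^ k), ∑ l ∈ Finset.range (N ^ k), g i l := by
  induction k generalizing g with
  | zero => simp [rowIndex, colIndex]
  | succ k ih =>
    rw [pow_succ (N * N), Finset.sum_range_mul_split, pow_succ N, Finset.sum_range_mul_split]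
    have h : ∀ a, ∀ i ∈ Finset.range (N * N), g (rowIndex N (k + 1) (a * (N * N) + i))
        (colIndex N (k + 1) (a * (N * N) + i)) =
        g (rowIndex N k a * N + i / N) (colIndex N k a * N + i % N) := by
      intro a i hi
      rw [Finset.mem_range] at hi
      have h6 : (a * (N * N) + i) % (N * N) = i := by
        rw [Nat.add_comm, Nat.add_mul_mod_self_right, Nat.mod_eq_of_lt hi]
      have h7 : (a * (N * N) + i) / (N * N) = a := by
        rw [Nat.add_comm, Nat.add_mul_div_right _ _ (Nat.mul_pos hN hN), Nat.div_eq_of_lt hi,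
          Nat.zero_add]
      rw [rowIndex, colIndex, h6, h7]
    rw [Finset.sum_congr rfl fun a _ => Finset.sum_congr rfl (h a)]
    rw [ih fun x y => ∑ i ∈ Finset.range (N * N), g (x * N + i / N) (y * N + i % N)]
    refine Finset.sum_congr rfl fun x _ => ?_
    simp only [Finset.sum_range_mul_split]
    rw [Finset.sum_comm]
    refine Finset.sum_congr rfl fun s hs => ?_
    refine Finset.sum_congr rfl fun y _ => Finset.sum_congr rfl fun t ht => ?_
    rw [Finset.mem_range] at hs ht
    rw [Nat.add_comm (s * N) t, Nat.add_mul_mod_self_right, Nat.mod_eq_of_lt ht,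
      Nat.add_mul_div_right _ _ hN, Nat.div_eq_of_lt ht, Nat.zero_add]

theorem digits_eq_iff {N x y x' y' : ℕ} (hy : y < N) (hy' : y' < N) :
    x * N + y = x' * N + y' ↔ x = x' ∧ y = y' := by
  constructor
  · intro h
    have hN : 0 < N := by omega
    have h1 := congrArg (· / N) h
    have h2 := congrArg (· % N) h
    simp only [Nat.add_comm _ y, Nat.add_comm _ y', Nat.add_mul_div_right _ _ hN,
      Nat.div_eq_of_lt hy, Nat.div_eq_of_lt hy', Nat.add_mul_mod_self_right,
      Nat.mod_eq_of_lt hy, Nat.mod_eq_of_lt hy', Nat.zero_add] at h1 h2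
    exact ⟨h1, h2⟩
  · rintro ⟨rfl, rfl⟩
    rfl

/-- The k-th tensor power of ⟨N, N, N⟩ is ⟨N^k, N^k, N^k⟩. Splitting off the lowest digits factors
the sum into the one for `k` and one instance of `h`, and equality of indices is equality of digits.
-/
theorem kron_scheme {N r D : ℕ} (hN : 0 < N) {F G W : ℕ → ℕ → R}
    (h : ∀ a < N * N, ∀ b < N * N, ∀ c < N * N, ∑ q ∈ Finset.range r, F q a * G q b * W c q =
      if a / N = c / N ∧ a % N = b / N ∧ b % N = c % N then (D : R) else 0) (k a b c : ℕ) :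
    ∑ q ∈ Finset.range (r ^ k), kron F r (N * N) k q a * kron G r (N * N) k q b *
        kron W (N * N) r k c q =
      if rowIndex N k a = rowIndex N k c ∧ colIndex N k a = rowIndex N k b ∧
        colIndex N k b = colIndex N k c then (D : R) ^ k else 0 := by
  have hNN : 0 < N * N := Nat.mul_pos hN hN
  induction k generalizing a b c with
  | zero => simp [kron, rowIndex, colIndex]
  | succ k ih =>
    rw [pow_succ r, Finset.sum_range_mul_split]
    have h1 : ∀ s ∈ Finset.range (r ^ k), ∀ t ∈ Finset.range r,
        kron F r (N * N) (k + 1) (s * r + t) a * kron G r (N * N) (k + 1) (s * r + t) b *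
          kron W (N * N) r (k + 1) c (s * r + t) =
        (kron F r (N * N) k s (a / (N * N)) * kron G r (N * N) k s (b / (N * N)) *
          kron W (N * N) r k (c / (N * N)) s) *
        (F t (a % (N * N)) * G t (b % (N * N)) * W (c % (N * N)) t) := by
      intro s _ t ht
      rw [Finset.mem_range] at ht
      have h6 : (s * r + t) % r = t := by
        rw [Nat.add_comm, Nat.add_mul_mod_self_right, Nat.mod_eq_of_lt ht]
      have h7 : (s * r + t) / r = s := by
        rw [Nat.add_comm, Nat.add_mul_div_right _ _ (by omega), Nat.div_eq_of_lt ht, Nat.zero_add]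
      simp only [kron, h6, h7]
      ring
    rw [Finset.sum_congr rfl fun s hs => Finset.sum_congr rfl (h1 s hs)]
    simp only [← Finset.mul_sum, ← Finset.sum_mul]
    rw [ih, h _ (Nat.mod_lt _ hNN) _ (Nat.mod_lt _ hNN) _ (Nat.mod_lt _ hNN)]
    simp only [rowIndex, colIndex]
    have hd : ∀ x, x % (N * N) / N < N := fun x =>
      Nat.div_lt_of_lt_mul (Nat.mod_lt _ hNN)
    have hm : ∀ x, x % (N * N) % N < N := fun x => Nat.mod_lt _ hN
    simp only [digits_eq_iff (hd a) (hd c), digits_eq_iff (hm a) (hd b),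
      digits_eq_iff (hm b) (hm c)]
    rw [ite_zero_mul_ite_zero, pow_succ]
    congr 1
    apply propext
    tauto

/-- Matrix multiplication by Kronecker powers of a bilinear algorithm. -/
theorem kron_matMul {N r D : ℕ} (hN : 0 < N) {F G W : ℕ → ℕ → R}
    (h : ∀ a < N * N, ∀ b < N * N, ∀ c < N * N, ∑ q ∈ Finset.range r, F q a * G q b * W c q =
      if a / N = c / N ∧ a % N = b / N ∧ b % N = c % N then (D : R) else 0) (k c : ℕ)
    (A B : ℕ → ℕ → R) :
    ∑ q ∈ Finset.range (r ^ k), kron W (N * N) r k c q *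
      ((∑ a ∈ Finset.range ((N * N) ^ k),
          kron F r (N * N) k q a * A (rowIndex N k a) (colIndex N k a)) *
        ∑ b ∈ Finset.range ((N * N) ^ k),
          kron G r (N * N) k q b * B (rowIndex N k b) (colIndex N k b)) =
      (D : R) ^ k * ∑ l ∈ Finset.range (N ^ k), A (rowIndex N k c) l * B l (colIndex N k c) := by
  have h1 : ∀ q, kron W (N * N) r k c q *
      ((∑ a ∈ Finset.range ((N * N) ^ k),
          kron F r (N * N) k q a * A (rowIndex N k a) (colIndex N k a)) *
        ∑ b ∈ Finset.range ((N * N) ^ k),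
          kron G r (N * N) k q b * B (rowIndex N k b) (colIndex N k b)) =
      ∑ a ∈ Finset.range ((N * N) ^ k), ∑ b ∈ Finset.range ((N * N) ^ k),
        (kron F r (N * N) k q a * kron G r (N * N) k q b * kron W (N * N) r k c q) *
        (A (rowIndex N k a) (colIndex N k a) * B (rowIndex N k b) (colIndex N k b)) := by
    intro q
    rw [Finset.sum_mul_sum, Finset.mul_sum]
    refine Finset.sum_congr rfl fun a _ => ?_
    rw [Finset.mul_sum]
    refine Finset.sum_congr rfl fun b _ => ?_
    ring
  rw [Finset.sum_congr rfl fun q _ => h1 q, Finset.sum_comm]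
  -- With the sum over `q` innermost, the coefficients collapse to an indicator of matching indices.
  -- Interleaved indices are then traded for pairs of row and column, and a single sum over the
  -- middle index survives.
  simp_rw [Finset.sum_comm (s := Finset.range (r ^ k)), ← Finset.sum_mul, kron_scheme hN h]
  rw [sum_rowIndex_colIndex hN k fun i l => ∑ b ∈ Finset.range ((N * N) ^ k),
    (if i = rowIndex N k c ∧ l = rowIndex N k b ∧ colIndex N k b = colIndex N k c
      then (D : R) ^ k else 0) * (A i l * B (rowIndex N k b) (colIndex N k b))]
  simp_rw [fun i l => sum_rowIndex_colIndex hN k fun i' l' =>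
    (if i = rowIndex N k c ∧ l = i' ∧ l' = colIndex N k c
      then (D : R) ^ k else 0) * (A i l * B i' l')]
  rw [Finset.sum_eq_single (rowIndex N k c)]
  · rw [Finset.mul_sum]
    refine Finset.sum_congr rfl fun l hl => ?_
    rw [Finset.sum_eq_single l, Finset.sum_eq_single (colIndex N k c)]
    · simp
    · intro b _ hb
      simp [hb]
    · intro hb
      exact absurd (Finset.mem_range.2 (colIndex_lt hN k c)) hb
    · intro b _ hb
      refine Finset.sum_eq_zero fun _ _ => ?_
      simp [hb.symm]
    · exact fun hb => absurd hl hb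
  · intro i _ hi
    refine Finset.sum_eq_zero fun _ _ => Finset.sum_eq_zero fun _ _ => Finset.sum_eq_zero
      fun _ _ => ?_
    simp [hi]
  · intro hb
    exact absurd (Finset.mem_range.2 (rowIndex_lt hN k c)) hb

end Kronecker

/-! ### Binary digits -/

/-- Digit `v` of `X` in base two. -/
def bitn (X v : ℕ) : ℕ := X / 2 ^ v % 2

theorem bitn_eq_toNat (X v : ℕ) : bitn X v = (X.testBit v).toNat := by
  rw [bitn, Nat.testBit_eq_decide_div_mod_eq]
  rcases Nat.mod_two_eq_zero_or_one (X / 2 ^ v) with h | h <;> simp [h]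

theorem bitn_eq_one_iff {X v : ℕ} : bitn X v = 1 ↔ X.testBit v = true := by
  rw [bitn_eq_toNat]
  cases X.testBit v <;> simp

theorem bitn_le_one (X v : ℕ) : bitn X v ≤ 1 := by
  rw [bitn_eq_toNat]
  exact Bool.toNat_le _

theorem bitn_add_two_pow_mul {m x : ℕ} (hx : x < 2 ^ m) (y v : ℕ) :
    bitn (x + 2 ^ m * y) v = if v < m then bitn x v else bitn y (v - m) := by
  simp only [bitn_eq_toNat]
  rw [Nat.add_comm, Nat.testBit_two_pow_mul_add y hx]
  split_ifs <;> rfl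

theorem bitn_zero (v : ℕ) : bitn 0 v = 0 := by simp [bitn]

theorem bitn_of_lt {X v s : ℕ} (hX : X < 2 ^ s) (hv : s ≤ v) : bitn X v = 0 := by
  rw [bitn, Nat.div_eq_of_lt (hX.trans_le (Nat.pow_le_pow_right (by norm_num) hv)), Nat.zero_mod]

theorem two_pow_le_of_bitn {T i : ℕ} (h : bitn T i = 1) : 2 ^ i ≤ T := by
  by_contra hlt
  rw [bitn, Nat.div_eq_of_lt (not_le.1 hlt)] at h
  simp at h

/-- No borrow occurs: T is a part below 2^i plus 2^i times an odd number, and the subtraction makes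
that number even. -/
theorem bitn_sub_two_pow {T i : ℕ} (h : bitn T i = 1) (j : ℕ) :
    bitn (T - 2 ^ i) j = if j = i then 0 else bitn T j := by
  have hb : T % 2 ^ i < 2 ^ i := Nat.mod_lt _ (by positivity)
  obtain ⟨a, ha⟩ : ∃ a, T / 2 ^ i = 2 * a + 1 := ⟨T / 2 ^ i / 2, by
    rw [bitn] at h
    omega⟩
  have hT : T = T % 2 ^ i + 2 ^ i * (2 * a + 1) := by
    rw [← ha, Nat.add_comm]
    exact (Nat.div_add_mod T (2 ^ i)).symm
  have hT' : T - 2 ^ i = T % 2 ^ i + 2 ^ i * (2 * a) := by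
    rw [Nat.mul_add, Nat.mul_one] at hT
    omega
  rw [hT', bitn_add_two_pow_mul hb]
  conv_rhs => rw [hT, bitn_add_two_pow_mul hb]
  rcases lt_trichotomy j i with hj | rfl | hj
  · simp [hj, hj.ne]
  · simp [bitn]
  · have h1 : ¬ j < i := by omega
    have h2 : j ≠ i := by omega
    obtain ⟨d, hd⟩ : ∃ d, j - i = d + 1 := ⟨j - i - 1, by omega⟩
    simp only [h1, h2, if_false, hd, bitn, pow_succ', ← Nat.div_div_eq_div_mul]
    congr 2
    omega

/-- The positions below `s` of the nonzero binary digits of `T`. -/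
def bitSet (s T : ℕ) : Finset ℕ := (Finset.range s).filter fun i => bitn T i = 1

theorem mem_bitSet {s T i : ℕ} : i ∈ bitSet s T ↔ i < s ∧ bitn T i = 1 := by
  simp [bitSet]

theorem bitSet_subset (s T : ℕ) : bitSet s T ⊆ Finset.range s := Finset.filter_subset _ _

theorem exists_bitSet_eq {s : ℕ} {S : Finset ℕ} (hS : S ⊆ Finset.range s) :
    ∃ X < 2 ^ s, bitSet s X = S := by
  refine ⟨Nat.ofBits fun i : Fin s => decide ((i : ℕ) ∈ S), Nat.ofBits_lt_two_pow _, ?_⟩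
  ext i
  rw [mem_bitSet, bitn_eq_one_iff]
  constructor
  · rintro ⟨hi, h⟩
    rw [Nat.testBit_ofBits_lt _ _ hi] at h
    simpa using h
  · intro h
    have hi := Finset.mem_range.1 (hS h)
    refine ⟨hi, ?_⟩
    rw [Nat.testBit_ofBits_lt _ _ hi]
    simpa using h

theorem eq_zero_of_bitSet_eq_empty {s T : ℕ} (hT : T < 2 ^ s) (h : bitSet s T = ∅) : T = 0 := by
  refine Nat.eq_of_testBit_eq fun i => ?_
  rw [Nat.zero_testBit]
  by_contra hi
  rw [Bool.not_eq_false, ← bitn_eq_one_iff] at hi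
  rcases lt_or_ge i s with his | his
  · have : i ∈ bitSet s T := mem_bitSet.2 ⟨his, hi⟩
    simp [h] at this
  · rw [bitn_of_lt hT his] at hi
    simp at hi

theorem bitSet_sub_two_pow {s T i : ℕ} (h : bitn T i = 1) :
    bitSet s (T - 2 ^ i) = (bitSet s T).erase i := by
  ext j
  rw [Finset.mem_erase, mem_bitSet, mem_bitSet, bitn_sub_two_pow h]
  split_ifs with hj <;> simp [hj]

theorem bitSet_two_pow_sub_one (s : ℕ) : bitSet s (2 ^ s - 1) = Finset.range s := by
  ext i
  rw [mem_bitSet, bitn_eq_one_iff, Nat.testBit_two_pow_sub_one]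
  simp

theorem sum_bitn_mul {s T n : ℕ} (hT : T < 2 ^ s) (hs : s ≤ n) (f : ℕ → ℕ) :
    ∑ j ∈ Finset.range n, bitn T j * f j = ∑ j ∈ bitSet s T, f j := by
  rw [bitSet, Finset.sum_filter, ← Finset.sum_subset (Finset.range_mono hs)]
  · refine Finset.sum_congr rfl fun j _ => ?_
    have := bitn_le_one T j
    split_ifs with h
    · simp [h]
    · simp [show bitn T j = 0 by omega]
  · intro j _ hj
    rw [Finset.mem_range, not_lt] at hj
    rw [bitn_of_lt hT hj, Nat.zero_mul]

/-! ### Sums of powers -/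

/-- If t is the largest exponent, the sum lies between Z^t and L · Z^t, which is less than Z^(t+1).
Hence exactly the indices i < t are counted, and comparisons with powers of Z read off the maximum.
-/
theorem sum_indicator_pow_le {Z L d : ℕ} (hL : 0 < L) (hZ : L < Z) (f : ℕ → ℕ)
    (hf : ∀ y < L, f y < d) :
    (∑ i ∈ Finset.range d, if Z ^ (i + 1) ≤ ∑ y ∈ Finset.range L, Z ^ f y then 1 else 0) =
      (Finset.range L).sup f := by
  have hZ1 : 1 < Z := by omega
  have key : ∀ i, Z ^ (i + 1) ≤ ∑ y ∈ Finset.range L, Z ^ f y ↔ i < (Finset.range L).sup f := by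
    intro i
    rw [Finset.lt_sup_iff]
    constructor
    · intro h
      by_contra! hcon
      have h1 : ∑ y ∈ Finset.range L, Z ^ f y ≤ L * Z ^ i := by
        calc _ ≤ ∑ y ∈ Finset.range L, Z ^ i :=
              Finset.sum_le_sum fun y hy => Nat.pow_le_pow_right (by omega) (hcon y hy)
          _ = _ := by simp
      have h2 : L * Z ^ i < Z ^ (i + 1) := by
        rw [pow_succ']
        exact Nat.mul_lt_mul_of_pos_right hZ (by positivity)
      omega
    · rintro ⟨y, hy, hi⟩
      calc Z ^ (i + 1) ≤ Z ^ f y := Nat.pow_le_pow_right (by omega) hi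
        _ ≤ _ := Finset.single_le_sum (f := fun y => Z ^ f y) (fun _ _ => Nat.zero_le _) hy
  simp only [key]
  rw [← Finset.sum_filter, Finset.sum_const, smul_eq_mul, mul_one]
  have hle : (Finset.range L).sup f ≤ d :=
    Finset.sup_le fun y hy => (hf y (Finset.mem_range.1 hy)).le
  generalize (Finset.range L).sup f = t at hle ⊢
  rw [show (Finset.range d).filter (· < t) = Finset.range t by ext i; simp; omega]
  simp

/-! ### Balanced cuts -/

/-- The class of a pair of vertices in a vertex set that consists of three blocks of size `m`. -/
def pairClass (m u v : ℕ) : ℕ :=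
  if u < 2 * m ∧ v < 2 * m then 0 else if u < m ∨ v < m then 2 else 1

/-- The contribution of class `c` to the weight of the cut with mask `X`. -/
def classWeight (adj : ℕ → ℕ → ℕ) (K n m c X : ℕ) : ℕ :=
  ∑ u ∈ Finset.range n, ∑ v ∈ Finset.range n,
    if pairClass m u v = c then (1 - bitn X u) * bitn X v * (K - adj u v) else 0

/-- The weight of the cut with mask `X`. -/
def cutWeight (adj : ℕ → ℕ → ℕ) (K n X : ℕ) : ℕ :=
  ∑ u ∈ Finset.range n, ∑ v ∈ Finset.range n, (1 - bitn X u) * bitn X v * (K - adj u v)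

/-- The number of arcs that enter `S`. -/
def cutSize (adj : ℕ → ℕ → ℕ) (n : ℕ) (S : Finset ℕ) : ℕ :=
  ∑ u ∈ Finset.range n \ S, ∑ v ∈ S, adj u v

section Cut

variable {adj : ℕ → ℕ → ℕ} {K n m : ℕ}

theorem classWeight_add (X : ℕ) : classWeight adj K n m 0 X + classWeight adj K n m 1 X +
    classWeight adj K n m 2 X = cutWeight adj K n X := by
  simp only [classWeight, cutWeight, ← Finset.sum_add_distrib]
  refine Finset.sum_congr rfl fun u _ => Finset.sum_congr rfl fun v _ => ?_
  have : pairClass m u v = 0 ∨ pairClass m u v = 1 ∨ pairClass m u v = 2 := by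
    rw [pairClass]; split_ifs <;> simp
  rcases this with h | h | h <;> simp [h]

/-- Used to show that a class ignores one block of the mask, which can then be replaced by 0. -/
theorem classWeight_congr {c X X' : ℕ}
    (h : ∀ u v, pairClass m u v = c → bitn X u = bitn X' u ∧ bitn X v = bitn X' v) :
    classWeight adj K n m c X = classWeight adj K n m c X' := by
  refine Finset.sum_congr rfl fun u _ => Finset.sum_congr rfl fun v _ => ?_
  split_ifs with hc
  · rw [(h u v hc).1, (h u v hc).2]
  · rfl

theorem classWeight_le (c X : ℕ) : classWeight adj K n m c X ≤ n * (n * K) := by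
  calc classWeight adj K n m c X
      ≤ ∑ u ∈ Finset.range n, ∑ v ∈ Finset.range n, K := by
        refine Finset.sum_le_sum fun u _ => Finset.sum_le_sum fun v _ => ?_
        split_ifs
        · calc (1 - bitn X u) * bitn X v * (K - adj u v) ≤ 1 * 1 * K :=
              Nat.mul_le_mul (Nat.mul_le_mul (by omega) (bitn_le_one X v)) (by omega)
            _ = K := by ring
        · exact Nat.zero_le _
    _ = n * (n * K) := by simp

theorem classWeight_zero_add_one_le (X X' : ℕ) :
    classWeight adj K n m 0 X + classWeight adj K n m 1 X' ≤ 2 * (n * (n * K)) := by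
  have h1 := classWeight_le (adj := adj) (K := K) (n := n) (m := m) 0 X
  have h2 := classWeight_le (adj := adj) (K := K) (n := n) (m := m) 1 X'
  omega

/-- The mask with the blocks `x`, `y`, `z`. -/
def joinBlocks (m x y z : ℕ) : ℕ := x + 2 ^ m * (y + 2 ^ m * z)

theorem bitn_joinBlocks {x y z : ℕ} (hx : x < 2 ^ m) (hy : y < 2 ^ m) (v : ℕ) :
    bitn (joinBlocks m x y z) v = if v < m then bitn x v else if v < 2 * m then bitn y (v - m)
      else bitn z (v - 2 * m) := by
  rw [joinBlocks, bitn_add_two_pow_mul hx, bitn_add_two_pow_mul hy]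
  split_ifs <;> first | rfl | omega | (congr 1; omega)

/-- Pairs of class 0 lie in the first two blocks and pairs of class 1 in the last two. A pair of
class 2 has one vertex in the first block and one in the third. So each class sees only two of the
three blocks; this is the step that turns cuts into paths x, y, z of a matrix product. -/
theorem cutWeight_joinBlocks {x y z : ℕ} (hx : x < 2 ^ m) (hy : y < 2 ^ m) :
    cutWeight adj K n (joinBlocks m x y z) =
      classWeight adj K n m 2 (joinBlocks m x 0 z) +
        (classWeight adj K n m 0 (joinBlocks m x y 0) +
          classWeight adj K n m 1 (joinBlocks m 0 y z)) := by
  have h0 : 0 < 2 ^ m := by positivity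
  rw [← classWeight_add (m := m), Nat.add_comm]
  congr 1
  · refine classWeight_congr fun u v h => ?_
    rw [pairClass] at h
    rw [bitn_joinBlocks hx hy, bitn_joinBlocks hx hy, bitn_joinBlocks hx h0,
      bitn_joinBlocks hx h0]
    split_ifs at h ⊢ <;> omega
  congr 1
  · refine classWeight_congr fun u v h => ?_
    rw [pairClass] at h
    simp only [bitn_joinBlocks hx hy]
    split_ifs at h ⊢ <;> omega
  · refine classWeight_congr fun u v h => ?_
    rw [pairClass] at h
    rw [bitn_joinBlocks hx hy, bitn_joinBlocks hx hy, bitn_joinBlocks h0 hy,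
      bitn_joinBlocks h0 hy]
    split_ifs at h ⊢ <;> omega

theorem exists_joinBlocks {X : ℕ} (hX : X < 2 ^ (3 * m)) :
    ∃ x < 2 ^ m, ∃ y < 2 ^ m, ∃ z < 2 ^ m, X = joinBlocks m x y z := by
  have h0 : 0 < 2 ^ m := by positivity
  refine ⟨X % 2 ^ m, Nat.mod_lt _ h0, X / 2 ^ m % 2 ^ m, Nat.mod_lt _ h0, X / 2 ^ m / 2 ^ m,
    ?_, ?_⟩
  · rw [Nat.div_div_eq_div_mul]
    refine Nat.div_lt_of_lt_mul (hX.trans_le (le_of_eq ?_))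
    ring
  · rw [joinBlocks, Nat.mod_add_div, Nat.mod_add_div]

/-- Every pair of a vertex outside and a vertex inside contributes K minus its arc. Among sets of
one size, maximizing the weight is therefore minimizing the cut. -/
theorem cutWeight_add_cutSize (hK : ∀ u v, adj u v ≤ K) (X : ℕ) :
    cutWeight adj K n X + cutSize adj n (bitSet n X) =
      (n - (bitSet n X).card) * ((bitSet n X).card * K) := by
  have h1 : cutWeight adj K n X =
      ∑ u ∈ Finset.range n \ bitSet n X, ∑ v ∈ bitSet n X, (K - adj u v) := by
    have hsd : Finset.range n \ bitSet n X = (Finset.range n).filter fun i => ¬ bitn X i = 1 := by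
      ext i
      rw [Finset.mem_sdiff, mem_bitSet, Finset.mem_filter, Finset.mem_range]
      tauto
    rw [hsd, bitSet, Finset.sum_filter]
    refine Finset.sum_congr rfl fun u _ => ?_
    rw [Finset.sum_filter]
    have hu := bitn_le_one X u
    by_cases h : ¬ bitn X u = 1
    · rw [if_pos h, show bitn X u = 0 by omega]
      refine Finset.sum_congr rfl fun v _ => ?_
      have hv := bitn_le_one X v
      split_ifs with h'
      · simp [h']
      · simp [show bitn X v = 0 by omega]
    · rw [if_neg h]
      rw [not_not] at h
      simp [h]
  rw [h1, cutSize, ← Finset.sum_add_distrib]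
  simp only [← Finset.sum_add_distrib]
  rw [Finset.sum_congr rfl fun u _ => Finset.sum_congr rfl fun v _ => Nat.sub_add_cancel (hK u v)]
  simp [Finset.card_sdiff_of_subset (bitSet_subset n X)]

theorem cutSize_le (hadj : ∀ u v, adj u v ≤ 1) {S : Finset ℕ} (hS : S ⊆ Finset.range n) :
    cutSize adj n S ≤ n * n := by
  have h1 : (Finset.range n \ S).card ≤ n := by
    simpa using Finset.card_le_card (Finset.sdiff_subset (s := Finset.range n) (t := S))
  have h2 : S.card ≤ n := by simpa using Finset.card_le_card hS
  calc cutSize adj n S ≤ ∑ u ∈ Finset.range n \ S, ∑ v ∈ S, 1 :=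
        Finset.sum_le_sum fun u _ => Finset.sum_le_sum fun v _ => hadj u v
    _ = (Finset.range n \ S).card * S.card := by simp
    _ ≤ n * n := Nat.mul_le_mul h1 h2

theorem cutSize_le_of_maximal (hK : ∀ u v, adj u v ≤ K) {X : ℕ}
    (hX : ∀ X' < 2 ^ n, cutWeight adj K n X' ≤ cutWeight adj K n X) {S : Finset ℕ}
    (hS : S ⊆ Finset.range n) (hcard : S.card = (bitSet n X).card) :
    cutSize adj n (bitSet n X) ≤ cutSize adj n S := by
  obtain ⟨X', hX', rfl⟩ := exists_bitSet_eq hS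
  have h1 := cutWeight_add_cutSize (n := n) hK X
  have h2 := cutWeight_add_cutSize (n := n) hK X'
  have h3 := hX X' hX'
  rw [hcard] at h2
  omega

/-- One separated pair is worth more than all the arcs of a cut can be, so a maximal cut separates
at least as many pairs as a set of n/2 vertices does, and (n - h) h being this large forces h close
to n/2. -/
theorem card_bitSet_of_maximal (hadj : ∀ u v, adj u v ≤ 1) (hK : n * n < K) {X : ℕ}
    (hX : ∀ X' < 2 ^ n, cutWeight adj K n X' ≤ cutWeight adj K n X) :
    (bitSet n X).card ≤ n / 2 + 1 ∧ n - (bitSet n X).card ≤ n / 2 + 1 := by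
  have hK' : ∀ u v, adj u v ≤ K := fun u v => (hadj u v).trans (by omega)
  obtain ⟨X', hX', hS⟩ := exists_bitSet_eq (s := n) (S := Finset.range (n / 2))
    (Finset.range_mono (by omega))
  have h1 := cutWeight_add_cutSize (n := n) hK' X
  have h2 := cutWeight_add_cutSize (n := n) hK' X'
  have h3 := hX X' hX'
  have h4 := cutSize_le (n := n) hadj (bitSet_subset n X')
  rw [hS, Finset.card_range] at h2
  rw [hS] at h4
  set h := (bitSet n X).card with hh
  have hhn : h ≤ n := by simpa using Finset.card_le_card (bitSet_subset n X)
  have h5 : (n - n / 2) * (n / 2) ≤ (n - h) * h := by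
    by_contra hlt
    have h6 : ((n - h) * h + 1) * K ≤ (n - n / 2) * (n / 2) * K :=
      Nat.mul_le_mul_right _ (by omega)
    rw [← mul_assoc] at h1 h2
    rw [Nat.succ_mul] at h6
    omega
  obtain ⟨q, hq⟩ : ∃ q, n / 2 = q := ⟨_, rfl⟩
  obtain ⟨p, hp⟩ : ∃ p, p = n - h := ⟨_, rfl⟩
  obtain ⟨w, hw⟩ : ∃ w, w = n - n / 2 := ⟨_, rfl⟩
  rw [← hp, ← hw, hq] at h5
  have hsum : p + h = w + q := by omega
  have hwq : w ≤ q + 1 := by omega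
  rw [← hp, hq]
  constructor
  · by_contra hcon
    -- From h = q + 2 + t and w = p + 2 + t, the inequality w q ≤ p h reduces to q ≤ p, while w ≤ q
    -- + 1 gives p < q.
    obtain ⟨t, ht⟩ : ∃ t, h = q + 2 + t := ⟨h - (q + 2), by omega⟩
    have hpw : w = p + 2 + t := by omega
    nlinarith
  · by_contra hcon
    obtain ⟨t, ht⟩ : ∃ t, p = q + 2 + t := ⟨p - (q + 2), by omega⟩
    have hpw : w = h + 2 + t := by omega
    nlinarith

end Cut

/-! ### Orderings -/

/-- The number of arcs between vertices of `A` that are forward with respect to `ρ`. -/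
def forwardArcs (adj : ℕ → ℕ → ℕ) (ρ : ℕ → ℕ) (A : Finset ℕ) : ℕ :=
  ∑ i ∈ A, ∑ j ∈ A, if ρ j < ρ i then adj j i else 0

/-- The number of arcs from `A` to `B` that are backward with respect to `ρ`. -/
def backwardArcs (adj : ℕ → ℕ → ℕ) (ρ : ℕ → ℕ) (A B : Finset ℕ) : ℕ :=
  ∑ u ∈ A, ∑ v ∈ B, if ρ v < ρ u then adj u v else 0

section Orderings

variable {adj : ℕ → ℕ → ℕ}

/-- Inside a fixed set the total is constant, so the dynamic program may maximize forward arcs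
instead of minimizing backward ones. -/
theorem forwardArcs_add_backwardArcs (hadj : ∀ u, adj u u = 0) {ρ : ℕ → ℕ} {A : Finset ℕ}
    (hρ : Set.InjOn ρ A) :
    forwardArcs adj ρ A + backwardArcs adj ρ A A = ∑ u ∈ A, ∑ v ∈ A, adj u v := by
  rw [forwardArcs, Finset.sum_comm, backwardArcs]
  simp only [← Finset.sum_add_distrib]
  refine Finset.sum_congr rfl fun u hu => Finset.sum_congr rfl fun v hv => ?_
  rcases lt_trichotomy (ρ u) (ρ v) with h | h | h
  · simp [h, h.le]
  · have : u = v := hρ hu hv h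
    subst this
    simp [hadj]
  · simp [h, h.le]

theorem backwardArcs_split (ρ : ℕ → ℕ) {A S : Finset ℕ} (hS : S ⊆ A) :
    backwardArcs adj ρ A A = (backwardArcs adj ρ S S + backwardArcs adj ρ (A \ S) (A \ S)) +
      (backwardArcs adj ρ S (A \ S) + backwardArcs adj ρ (A \ S) S) := by
  simp only [backwardArcs]
  rw [← Finset.sum_sdiff hS]
  simp only [← Finset.sum_sdiff hS, Finset.sum_add_distrib]
  ring

/-- Concatenating optimal orderings of the two sides of a cut that is minimum among the cuts
with the same sizes costs at most twice the optimum. -/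
theorem backwardArcs_le_two_mul (hadj : ∀ u, adj u u = 0) {n : ℕ} {S : Finset ℕ}
    (hS : S ⊆ Finset.range n)
    (hcut : ∀ S' ⊆ Finset.range n, S'.card = S.card → cutSize adj n S ≤ cutSize adj n S')
    {ρ σ : ℕ → ℕ} (hρ : Set.InjOn ρ (Finset.range n))
    (hρS : ∀ u ∈ S, ∀ v ∈ Finset.range n \ S, ρ u < ρ v)
    (hσ : Set.InjOn σ (Finset.range n)) (hσn : ∀ v < n, σ v < n)
    (h₁ : forwardArcs adj σ S ≤ forwardArcs adj ρ S)
    (h₂ : forwardArcs adj σ (Finset.range n \ S) ≤ forwardArcs adj ρ (Finset.range n \ S)) :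
    backwardArcs adj ρ (Finset.range n) (Finset.range n) ≤
      2 * backwardArcs adj σ (Finset.range n) (Finset.range n) := by
  set A := Finset.range n with hA
  have hT : A \ S ⊆ A := Finset.sdiff_subset
  have e1 := forwardArcs_add_backwardArcs hadj (hρ.mono (Finset.coe_subset.2 hS))
  have e2 := forwardArcs_add_backwardArcs hadj (hσ.mono (Finset.coe_subset.2 hS))
  have e3 := forwardArcs_add_backwardArcs hadj (hρ.mono (Finset.coe_subset.2 hT))
  have e4 := forwardArcs_add_backwardArcs hadj (hσ.mono (Finset.coe_subset.2 hT))
  have e5 := backwardArcs_split (adj := adj) ρ hS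
  have e6 := backwardArcs_split (adj := adj) σ hS
  -- As ρ lists S first, no arc leaving S is backward and every arc entering S is.
  have e7 : backwardArcs adj ρ S (A \ S) = 0 := by
    refine Finset.sum_eq_zero fun u hu => Finset.sum_eq_zero fun v hv => ?_
    rw [if_neg (hρS u hu v hv).le.not_gt]
  have e8 : backwardArcs adj ρ (A \ S) S = cutSize adj n S := by
    refine Finset.sum_congr rfl fun u hu => Finset.sum_congr rfl fun v hv => ?_
    rw [if_pos (hρS v hv u hu)]
  have hcn : S.card ≤ n := by simpa [hA] using Finset.card_le_card hS
  -- The initial segment of σ of the same size as S. All arcs entering it are backward for σ, and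
  -- the minimality of S compares the two cuts.
  let S' := A.filter fun v => σ v < S.card
  have hS' : S' ⊆ A := Finset.filter_subset _ _
  have himg : A.image σ = A := by
    refine Finset.eq_of_subset_of_card_le (fun x hx => ?_) ?_
    · obtain ⟨v, hv, rfl⟩ := Finset.mem_image.1 hx
      exact Finset.mem_range.2 (hσn v (Finset.mem_range.1 hv))
    · rw [Finset.card_image_of_injOn hσ]
  have hcard : S'.card = S.card := by
    rw [← Finset.card_image_of_injOn (hσ.mono (Finset.coe_subset.2 hS'))]
    have : S'.image σ = Finset.range S.card := by
      ext x
      simp only [S', Finset.mem_image, Finset.mem_filter, Finset.mem_range]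
      constructor
      · rintro ⟨v, ⟨-, hv⟩, rfl⟩
        exact hv
      · intro hx
        have : x ∈ A.image σ := by rw [himg]; exact Finset.mem_range.2 (by omega)
        obtain ⟨v, hv, rfl⟩ := Finset.mem_image.1 this
        exact ⟨v, ⟨hv, hx⟩, rfl⟩
    rw [this, Finset.card_range]
  have e9 : cutSize adj n S' ≤ backwardArcs adj σ A A := by
    have e10 := backwardArcs_split (adj := adj) σ hS'
    have e11 : backwardArcs adj σ (A \ S') S' = cutSize adj n S' := by
      refine Finset.sum_congr rfl fun u hu => Finset.sum_congr rfl fun v hv => ?_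
      rw [Finset.mem_sdiff, Finset.mem_filter] at hu
      rw [Finset.mem_filter] at hv
      rw [if_pos]
      have : ¬ σ u < S.card := fun h => hu.2 ⟨hu.1, h⟩
      omega
    omega
  have e12 := hcut S' hS' hcard
  omega

theorem forwardArcs_image {f ρ : ℕ → ℕ} {A : Finset ℕ} (hf : Set.InjOn f A) :
    forwardArcs adj ρ (A.image f) = forwardArcs (fun i j => adj (f i) (f j)) (ρ ∘ f) A := by
  rw [forwardArcs, Finset.sum_image hf]
  refine Finset.sum_congr rfl fun i _ => ?_
  rw [Finset.sum_image hf]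
  rfl

theorem forwardArcs_erase {ρ : ℕ → ℕ} {A : Finset ℕ} {i : ℕ} (hi : i ∈ A)
    (hmax : ∀ j ∈ A.erase i, ρ j < ρ i) :
    forwardArcs adj ρ A = forwardArcs adj ρ (A.erase i) + ∑ j ∈ A.erase i, adj j i := by
  rw [forwardArcs, forwardArcs, ← Finset.add_sum_erase _ _ hi, add_comm]
  congr 1
  · refine Finset.sum_congr rfl fun l hl => ?_
    rw [← Finset.add_sum_erase _ _ hi, if_neg (hmax l hl).le.not_gt, Nat.zero_add]
  · rw [← Finset.add_sum_erase _ _ hi]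
    simp only [lt_irrefl, if_false, Nat.zero_add]
    refine Finset.sum_congr rfl fun j hj => ?_
    rw [if_pos (hmax j hj)]

/-! ### Dynamic programming over subsets -/

/-- The number of vertices plus the maximum number of forward arcs over all orderings of the
vertex set with mask `T`, paired with the last vertex of an optimal ordering. -/
def bestOrder (adj : ℕ → ℕ → ℕ) (n s : ℕ) (T : ℕ) : ℕ :=
  (Finset.range n).sup fun i => if h : i < s ∧ bitn T i = 1 then
    -- The value is stored as the quotient and the last vertex as the remainder modulo n + 1, so a
    -- maximum also delivers a maximizer. The summand 1, which counts the vertex, makes the entry of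
    -- an admissible vertex positive, so the default 0 never wins for a nonempty set.
    (bestOrder adj n s (T - 2 ^ i) / (n + 1) +
      (∑ j ∈ Finset.range n, bitn (T - 2 ^ i) j * adj j i) + 1) * (n + 1) + i else 0
  termination_by T
  decreasing_by
    have := two_pow_le_of_bitn h.2
    have : 0 < 2 ^ i := by positivity
    omega

variable {n s : ℕ}

theorem bestOrder_ge (hs : s ≤ n) {T : ℕ} (hT : T < 2 ^ s) {i : ℕ} (hi : i < s)
    (hb : bitn T i = 1) :
    (bestOrder adj n s (T - 2 ^ i) / (n + 1) + (∑ j ∈ (bitSet s T).erase i, adj j i) + 1) * (n + 1)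
      + i ≤ bestOrder adj n s T := by
  have hlt : T - 2 ^ i < 2 ^ s := (Nat.sub_le _ _).trans_lt hT
  rw [← bitSet_sub_two_pow hb, ← sum_bitn_mul hlt hs]
  conv_rhs => rw [bestOrder]
  have := Finset.le_sup (f := fun i => if h : i < s ∧ bitn T i = 1 then
    (bestOrder adj n s (T - 2 ^ i) / (n + 1) +
      (∑ j ∈ Finset.range n, bitn (T - 2 ^ i) j * adj j i) + 1) * (n + 1) + i else 0)
    (Finset.mem_range.2 (hi.trans_le hs))
  simpa [hi, hb] using this

/-- The last vertex of an optimal ordering of the set with mask `T`. -/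
def lastVertex (adj : ℕ → ℕ → ℕ) (n s : ℕ) (T : ℕ) : ℕ := bestOrder adj n s T % (n + 1)

/-- The maximum is positive, hence attained at an admissible vertex, and that vertex is the
remainder modulo n + 1 because it is below n + 1. -/
theorem lastVertex_spec (hs : s ≤ n) {T : ℕ} (hT : T < 2 ^ s) (hT0 : T ≠ 0) :
    lastVertex adj n s T < s ∧ bitn T (lastVertex adj n s T) = 1 ∧
      bestOrder adj n s T / (n + 1) = bestOrder adj n s (T - 2 ^ lastVertex adj n s T) / (n + 1) +
        (∑ j ∈ (bitSet s T).erase (lastVertex adj n s T), adj j (lastVertex adj n s T)) + 1 := by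
  obtain ⟨i₀, hi₀⟩ : (bitSet s T).Nonempty := by
    rw [Finset.nonempty_iff_ne_empty]
    exact fun h => hT0 (eq_zero_of_bitSet_eq_empty hT h)
  rw [mem_bitSet] at hi₀
  have hpos : 0 < bestOrder adj n s T := by
    refine lt_of_lt_of_le ?_ (bestOrder_ge hs hT hi₀.1 hi₀.2)
    positivity
  obtain ⟨i, hi, he⟩ := Finset.exists_mem_eq_sup (Finset.range n)
    ⟨i₀, Finset.mem_range.2 (by omega)⟩ (fun i => if h : i < s ∧ bitn T i = 1 then
      (bestOrder adj n s (T - 2 ^ i) / (n + 1) +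
        (∑ j ∈ Finset.range n, bitn (T - 2 ^ i) j * adj j i) + 1) * (n + 1) + i else 0)
  rw [← bestOrder] at he
  have hg : i < s ∧ bitn T i = 1 := by
    by_contra hg
    rw [dif_neg hg] at he
    omega
  have hlt : T - 2 ^ i < 2 ^ s := (Nat.sub_le _ _).trans_lt hT
  rw [dif_pos hg, sum_bitn_mul hlt hs, bitSet_sub_two_pow hg.2] at he
  have hin : i < n + 1 := by omega
  have hlast : lastVertex adj n s T = i := by
    rw [lastVertex, he, Nat.add_comm, Nat.add_mul_mod_self_right, Nat.mod_eq_of_lt hin]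
  rw [hlast]
  refine ⟨hg.1, hg.2, ?_⟩
  rw [he, Nat.add_comm _ i, Nat.add_mul_div_right _ _ (by omega), Nat.div_eq_of_lt hin,
    Nat.zero_add]

/-- Optimality: removing the last vertex of an arbitrary ordering ρ gives an option in the
recursion, and the arcs into that vertex are all forward. -/
theorem forwardArcs_add_card_le (hs : s ≤ n) {ρ : ℕ → ℕ} (hρ : Set.InjOn ρ (Finset.range s))
    (T : ℕ) (hT : T < 2 ^ s) :
    forwardArcs adj ρ (bitSet s T) + (bitSet s T).card ≤ bestOrder adj n s T / (n + 1) := by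
  induction T using Nat.strong_induction_on with
  | _ T ih =>
    rcases eq_or_ne T 0 with rfl | hT0
    · have : bitSet s 0 = ∅ := by
        ext i
        simp [mem_bitSet, bitn_zero]
      simp [this, forwardArcs]
    · have hne : (bitSet s T).Nonempty := by
        rw [Finset.nonempty_iff_ne_empty]
        exact fun h => hT0 (eq_zero_of_bitSet_eq_empty hT h)
      obtain ⟨i, hi, hmax⟩ := Finset.exists_max_image (bitSet s T) ρ hne
      have hi' := mem_bitSet.1 hi
      have h2 := two_pow_le_of_bitn hi'.2
      have h3 : 0 < 2 ^ i := by positivity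
      have hstep := ih (T - 2 ^ i) (by omega) (by omega)
      rw [bitSet_sub_two_pow hi'.2, Finset.card_erase_of_mem hi] at hstep
      have hc : 0 < (bitSet s T).card := Finset.card_pos.2 hne
      rw [forwardArcs_erase hi]
      · rw [Nat.le_div_iff_mul_le (by omega)]
        refine le_trans ?_ (bestOrder_ge hs hT hi'.1 hi'.2)
        refine le_trans (Nat.mul_le_mul_right _ ?_) (Nat.le_add_right _ _)
        omega
      · intro j hj
        rw [Finset.mem_erase] at hj
        refine lt_of_le_of_ne (hmax j hj.2) fun h => hj.1 ?_
        exact hρ (bitSet_subset _ _ hj.2) (bitSet_subset _ _ hi) h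

/-! ### Reading an optimal ordering off the table -/

/-- The vertices that are left when the last `j` vertices of an optimal ordering have been
removed. -/
def prefixMask (adj : ℕ → ℕ → ℕ) (n s : ℕ) : ℕ → ℕ
  | 0 => 2 ^ s - 1
  | j + 1 => prefixMask adj n s j - 2 ^ lastVertex adj n s (prefixMask adj n s j)

/-- The positions in an optimal ordering. -/
def bestRank (adj : ℕ → ℕ → ℕ) (n s i : ℕ) : ℕ :=
  s - ∑ j ∈ Finset.range (n + 1), bitn (prefixMask adj n s j) i

theorem prefixMask_lt (j : ℕ) : prefixMask adj n s j < 2 ^ s := by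
  have : 0 < 2 ^ s := by positivity
  induction j with
  | zero => rw [prefixMask]; omega
  | succ j ih => exact (Nat.sub_le _ _).trans_lt ih

theorem prefixMask_spec (hs : s ≤ n) (j : ℕ) (hj : j ≤ s) :
    (bitSet s (prefixMask adj n s j)).card = s - j := by
  induction j with
  | zero => simp [prefixMask, bitSet_two_pow_sub_one]
  | succ j ih =>
    have hc := ih (by omega)
    have h0 : prefixMask adj n s j ≠ 0 := by
      intro h
      have : bitSet s 0 = ∅ := by ext i; simp [mem_bitSet, bitn_zero]
      rw [h, this, Finset.card_empty] at hc
      omega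
    obtain ⟨h1, h2, -⟩ := lastVertex_spec (adj := adj) hs (prefixMask_lt j) h0
    rw [prefixMask, bitSet_sub_two_pow h2, Finset.card_erase_of_mem (mem_bitSet.2 ⟨h1, h2⟩), hc]
    omega

theorem prefixMask_ne_zero (hs : s ≤ n) {j : ℕ} (hj : j < s) : prefixMask adj n s j ≠ 0 := by
  intro h
  have hc := prefixMask_spec (adj := adj) hs j hj.le
  have : bitSet s 0 = ∅ := by ext i; simp [mem_bitSet, bitn_zero]
  rw [h, this, Finset.card_empty] at hc
  omega

/-- Truncated subtraction keeps the mask at 0 once all vertices are gone, so ranks can be computed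
from n + 1 masks whatever the size s is. -/
theorem prefixMask_eq_zero (hs : s ≤ n) {j : ℕ} (hj : s ≤ j) : prefixMask adj n s j = 0 := by
  induction j, hj using Nat.le_induction with
  | base =>
    refine eq_zero_of_bitSet_eq_empty (prefixMask_lt s) ?_
    rw [← Finset.card_eq_zero, prefixMask_spec hs s le_rfl, Nat.sub_self]
  | succ j _ ih => rw [prefixMask, ih, Nat.zero_sub]

/-- The `j`-th vertex from the end of an optimal ordering. -/
def fromEnd (adj : ℕ → ℕ → ℕ) (n s j : ℕ) : ℕ := lastVertex adj n s (prefixMask adj n s j)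

theorem bitSet_prefixMask_succ (hs : s ≤ n) {j : ℕ} (hj : j < s) :
    fromEnd adj n s j ∈ bitSet s (prefixMask adj n s j) ∧
      bitSet s (prefixMask adj n s (j + 1)) =
        (bitSet s (prefixMask adj n s j)).erase (fromEnd adj n s j) := by
  obtain ⟨h1, h2, -⟩ := lastVertex_spec (adj := adj) hs (prefixMask_lt j) (prefixMask_ne_zero hs hj)
  exact ⟨mem_bitSet.2 ⟨h1, h2⟩, by rw [prefixMask, bitSet_sub_two_pow h2]; rfl⟩

theorem bitSet_prefixMask_anti (hs : s ≤ n) {j j' : ℕ} (hj : j ≤ j') (hj' : j' ≤ s) :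
    bitSet s (prefixMask adj n s j') ⊆ bitSet s (prefixMask adj n s j) := by
  induction j', hj using Nat.le_induction with
  | base => exact subset_rfl
  | succ l _ ih =>
    rw [(bitSet_prefixMask_succ hs (by omega)).2]
    exact (Finset.erase_subset _ _).trans (ih (by omega))

/-- The masks decrease and lose this vertex exactly at step j + 1. The vertex thus belongs to j + 1
masks, and counting them determines its position. -/
theorem bitn_prefixMask_fromEnd (hs : s ≤ n) {j : ℕ} (hj : j < s) (l : ℕ) :
    bitn (prefixMask adj n s l) (fromEnd adj n s j) = if l < j + 1 then 1 else 0 := by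
  obtain ⟨hmem, her⟩ := bitSet_prefixMask_succ (adj := adj) hs hj
  split_ifs with hl
  · exact (mem_bitSet.1 (bitSet_prefixMask_anti hs (by omega) (by omega) hmem)).2
  · have hlt := (mem_bitSet.1 hmem).1
    rcases le_total s l with h | h
    · rw [prefixMask_eq_zero hs h, bitn_zero]
    · have hnot : fromEnd adj n s j ∉ bitSet s (prefixMask adj n s l) := by
        intro hin
        have := bitSet_prefixMask_anti hs (by omega : j + 1 ≤ l) h hin
        rw [her] at this
        simp at this
      rw [mem_bitSet, not_and] at hnot
      have h1 := hnot hlt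
      have h2 := bitn_le_one (prefixMask adj n s l) (fromEnd adj n s j)
      omega

theorem bestRank_fromEnd (hs : s ≤ n) {j : ℕ} (hj : j < s) :
    bestRank adj n s (fromEnd adj n s j) = s - (j + 1) := by
  rw [bestRank, Finset.sum_congr rfl fun l _ => bitn_prefixMask_fromEnd hs hj l,
    ← Finset.sum_filter, Finset.sum_const, smul_eq_mul, mul_one]
  rw [show (Finset.range (n + 1)).filter (· < j + 1) = Finset.range (j + 1) by ext; simp; omega]
  simp

theorem exists_fromEnd_eq (hs : s ≤ n) {j : ℕ} (hj : j ≤ s) {i : ℕ}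
    (hi : i ∈ bitSet s (prefixMask adj n s j)) :
    ∃ l, j ≤ l ∧ l < s ∧ fromEnd adj n s l = i := by
  induction hd : s - j generalizing j with
  | zero =>
    obtain rfl : j = s := by omega
    rw [prefixMask_eq_zero hs le_rfl] at hi
    simp [mem_bitSet, bitn_zero] at hi
  | succ d ih =>
    rcases eq_or_ne i (fromEnd adj n s j) with h | h
    · exact ⟨j, le_rfl, by omega, h.symm⟩
    · obtain ⟨l, h1, h2, h3⟩ := ih (j := j + 1) (by omega) (by
        rw [(bitSet_prefixMask_succ hs (by omega)).2]
        exact Finset.mem_erase.2 ⟨h, hi⟩) (by omega)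
      exact ⟨l, by omega, h2, h3⟩

theorem exists_fromEnd_eq_of_lt (hs : s ≤ n) {i : ℕ} (hi : i < s) :
    ∃ l < s, fromEnd adj n s l = i := by
  obtain ⟨l, -, h2, h3⟩ := exists_fromEnd_eq (adj := adj) hs (Nat.zero_le s) (i := i) (by
    rw [prefixMask, bitSet_two_pow_sub_one]
    exact Finset.mem_range.2 hi)
  exact ⟨l, h2, h3⟩

theorem bestRank_lt (hs : s ≤ n) {i : ℕ} (hi : i < s) : bestRank adj n s i < s := by
  obtain ⟨l, hl, rfl⟩ := exists_fromEnd_eq_of_lt (adj := adj) hs hi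
  rw [bestRank_fromEnd hs hl]
  omega

theorem bestRank_injOn (hs : s ≤ n) : Set.InjOn (bestRank adj n s) (Finset.range s) := by
  intro i hi i' hi' h
  obtain ⟨l, hl, rfl⟩ := exists_fromEnd_eq_of_lt (adj := adj) hs (Finset.mem_range.1 hi)
  obtain ⟨l', hl', rfl⟩ := exists_fromEnd_eq_of_lt (adj := adj) hs (Finset.mem_range.1 hi')
  rw [bestRank_fromEnd hs hl, bestRank_fromEnd hs hl'] at h
  rw [show l = l' by omega]

/-- The counterpart of `forwardArcs_add_card_le`: the traced ordering achieves the value in the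
table, as each removed vertex has the highest rank among those still present. -/
theorem forwardArcs_bestRank (hs : s ≤ n) {j : ℕ} (hj : j ≤ s) :
    bestOrder adj n s (prefixMask adj n s j) / (n + 1) ≤
      forwardArcs adj (bestRank adj n s) (bitSet s (prefixMask adj n s j)) + (s - j) := by
  induction hd : s - j generalizing j with
  | zero =>
    rw [prefixMask_eq_zero hs (by omega), bestOrder]
    have : ((Finset.range n).sup fun _ => 0) = 0 := Nat.le_zero.1 (Finset.sup_le fun _ _ => le_rfl)
    simp [bitn_zero, this]
  | succ d ih =>
    have hjs : j < s := by omega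
    obtain ⟨hmem, her⟩ := bitSet_prefixMask_succ (adj := adj) hs hjs
    have h1 := (lastVertex_spec (adj := adj) hs (prefixMask_lt (adj := adj) (n := n) j)
      (prefixMask_ne_zero hs hjs)).2.2
    have h2 := ih (j := j + 1) (by omega) (by omega)
    rw [her, prefixMask] at h2
    rw [forwardArcs_erase hmem]
    · simp only [fromEnd] at h1 h2 ⊢
      omega
    · intro i hi
      rw [← her] at hi
      obtain ⟨l, hl, hls, rfl⟩ := exists_fromEnd_eq hs (by omega) hi
      rw [bestRank_fromEnd hs hls, bestRank_fromEnd hs hjs]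
      omega

/-- Dynamic programming finds an ordering with the maximum number of forward arcs. -/
theorem forwardArcs_le_bestRank (hs : s ≤ n) {ρ : ℕ → ℕ} (hρ : Set.InjOn ρ (Finset.range s)) :
    forwardArcs adj ρ (Finset.range s) ≤ forwardArcs adj (bestRank adj n s) (Finset.range s) := by
  have h1 := forwardArcs_add_card_le (adj := adj) hs hρ _ (prefixMask_lt (adj := adj) (n := n) 0)
  have h2 := forwardArcs_bestRank (adj := adj) hs (Nat.zero_le s)
  rw [prefixMask, bitSet_two_pow_sub_one, Finset.card_range] at h1
  rw [prefixMask, bitSet_two_pow_sub_one] at h2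
  omega

end Orderings

/-! ### Renumbering the vertices -/

/-- The new number of vertex `v` when the vertices in the mask `X` are numbered first. -/
def relabel (n X v : ℕ) : ℕ :=
  if bitn X v = 1 then ∑ u ∈ Finset.range v, bitn X u
  else ∑ u ∈ Finset.range n, bitn X u + ∑ u ∈ Finset.range v, (1 - bitn X u)

/-- The vertex with the new number `q`. -/
def vertexAt (n X q : ℕ) : ℕ := ∑ v ∈ Finset.range n, if relabel n X v = q then v else 0

/-- The number of vertices in the mask `X`. -/
def maskSize (n X : ℕ) : ℕ := ∑ u ∈ Finset.range n, bitn X u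

/-- Adjacency of the vertices in terms of the new numbers from `off` on. -/
def shiftedAdj (adj : ℕ → ℕ → ℕ) (n X off i j : ℕ) : ℕ :=
  adj (vertexAt n X (off + i)) (vertexAt n X (off + j))

/-- The position of vertex `v` in the concatenation of optimal orderings of the two sides. -/
def finalPosition (adj : ℕ → ℕ → ℕ) (n X v : ℕ) : ℕ :=
  if relabel n X v < maskSize n X then
    bestRank (shiftedAdj adj n X 0) n (maskSize n X) (relabel n X v)
  else maskSize n X + bestRank (shiftedAdj adj n X (maskSize n X)) n (n - maskSize n X)
    (relabel n X v - maskSize n X)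

theorem sum_range_add_le {f : ℕ → ℕ} {v w : ℕ} (h : v < w) :
    ∑ u ∈ Finset.range v, f u + f v ≤ ∑ u ∈ Finset.range w, f u := by
  rw [← Finset.sum_range_succ]
  exact Finset.sum_le_sum_of_subset (Finset.range_mono h)

section Relabel

variable {n X : ℕ}

theorem maskSize_eq_card : maskSize n X = (bitSet n X).card := by
  rw [maskSize, bitSet, Finset.card_filter]
  refine Finset.sum_congr rfl fun u _ => ?_
  have := bitn_le_one X u
  split_ifs <;> omega

theorem maskSize_le : maskSize n X ≤ n := by
  rw [maskSize_eq_card]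
  simpa using Finset.card_le_card (bitSet_subset n X)

theorem maskSize_add : maskSize n X + ∑ u ∈ Finset.range n, (1 - bitn X u) = n := by
  rw [maskSize, ← Finset.sum_add_distrib,
    Finset.sum_congr rfl fun u _ => Nat.add_sub_cancel' (bitn_le_one X u)]
  simp

theorem relabel_lt_maskSize_iff {v : ℕ} (hv : v < n) :
    relabel n X v < maskSize n X ↔ bitn X v = 1 := by
  rw [relabel]
  split_ifs with h
  · have := sum_range_add_le (f := bitn X) hv
    rw [h] at this
    simp only [h, iff_true, maskSize]
    omega
  · simp only [h, iff_false, maskSize]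
    omega

theorem relabel_lt {v : ℕ} (hv : v < n) : relabel n X v < n := by
  by_cases h : bitn X v = 1
  · exact ((relabel_lt_maskSize_iff hv).2 h).trans_le maskSize_le
  · rw [relabel, if_neg h]
    have h1 := sum_range_add_le (f := fun u => 1 - bitn X u) hv
    have h2 := maskSize_add (n := n) (X := X)
    have h3 := bitn_le_one X v
    rw [maskSize] at h2
    omega

theorem relabel_injOn : Set.InjOn (relabel n X) (Finset.range n) := by
  have key : ∀ v w, v < w → w < n → relabel n X v ≠ relabel n X w := by
    intro v w hvw hw he
    have h1 := relabel_lt_maskSize_iff (X := X) (hvw.trans hw)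
    have h2 := relabel_lt_maskSize_iff (X := X) hw
    rw [he, h2] at h1
    rw [relabel, relabel] at he
    have h3 := sum_range_add_le (f := fun u => 1 - bitn X u) hvw
    have h4 := sum_range_add_le (f := bitn X) hvw
    have h5 := bitn_le_one X v
    by_cases hb : bitn X v = 1
    · rw [if_pos hb, if_pos (h1.2 hb)] at he
      omega
    · rw [if_neg hb, if_neg (fun h => hb (h1.1 h))] at he
      omega
  intro v hv w hw he
  have hv' := Finset.mem_range.1 hv
  have hw' := Finset.mem_range.1 hw
  rcases lt_trichotomy v w with h | h | h
  · exact absurd he (key v w h hw')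
  · exact h
  · exact absurd he.symm (key w v h hv')

theorem vertexAt_relabel {v : ℕ} (hv : v < n) : vertexAt n X (relabel n X v) = v := by
  rw [vertexAt, Finset.sum_eq_single v]
  · simp
  · intro w hw hne
    rw [if_neg]
    exact fun he => hne (relabel_injOn hw (Finset.mem_range.2 hv) he)
  · intro h
    exact absurd (Finset.mem_range.2 hv) h

theorem exists_relabel_eq {q : ℕ} (hq : q < n) : ∃ v < n, relabel n X v = q := by
  have himg : (Finset.range n).image (relabel n X) = Finset.range n := by
    refine Finset.eq_of_subset_of_card_le (fun x hx => ?_) ?_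
    · obtain ⟨v, hv, rfl⟩ := Finset.mem_image.1 hx
      exact Finset.mem_range.2 (relabel_lt (Finset.mem_range.1 hv))
    · rw [Finset.card_image_of_injOn relabel_injOn]
  have : q ∈ (Finset.range n).image (relabel n X) := by rw [himg]; exact Finset.mem_range.2 hq
  obtain ⟨v, hv, rfl⟩ := Finset.mem_image.1 this
  exact ⟨v, Finset.mem_range.1 hv, rfl⟩

theorem relabel_vertexAt {q : ℕ} (hq : q < n) : relabel n X (vertexAt n X q) = q := by
  obtain ⟨v, hv, rfl⟩ := exists_relabel_eq (X := X) hq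
  rw [vertexAt_relabel hv]

theorem vertexAt_lt {q : ℕ} (hq : q < n) : vertexAt n X q < n := by
  obtain ⟨v, hv, rfl⟩ := exists_relabel_eq (X := X) hq
  rwa [vertexAt_relabel hv]

theorem vertexAt_injOn (off s : ℕ) (h : off + s ≤ n) :
    Set.InjOn (fun i => vertexAt n X (off + i)) (Finset.range s) := by
  intro i hi j hj he
  have hi' : i < s := Finset.mem_range.1 hi
  have hj' : j < s := Finset.mem_range.1 hj
  have := congrArg (relabel n X) he
  simp only at this
  rw [relabel_vertexAt (by omega), relabel_vertexAt (by omega)] at this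
  omega

theorem image_vertexAt_left :
    (Finset.range (maskSize n X)).image (fun i => vertexAt n X (0 + i)) = bitSet n X := by
  ext v
  rw [Finset.mem_image, mem_bitSet]
  have hle := maskSize_le (n := n) (X := X)
  constructor
  · rintro ⟨i, hi, rfl⟩
    rw [Finset.mem_range] at hi
    have h1 : vertexAt n X (0 + i) < n := vertexAt_lt (by omega)
    refine ⟨h1, ?_⟩
    rw [← relabel_lt_maskSize_iff h1, relabel_vertexAt (by omega)]
    omega
  · rintro ⟨hv, hb⟩
    exact ⟨relabel n X v, Finset.mem_range.2 ((relabel_lt_maskSize_iff hv).2 hb), by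
      rw [Nat.zero_add, vertexAt_relabel hv]⟩

theorem image_vertexAt_right :
    (Finset.range (n - maskSize n X)).image (fun i => vertexAt n X (maskSize n X + i)) =
      Finset.range n \ bitSet n X := by
  ext v
  rw [Finset.mem_image, Finset.mem_sdiff, mem_bitSet, Finset.mem_range]
  have hle := maskSize_le (n := n) (X := X)
  constructor
  · rintro ⟨i, hi, rfl⟩
    rw [Finset.mem_range] at hi
    have h1 : vertexAt n X (maskSize n X + i) < n := vertexAt_lt (by omega)
    refine ⟨h1, fun h => ?_⟩
    have := (relabel_lt_maskSize_iff h1).2 h.2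
    rw [relabel_vertexAt (by omega)] at this
    omega
  · rintro ⟨hv, hb⟩
    have h1 : ¬ relabel n X v < maskSize n X := fun h => hb ⟨hv, (relabel_lt_maskSize_iff hv).1 h⟩
    have h2 := relabel_lt (X := X) hv
    refine ⟨relabel n X v - maskSize n X, Finset.mem_range.2 (by omega), ?_⟩
    rw [Nat.add_sub_cancel' (by omega), vertexAt_relabel hv]

variable {adj : ℕ → ℕ → ℕ}

theorem finalPosition_left {i : ℕ} (hi : i < maskSize n X) :
    finalPosition adj n X (vertexAt n X (0 + i)) =
      bestRank (shiftedAdj adj n X 0) n (maskSize n X) i := by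
  have hle := maskSize_le (n := n) (X := X)
  rw [Nat.zero_add, finalPosition, relabel_vertexAt (by omega), if_pos hi]

theorem finalPosition_right {i : ℕ} (hi : i < n - maskSize n X) :
    finalPosition adj n X (vertexAt n X (maskSize n X + i)) = maskSize n X +
      bestRank (shiftedAdj adj n X (maskSize n X)) n (n - maskSize n X) i := by
  rw [finalPosition, relabel_vertexAt (by omega), if_neg (by omega), Nat.add_sub_cancel_left]

theorem finalPosition_of_mem {v : ℕ} (hv : v < n) (hb : bitn X v = 1) :
    finalPosition adj n X v < maskSize n X := by
  rw [finalPosition, if_pos ((relabel_lt_maskSize_iff hv).2 hb)]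
  exact bestRank_lt maskSize_le ((relabel_lt_maskSize_iff hv).2 hb)

theorem finalPosition_of_notMem {v : ℕ} (hv : v < n) (hb : ¬ bitn X v = 1) :
    maskSize n X ≤ finalPosition adj n X v ∧ finalPosition adj n X v < n := by
  have h1 := mt (relabel_lt_maskSize_iff hv).1 hb
  have h2 := relabel_lt (X := X) hv
  rw [finalPosition, if_neg h1]
  have := bestRank_lt (adj := shiftedAdj adj n X (maskSize n X)) (s := n - maskSize n X) (n := n)
    (by omega) (i := relabel n X v - maskSize n X) (by omega)
  omega

theorem finalPosition_lt {v : ℕ} (hv : v < n) : finalPosition adj n X v < n := by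
  by_cases hb : bitn X v = 1
  · exact (finalPosition_of_mem hv hb).trans_le maskSize_le
  · exact (finalPosition_of_notMem hv hb).2

theorem finalPosition_injOn : Set.InjOn (finalPosition adj n X) (Finset.range n) := by
  have hle := maskSize_le (n := n) (X := X)
  have inj : ∀ v w, v < n → w < n → finalPosition adj n X v = finalPosition adj n X w →
      (bitn X v = 1 ↔ bitn X w = 1) := by
    intro v w hv hw he
    by_contra hne
    by_cases hb : bitn X v = 1
    · have hb' : ¬ bitn X w = 1 := fun h => hne ⟨fun _ => h, fun _ => hb⟩
      have h1 := finalPosition_of_mem (adj := adj) hv hb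
      have h2 := finalPosition_of_notMem (adj := adj) hw hb'
      omega
    · have hb' : bitn X w = 1 := by
        by_contra h
        exact hne ⟨fun h' => absurd h' hb, fun h' => absurd h' h⟩
      have h1 := finalPosition_of_mem (adj := adj) hw hb'
      have h2 := finalPosition_of_notMem (adj := adj) hv hb
      omega
  intro v hv w hw he
  have hv' := Finset.mem_range.1 hv
  have hw' := Finset.mem_range.1 hw
  have hiff := inj v w hv' hw' he
  refine relabel_injOn (X := X) hv hw ?_
  have rv := relabel_lt (X := X) hv'
  have rw' := relabel_lt (X := X) hw'
  have mv := relabel_lt_maskSize_iff (X := X) hv'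
  have mw := relabel_lt_maskSize_iff (X := X) hw'
  rw [finalPosition, finalPosition] at he
  by_cases hb : bitn X v = 1
  · rw [if_pos (mv.2 hb), if_pos (mw.2 (hiff.1 hb))] at he
    exact bestRank_injOn hle (Finset.mem_range.2 (mv.2 hb))
      (Finset.mem_range.2 (mw.2 (hiff.1 hb))) he
  · have h1 := mt mv.1 hb
    have h2 := mt mw.1 (mt hiff.2 hb)
    rw [if_neg h1, if_neg h2] at he
    have := bestRank_injOn (s := n - maskSize n X) (n := n) (by omega)
      (Finset.mem_range.2 (by omega : relabel n X v - maskSize n X < n - maskSize n X))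
      (Finset.mem_range.2 (by omega : relabel n X w - maskSize n X < n - maskSize n X))
      (Nat.add_left_cancel he)
    omega

/-- Both sides are pulled back along `vertexAt`, which numbers the vertices of the side
consecutively, so that the optimality of `bestRank` on an initial segment applies. The other side is
treated in the same way with an offset. -/
theorem forwardArcs_le_finalPosition_left {σ : ℕ → ℕ} (hσ : Set.InjOn σ (Finset.range n)) :
    forwardArcs adj σ (bitSet n X) ≤ forwardArcs adj (finalPosition adj n X) (bitSet n X) := by
  have hle := maskSize_le (n := n) (X := X)
  have hinj := vertexAt_injOn (n := n) (X := X) 0 (maskSize n X) (by omega)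
  rw [← image_vertexAt_left, forwardArcs_image hinj, forwardArcs_image hinj]
  refine (forwardArcs_le_bestRank hle (hσ.comp hinj fun i hi => ?_)).trans (le_of_eq ?_)
  · have := Finset.mem_range.1 hi
    exact Finset.mem_range.2 (vertexAt_lt (by omega))
  · refine Finset.sum_congr rfl fun i hi => Finset.sum_congr rfl fun j hj => ?_
    rw [Finset.mem_range] at hi hj
    simp only [Function.comp, finalPosition_left hi, finalPosition_left hj]
    rfl

theorem forwardArcs_le_finalPosition_right {σ : ℕ → ℕ} (hσ : Set.InjOn σ (Finset.range n)) :
    forwardArcs adj σ (Finset.range n \ bitSet n X) ≤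
      forwardArcs adj (finalPosition adj n X) (Finset.range n \ bitSet n X) := by
  have hle := maskSize_le (n := n) (X := X)
  have hinj := vertexAt_injOn (n := n) (X := X) (maskSize n X) (n - maskSize n X) (by omega)
  rw [← image_vertexAt_right, forwardArcs_image hinj, forwardArcs_image hinj]
  refine (forwardArcs_le_bestRank (n := n) (by omega)
    (hσ.comp hinj fun i hi => ?_)).trans (le_of_eq ?_)
  · have := Finset.mem_range.1 hi
    exact Finset.mem_range.2 (vertexAt_lt (by omega))
  · refine Finset.sum_congr rfl fun i hi => Finset.sum_congr rfl fun j hj => ?_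
    rw [Finset.mem_range] at hi hj
    simp only [Function.comp, finalPosition_right hi, finalPosition_right hj,
      Nat.add_lt_add_iff_left]
    rfl

/-- The approximation guarantee. -/
theorem backwardArcs_finalPosition_le {K : ℕ} (hloop : ∀ u, adj u u = 0)
    (hK : ∀ u v, adj u v ≤ K) (hX : ∀ X' < 2 ^ n, cutWeight adj K n X' ≤ cutWeight adj K n X)
    {σ : ℕ → ℕ} (hσ : Set.InjOn σ (Finset.range n)) (hσn : ∀ v < n, σ v < n) :
    backwardArcs adj (finalPosition adj n X) (Finset.range n) (Finset.range n) ≤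
      2 * backwardArcs adj σ (Finset.range n) (Finset.range n) := by
  refine backwardArcs_le_two_mul hloop (bitSet_subset n X)
    (fun S' hS' hc => cutSize_le_of_maximal hK hX hS' hc) finalPosition_injOn ?_ hσ hσn
    (forwardArcs_le_finalPosition_left hσ) (forwardArcs_le_finalPosition_right hσ)
  intro u hu v hv
  rw [mem_bitSet] at hu
  rw [Finset.mem_sdiff, Finset.mem_range, mem_bitSet] at hv
  exact (finalPosition_of_mem hu.1 hu.2).trans_le
    (finalPosition_of_notMem hv.1 fun h => hv.2 ⟨hv.1, h⟩).1

end Relabel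

open RAM RAM.Exp

/-! ### Parameters of the algorithm -/

/-- A bilinear algorithm with integer coefficients for matrices whose size is a power of two. -/
structure Scheme where
  e : ℕ
  r : ℕ
  D : ℕ
  F : ℕ → ℕ → ℤ
  G : ℕ → ℕ → ℤ
  W : ℕ → ℕ → ℤ
  e_pos : 0 < e
  le_r : 2 ^ e * 2 ^ e ≤ r
  D_pos : 0 < D
  spec : IsMatMulScheme (2 ^ e) r D F G W

namespace Scheme

variable (S : Scheme) (n : ℕ)

/-- The number of matrix entries at the lowest level. -/
def Q : ℕ := 2 ^ S.e * 2 ^ S.e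

/-- The number of recursion levels of the matrix product. -/
def k : ℕ := (n + (3 * S.e - 1)) / (3 * S.e)

/-- The size of each of the three blocks of vertices. -/
def m : ℕ := S.e * S.k n

/-- The reward for each pair of vertices that a cut separates. -/
def K : ℕ := n * n + 1

/-- A bound for the weight of two classes of pairs. -/
def wd : ℕ := 2 * (n * (n * K n)) + 1

/-- The space reserved for each level of the matrix product. -/
def R : ℕ := 4 * ((n + 1) * (n + 1)) * S.r ^ S.k n

/-- The space reserved for each array. -/
def H : ℕ := (S.k n + 1) * S.R n

/-- The number of subsets of a block. -/
def L : ℕ := 2 ^ S.m n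

/-- The base in which the weights are encoded. -/
def Z : ℕ := S.L n + 1

/-- The factor by which the computed matrix product is scaled. -/
def DK : ℕ := S.D ^ S.k n

/-- The modulus. -/
def M : ℕ := S.DK n * S.Z n ^ wd n

/-- The contents of the registers after the setup. -/
def regs : ℕ → ℕ
  | 0 => n
  | 1 => S.k n
  | 2 => S.m n
  | 3 => K n
  | 4 => wd n
  | 5 => S.r
  | 6 => S.Q
  | 7 => n + 1
  | 8 => S.R n
  | 9 => S.H n
  | 10 => S.L n
  | 11 => S.Z n
  | 12 => S.DK n
  | 13 => S.M n
  | _ => 0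

/-- The expressions that compute the contents of the registers. -/
def setupExp : ℕ → Exp
  | 1 => (var 0 + const (3 * S.e - 1)) / const (3 * S.e)
  | 2 => const S.e * var 1
  | 3 => var 0 * var 0 + 1
  | 4 => 2 * (var 0 * (var 0 * var 3)) + 1
  | 5 => const S.r
  | 6 => const S.Q
  | 7 => var 0 + 1
  | 8 => 4 * ((var 0 + 1) * (var 0 + 1)) * prod 14 1 (const S.r)
  | 9 => (var 1 + 1) * var 8
  | 10 => prod 14 2 2
  | 11 => var 10 + 1
  | 12 => prod 14 1 (const S.D)
  | 13 => var 12 * prod 14 4 (var 11)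
  | _ => 0

/-- The registers that hold small numbers. -/
def small : List ℕ := [0, 1, 2, 3, 4, 5, 6, 7]

theorem setupExp_wf (t : ℕ) : (S.setupExp t).WF small := by
  unfold setupExp small
  split <;> simp

theorem eval_setupExp (μ : ℕ → ℕ) (t : ℕ) (ht : t < 13) :
    (S.setupExp (t + 1)).eval μ (fun i => if i ≤ t then S.regs n i else 0) = S.regs n (t + 1) := by
  interval_cases t <;>
    simp [setupExp, regs, k, m, K, wd, R, H, L, Z, DK, M]

/-- The parameter registers hold the right values. -/
structure Par (env : ℕ → ℕ) : Prop where
  h0 : env 0 = n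
  h1 : env 1 = S.k n
  h2 : env 2 = S.m n
  h3 : env 3 = K n
  h4 : env 4 = wd n
  h5 : env 5 = S.r
  h6 : env 6 = S.Q
  h7 : env 7 = n + 1
  h8 : env 8 = S.R n
  h9 : env 9 = S.H n
  h10 : env 10 = S.L n
  h11 : env 11 = S.Z n
  h12 : env 12 = S.DK n
  h13 : env 13 = S.M n

theorem par_regs : S.Par n (S.regs n) := by constructor <;> rfl

variable {S n}

theorem Par.update {env : ℕ → ℕ} (h : S.Par n env) {x : ℕ} (hx : 14 ≤ x) (v : ℕ) :
    S.Par n (Function.update env x v) := by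
  constructor <;> rw [Function.update_of_ne (by omega)]
  exacts [h.h0, h.h1, h.h2, h.h3, h.h4, h.h5, h.h6, h.h7, h.h8, h.h9, h.h10, h.h11, h.h12, h.h13]

/-! ### Expressions for cuts -/

/-- Digit number `v` of `x`, for registers `x` and `v`. -/
def bitE (x v : ℕ) : Exp := mod (var x / prod 14 v 2) 2

theorem eval_bitE (μ env : ℕ → ℕ) {x v : ℕ} : (bitE x v).eval μ env = bitn (env x) (env v) := by
  simp [bitE, bitn]

/-- The weight of class `c` of the cut with the mask in register `20`. -/
def weightE (c : ℕ) : Exp :=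
  sum 15 0 (sum 16 0 (ite (eq (ite (lt (var 15) (2 * var 2) * lt (var 16) (2 * var 2)) 0
    (ite (lt (var 15) (var 2) + lt (var 16) (var 2)) 2 1)) (const c))
    ((1 - bitE 20 15) * bitE 20 16 * (var 3 - load (var 15 * var 0 + var 16))) 0))

variable {adj : ℕ → ℕ → ℕ} {env μ : ℕ → ℕ}

theorem eval_weightE (h : S.Par n env) (hadj : ∀ u < n, ∀ v < n, μ (u * n + v) = adj u v) (c : ℕ) :
    (weightE c).eval μ env = classWeight adj (K n) n (S.m n) c (env 20) := by
  simp only [weightE, eval_sum, h.h0]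
  refine Finset.sum_congr rfl fun u hu => ?_
  rw [Function.update_of_ne (by norm_num), h.h0]
  refine Finset.sum_congr rfl fun v hv => ?_
  have := hadj u (Finset.mem_range.1 hu) v (Finset.mem_range.1 hv)
  simp [eval_bitE, h.h0, h.h2, h.h3, this, pairClass]
  split_ifs <;> first | rfl | omega

/-- The row of entry `p` of a matrix, for `p` in register `21`. -/
def rowE (S : Scheme) : Exp :=
  sum 15 1 (mod (var 21 / prod 14 15 (var 6)) (var 6) / const (2 ^ S.e) * prod 14 15 (const (2 ^ S.e)))

/-- The column of entry `p` of a matrix, for `p` in register `21`. -/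
def colE (S : Scheme) : Exp :=
  sum 15 1 (mod (mod (var 21 / prod 14 15 (var 6)) (var 6)) (const (2 ^ S.e)) *
    prod 14 15 (const (2 ^ S.e)))

/-- The row of entry `p` of a matrix. -/
def row (S : Scheme) (n p : ℕ) : ℕ := rowIndex (2 ^ S.e) (S.k n) p

/-- The column of entry `p` of a matrix. -/
def col (S : Scheme) (n p : ℕ) : ℕ := colIndex (2 ^ S.e) (S.k n) p

theorem eval_rowE (h : S.Par n env) : (rowE S).eval μ env = S.row n (env 21) := by
  simp [rowE, row, rowIndex_eq_sum, h.h1, h.h6, Q]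

theorem eval_colE (h : S.Par n env) : (colE S).eval μ env = S.col n (env 21) := by
  simp [colE, col, colIndex_eq_sum, h.h1, h.h6, Q]

/-- The mask with given blocks. -/
def joinE (x y z : Exp) : Exp := x + var 10 * (y + var 10 * z)

theorem eval_joinE (h : S.Par n env) (x y z : Exp) : (joinE x y z).eval μ env =
    joinBlocks (S.m n) (x.eval μ env) (y.eval μ env) (z.eval μ env) := by
  simp [joinE, joinBlocks, h.h10, L]

/-- Entry `p` of the first matrix, for `p` in register `21`. -/
def leftE (S : Scheme) : Exp :=
  bind 20 (joinE (rowE S) (colE S) 0) (bind 22 (weightE 0) (pow (var 11) (var 22) 14 4))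

/-- Entry `p` of the second matrix, for `p` in register `21`. -/
def rightE (S : Scheme) : Exp :=
  bind 20 (joinE 0 (rowE S) (colE S)) (bind 22 (weightE 1) (pow (var 11) (var 22) 14 4))

/-- The encoded weights of the first class. -/
def leftEntry (S : Scheme) (n : ℕ) (adj : ℕ → ℕ → ℕ) (x y : ℕ) : ℕ :=
  S.Z n ^ classWeight adj (K n) n (S.m n) 0 (joinBlocks (S.m n) x y 0)

/-- The encoded weights of the second class. -/
def rightEntry (S : Scheme) (n : ℕ) (adj : ℕ → ℕ → ℕ) (y z : ℕ) : ℕ :=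
  S.Z n ^ classWeight adj (K n) n (S.m n) 1 (joinBlocks (S.m n) 0 y z)

theorem classWeight_le_wd (c X : ℕ) : classWeight adj (K n) n (S.m n) c X ≤ wd n := by
  have := classWeight_le (adj := adj) (K := K n) (n := n) (m := S.m n) c X
  rw [wd]
  omega

theorem eval_leftE (h : S.Par n env) (hadj : ∀ u < n, ∀ v < n, μ (u * n + v) = adj u v) :
    (leftE S).eval μ env = S.leftEntry n adj (S.row n (env 21)) (S.col n (env 21)) := by
  simp only [leftE, eval_bind]
  rw [eval_weightE (h.update (by norm_num) _) hadj, eval_joinE h, eval_rowE h, eval_colE h]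
  simp only [Function.update_self, eval_zero]
  rw [eval_pow (A := S.Z n) (B := classWeight adj (K n) n (S.m n) 0
    (joinBlocks (S.m n) (S.row n (env 21)) (S.col n (env 21)) 0))]
  · rfl
  · intro i
    simp [h.h11]
  · intro i
    simp
  · simpa [Function.update_apply, h.h4] using classWeight_le_wd _ _

theorem eval_rightE (h : S.Par n env) (hadj : ∀ u < n, ∀ v < n, μ (u * n + v) = adj u v) :
    (rightE S).eval μ env = S.rightEntry n adj (S.row n (env 21)) (S.col n (env 21)) := by
  simp only [rightE, eval_bind]
  rw [eval_weightE (h.update (by norm_num) _) hadj, eval_joinE h, eval_rowE h, eval_colE h]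
  simp only [Function.update_self, eval_zero]
  rw [eval_pow (A := S.Z n) (B := classWeight adj (K n) n (S.m n) 1
    (joinBlocks (S.m n) 0 (S.row n (env 21)) (S.col n (env 21))))]
  · rfl
  · intro i
    simp [h.h11]
  · intro i
    simp
  · simpa [Function.update_apply, h.h4] using classWeight_le_wd _ _

/-! ### Expressions for the matrix product -/

/-- The coefficient `c` modulo `M`. -/
def coeff (M : ℕ) (c : ℤ) : ℕ := c.toNat + (M - 1) * (-c).toNat

/-- The machine has only natural numbers, so a negative coefficient is replaced by M - 1 times its
absolute value. -/
theorem coeff_cast {M : ℕ} (hM : 0 < M) (c : ℤ) : ((coeff M c : ℕ) : ZMod M) = (c : ZMod M) := by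
  have h : ((M - 1 : ℕ) : ZMod M) = -1 := by
    rw [Nat.cast_sub hM]
    simp
  rw [coeff, Nat.cast_add, Nat.cast_mul, h]
  have h2 := Int.toNat_sub_toNat_neg c
  conv_rhs => rw [← h2]
  push_cast
  ring

/-- The levels of Yates' algorithm modulo `M`. -/
def yatesLevel (M k din dout : ℕ) (F : ℕ → ℕ → ℤ) (src : ℕ → ℕ) : ℕ → ℕ → ℕ
  | 0, p => if p < din ^ k then src p % M else 0
  | j + 1, p => if p < din ^ (k - (j + 1)) * dout ^ j * dout then
      (∑ i ∈ Finset.range din, coeff M (F (p % dout) i) *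
        yatesLevel M k din dout F src j (i * (din ^ (k - (j + 1)) * dout ^ j) + p / dout)) % M
    else 0

theorem yatesLevel_lt {M k din dout : ℕ} (hM : 0 < M) (F : ℕ → ℕ → ℤ) (src : ℕ → ℕ) (j p : ℕ) :
    yatesLevel M k din dout F src j p < M := by
  cases j <;> rw [yatesLevel] <;> split_ifs <;> first | exact Nat.mod_lt _ hM | exact hM

theorem yatesLevel_cast {M k din dout : ℕ} (hM : 0 < M) (hin : 0 < din) (hout : 0 < dout)
    (F : ℕ → ℕ → ℤ) (src : ℕ → ℕ) (q : ℕ) (hq : q < dout ^ k) :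
    (yatesLevel M k din dout F src k q : ZMod M) = ∑ p ∈ Finset.range (din ^ k),
      kron (fun o i => (F o i : ZMod M)) dout din k q p * (src p : ZMod M) := by
  rw [yates (F := fun o i => (F o i : ZMod M)) hin hout
    (fun j p => (yatesLevel M k din dout F src j p : ZMod M)) ?_ q hq]
  · refine Finset.sum_congr rfl fun p hp => ?_
    rw [yatesLevel, if_pos (Finset.mem_range.1 hp), ZMod.natCast_mod]
  · intro j hj p hp
    rw [show k - 1 - j = k - (j + 1) by omega] at hp ⊢
    rw [yatesLevel, if_pos (by rwa [mul_assoc, ← pow_succ]), ZMod.natCast_mod]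
    push_cast
    simp only [coeff_cast hM]

/-- Cell number `a` in register `31` of the array for Yates' algorithm, where `src` computes the
initial entry with the number in register `21`. -/
def yatesE (lo : Exp) (src : Exp) (F : ℕ → ℕ → ℤ) (din dout dinReg doutReg : ℕ) : Exp :=
  bind 23 (var 31 / var 8) (bind 21 (mod (var 31) (var 8)) (ite (eq (var 23) 0)
    (ite (lt (var 21) (prod 14 1 (var dinReg))) (mod src (var 13)) 0)
    (bind 24 (pow (var dinReg) (var 1 - var 23) 14 1 * pow (var doutReg) (var 23 - 1) 14 1)
      (ite (lt (var 21) (var 24 * var doutReg))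
        (mod (sum 15 dinReg (bind 25 (mod (var 21) (var doutReg) * var dinReg + var 15)
          ((table (var 25) (fun a => (F (a / din) (a % din)).toNat) (dout * din) +
            (var 13 - 1) * table (var 25) (fun a => (-F (a / din) (a % din)).toNat) (dout * din)) *
            load (lo + ((var 23 - 1) * var 8 + (var 15 * var 24 + var 21 / var doutReg))))))
          (var 13)) 0))))

/-- Address a = j R + p holds entry p of level j. A level reads only the previous one, whose cells
have smaller addresses and are already written; `hsmall` ensures that a level fits into R cells. -/
theorem eval_yatesE {lo src : Exp} {l : ℕ} {F : ℕ → ℕ → ℤ} {din dout dinReg doutReg : ℕ}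
    (h : S.Par n env) (hdR : dinReg < 14) (hoR : doutReg < 14) (hd : env dinReg = din)
    (ho : env doutReg = dout) (hdin : 0 < din) (hdout : 0 < dout)
    (hsmall : ∀ j ≤ S.k n, din ^ (S.k n - j) * dout ^ j ≤ S.R n)
    (hlo : ∀ env', S.Par n env' → lo.eval μ env' = l) {f : ℕ → ℕ}
    (hsrc : ∀ env', S.Par n env' → env' 21 < din ^ S.k n → src.eval μ env' = f (env' 21))
    {a : ℕ} (ha : a < S.H n) (ha' : env 31 = a)
    (hμ : ∀ b < a, μ (l + b) = yatesLevel (S.M n) (S.k n) din dout F f (b / S.R n) (b % S.R n)) :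
    (yatesE lo src F din dout dinReg doutReg).eval μ env =
      yatesLevel (S.M n) (S.k n) din dout F f (a / S.R n) (a % S.R n) := by
  have hR : 0 < S.R n := by
    by_contra hR
    rw [H, show S.R n = 0 by omega] at ha
    omega
  have hj : a / S.R n < S.k n + 1 := Nat.div_lt_of_lt_mul (by rwa [mul_comm])
  have haj := Nat.div_add_mod a (S.R n)
  simp only [yatesE, eval_bind, eval_div, eval_var, ha', h.h8]
  have h23 := (h.update (x := 23) (by norm_num) (a / S.R n))
  simp only [eval_mod, eval_var, ne_eq, show (31 : ℕ) ≠ 23 by norm_num, not_false_eq_true,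
    Function.update_of_ne, ha', show (8 : ℕ) ≠ 23 by norm_num, h.h8]
  have h21 := h23.update (x := 21) (by norm_num) (a % S.R n)
  set env₁ := Function.update (Function.update env 23 (a / S.R n)) 21 (a % S.R n) with henv₁
  have e21 : env₁ 21 = a % S.R n := by simp [env₁]
  have e23 : env₁ 23 = a / S.R n := by simp [env₁]
  have ed : env₁ dinReg = din := by
    rw [henv₁, Function.update_of_ne (by omega), Function.update_of_ne (by omega), hd]
  have eo : env₁ doutReg = dout := by
    rw [henv₁, Function.update_of_ne (by omega), Function.update_of_ne (by omega), ho]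
  have hmodR : a % S.R n < S.R n := Nat.mod_lt _ hR
  generalize hjj : a / S.R n = j at hj haj e23
  generalize hpp : a % S.R n = p at haj e21 hmodR
  rw [eval_ite, eval_eq, eval_var, eval_zero, e23]
  rcases j with _ | j
  · have h14 : ∀ i, Function.update env₁ 14 i dinReg = din := fun i => by
      rw [Function.update_of_ne (by omega), ed]
    simp only [if_true, one_ne_zero, if_false, eval_ite, eval_lt, eval_var, e21, eval_prod,
      h21.h1, h14, Finset.prod_const, Finset.card_range, eval_mod, h21.h13, eval_zero,
      yatesLevel]
    by_cases hp : p < din ^ S.k n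
    · rw [if_pos hp, if_neg one_ne_zero, if_pos hp, hsrc env₁ h21 (by rwa [e21]), e21]
    · rw [if_neg hp, if_pos rfl, if_neg hp]
  · have hpow : (pow (var dinReg) (var 1 - var 23) 14 1 *
        pow (var doutReg) (var 23 - 1) 14 1).eval μ env₁ = din ^ (S.k n - (j + 1)) * dout ^ j := by
      rw [eval_mul, eval_pow (A := din) (B := S.k n - (j + 1)),
        eval_pow (A := dout) (B := j)]
      · intro i
        rw [eval_var, Function.update_of_ne (by omega), eo]
      · intro i
        simp [e23]
      · rw [h21.h1]
        omega
      · intro i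
        rw [eval_var, Function.update_of_ne (by omega), ed]
      · intro i
        simp [e23, h21.h1]
      · rw [h21.h1]
        omega
    rw [if_neg (Nat.succ_ne_zero j), if_pos rfl, eval_bind, hpow]
    have h24 := h21.update (x := 24) (by norm_num) (din ^ (S.k n - (j + 1)) * dout ^ j)
    generalize hB : din ^ (S.k n - (j + 1)) * dout ^ j = B at h24 ⊢
    set env₂ := Function.update env₁ 24 B with henv₂
    have f21 : env₂ 21 = p := by simp [env₂, e21]
    have f23 : env₂ 23 = j + 1 := by simp [env₂, e23]
    have f24 : env₂ 24 = B := by simp [env₂]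
    have fd : env₂ dinReg = din := by rw [henv₂, Function.update_of_ne (by omega), ed]
    have fo : env₂ doutReg = dout := by rw [henv₂, Function.update_of_ne (by omega), eo]
    rw [yatesLevel, hB, eval_ite, eval_lt, eval_mul, eval_var, eval_var, eval_var, f21, f24, fo]
    by_cases hp : p < B * dout
    · rw [if_pos hp, if_neg one_ne_zero, if_pos hp, eval_mod, eval_var, h24.h13, eval_sum, fd]
      congr 1
      refine Finset.sum_congr rfl fun i hi => ?_
      rw [Finset.mem_range] at hi
      have h15 := h24.update (x := 15) (by norm_num) i
      rw [eval_bind]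
      set idx := p % dout * din + i with hidx
      have hidx_eval : (mod (var 21) (var doutReg) * var dinReg + var 15).eval μ
          (Function.update env₂ 15 i) = idx := by
        have g1 : Function.update env₂ 15 i doutReg = dout := by
          rcases eq_or_ne doutReg 15 with h' | h'
          · omega
          · rw [Function.update_of_ne h', fo]
        have g2 : Function.update env₂ 15 i dinReg = din := by
          rcases eq_or_ne dinReg 15 with h' | h'
          · omega
          · rw [Function.update_of_ne h', fd]
        rw [eval_add, eval_mul, eval_mod, eval_var, eval_var, eval_var, eval_var, g1, g2,
          Function.update_self, Function.update_of_ne (by norm_num), f21]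
      rw [hidx_eval]
      have h25 := h15.update (x := 25) (by norm_num) idx
      have hlt : idx < dout * din := by
        have := Nat.mod_lt p hdout
        calc idx < (p % dout + 1) * din := by rw [Nat.succ_mul]; omega
          _ ≤ _ := Nat.mul_le_mul_right _ this
      have hdiv : idx / din = p % dout := by
        rw [hidx, Nat.add_comm, Nat.add_mul_div_right _ _ hdin, Nat.div_eq_of_lt hi, Nat.zero_add]
      have hmod : idx % din = i := by
        rw [hidx, Nat.add_comm, Nat.add_mul_mod_self_right, Nat.mod_eq_of_lt hi]
      set env₃ := Function.update (Function.update env₂ 15 i) 25 idx with henv₃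
      have k25 : env₃ 25 = idx := by simp [env₃]
      have k23 : env₃ 23 = j + 1 := by simp [env₃, f23]
      have k24 : env₃ 24 = B := by simp [env₃, f24]
      have k21 : env₃ 21 = p := by simp [env₃, f21]
      have k15 : env₃ 15 = i := by simp [env₃]
      have ko : env₃ doutReg = dout := by
        rw [henv₃, Function.update_of_ne (by omega), Function.update_of_ne (by omega), fo]
      rw [eval_mul, eval_add, eval_mul, eval_table, eval_table, eval_sub, eval_load, eval_add,
        hlo _ h25]
      simp only [eval_add, eval_mul, eval_sub, eval_one, eval_var, eval_div, k25, k23, k24, k21,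
        k15, ko, h25.h8, h25.h13, if_pos hlt, hdiv, hmod, Nat.add_sub_cancel]
      -- The offset is below R, so the address read decodes to level j and precedes a.
      have hin : i * B + p / dout < S.R n := by
        have h1 : p / dout < B := Nat.div_lt_of_lt_mul (by rwa [mul_comm])
        have h2 : i * B + p / dout < din * B :=
          calc i * B + p / dout < (i + 1) * B := by rw [Nat.succ_mul]; omega
            _ ≤ _ := Nat.mul_le_mul_right _ hi
        have h3 : din * B ≤ S.R n := by
          rw [← hB, ← mul_assoc, ← pow_succ']
          have := hsmall j (by omega)
          rwa [show S.k n - j = S.k n - (j + 1) + 1 by omega] at this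
        omega
      rw [hμ]
      · rw [Nat.add_comm (j * S.R n), Nat.add_mul_div_right _ _ hR, Nat.div_eq_of_lt hin,
          Nat.add_mul_mod_self_right, Nat.mod_eq_of_lt hin, Nat.zero_add, coeff]
      · rw [← haj, Nat.mul_succ, mul_comm j]
        omega
    · rw [if_neg hp, if_pos rfl, if_neg hp, eval_zero]

end Scheme

/-! ### The arrays that the algorithm computes -/

/-- The index is stored below the value in base P, so the remainder of the maximum is the index of a
maximizer. -/
theorem sup_mul_add_spec {P : ℕ} (hP : 0 < P) (t : ℕ → ℕ) :
    ∀ p < P, t p ≤ t ((Finset.range P).sup (fun p => t p * P + p) % P) := by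
  intro p hp
  obtain ⟨q, hq, he⟩ := Finset.exists_mem_eq_sup (Finset.range P) ⟨0, Finset.mem_range.2 hP⟩
    fun p => t p * P + p
  rw [Finset.mem_range] at hq
  have hle := Finset.le_sup (f := fun p => t p * P + p) (Finset.mem_range.2 hp)
  rw [he] at hle ⊢
  rw [Nat.add_comm (t q * P), Nat.add_mul_mod_self_right, Nat.mod_eq_of_lt hq]
  by_contra hlt
  have : (t q + 1) * P ≤ t p * P := Nat.mul_le_mul_right _ (by omega)
  rw [Nat.succ_mul] at this
  omega

/-- In the summation identity for the indicator of (x, z), a missing preimage would make the left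
side 0, while the right side is 1. -/
theorem exists_rowIndex_colIndex {N : ℕ} (hN : 0 < N) {k x z : ℕ} (hx : x < N ^ k)
    (hz : z < N ^ k) : ∃ p < (N * N) ^ k, rowIndex N k p = x ∧ colIndex N k p = z := by
  by_contra! hcon
  have h := sum_rowIndex_colIndex hN k fun i l => if i = x ∧ l = z then 1 else 0
  rw [Finset.sum_eq_zero, Finset.sum_eq_single x, Finset.sum_eq_single z] at h
  · simp at h
  · intro l _ hl
    simp [hl]
  · exact fun h => absurd (Finset.mem_range.2 hz) h
  · intro i _ hi
    simp [hi]
  · exact fun h => absurd (Finset.mem_range.2 hx) h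
  · intro p hp
    rw [if_neg]
    exact fun h' => hcon p (Finset.mem_range.1 hp) h'.1 h'.2

namespace Scheme

variable (S : Scheme) (n : ℕ) (adj : ℕ → ℕ → ℕ)

/-- The initial entries for the first factor. -/
def leftSource (p : ℕ) : ℕ := S.leftEntry n adj (S.row n p) (S.col n p)

/-- The initial entries for the second factor. -/
def rightSource (p : ℕ) : ℕ := S.rightEntry n adj (S.row n p) (S.col n p)

/-- The levels of Yates' algorithm for the first factor. -/
def leftLevel : ℕ → ℕ → ℕ :=
  yatesLevel (S.M n) (S.k n) S.Q S.r S.F (S.leftSource n adj)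

/-- The levels of Yates' algorithm for the second factor. -/
def rightLevel : ℕ → ℕ → ℕ :=
  yatesLevel (S.M n) (S.k n) S.Q S.r S.G (S.rightSource n adj)

/-- The essential products. -/
def prodSource (q : ℕ) : ℕ := S.leftLevel n adj (S.k n) q * S.rightLevel n adj (S.k n) q

/-- The levels of Yates' algorithm for the matrix product. -/
def prodLevel : ℕ → ℕ → ℕ :=
  yatesLevel (S.M n) (S.k n) S.r S.Q S.W (S.prodSource n adj)

/-- The weight of the first two classes. -/
def pathWeight (x z y : ℕ) : ℕ :=
  classWeight adj (K n) n (S.m n) 0 (joinBlocks (S.m n) x y 0) +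
    classWeight adj (K n) n (S.m n) 1 (joinBlocks (S.m n) 0 y z)

/-- The maximum weight of a cut with two given blocks. -/
def pairValue (p : ℕ) : ℕ :=
  classWeight adj (K n) n (S.m n) 2 (joinBlocks (S.m n) (S.row n p) 0 (S.col n p)) +
    ∑ d ∈ Finset.range (wd n), if S.prodLevel n adj (S.k n) p / S.DK n < S.Z n ^ d * S.Z n
      then 0 else 1

/-- The running maximum of the values of pairs of blocks. -/
def pairMax (p : ℕ) : ℕ :=
  (Finset.range (p + 1)).sup fun p => S.pairValue n adj p * (S.L n * S.L n) + p

/-- The best pair of blocks. -/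
def bestPair : ℕ := S.pairMax n adj (S.L n * S.L n - 1) % (S.L n * S.L n)

/-- The running maximum of the weights for the remaining block. -/
def midMax (y : ℕ) : ℕ :=
  (Finset.range (y + 1)).sup fun y => S.pathWeight n adj (S.row n (S.bestPair n adj))
    (S.col n (S.bestPair n adj)) y * S.L n + y

/-- The best choice for the remaining block. -/
def bestMid : ℕ := S.midMax n adj (S.L n - 1) % S.L n

/-- The mask of the best cut. -/
def mask : ℕ :=
  joinBlocks (S.m n) (S.row n (S.bestPair n adj)) (S.bestMid n adj) (S.col n (S.bestPair n adj))

variable {S n adj}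

theorem L_pos : 0 < S.L n := by rw [L]; positivity

theorem Z_pos : 0 < S.Z n := Nat.succ_pos _

theorem DK_pos : 0 < S.DK n := Nat.pow_pos S.D_pos

theorem M_pos : 0 < S.M n := Nat.mul_pos DK_pos (Nat.pow_pos Z_pos)

theorem Q_pos : 0 < S.Q := by rw [Q]; positivity

theorem r_pos : 0 < S.r := Q_pos.trans_le S.le_r

theorem pow_e_k : (2 ^ S.e) ^ S.k n = S.L n := by rw [L, m, pow_mul]

theorem Q_pow_k : S.Q ^ S.k n = S.L n * S.L n := by rw [Q, mul_pow, pow_e_k]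

theorem row_lt (p : ℕ) : S.row n p < S.L n := by
  rw [← pow_e_k]
  exact rowIndex_lt (by positivity) _ _

theorem col_lt (p : ℕ) : S.col n p < S.L n := by
  rw [← pow_e_k]
  exact colIndex_lt (by positivity) _ _

/-- `k` is n / (3e) rounded up. The blocks may extend beyond the n vertices, which is harmless
because weights and sets ignore the digits from n on. -/
theorem le_three_mul_m : n ≤ 3 * S.m n := by
  have he := S.e_pos
  have h : n + (3 * S.e - 1) < 3 * S.e * (S.k n + 1) := Nat.lt_mul_div_succ _ (by omega)
  have h2 : 3 * S.m n = 3 * S.e * S.k n := by rw [m, mul_assoc]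
  rw [Nat.mul_succ] at h
  omega

theorem pathWeight_lt (x z y : ℕ) : S.pathWeight n adj x z y < wd n :=
  Nat.lt_succ_of_le (classWeight_zero_add_one_le _ _)

/-- There are L < Z summands, each at most Z^(wd - 1). The bound justifies the modulus. -/
theorem sum_pathWeight_lt (x z : ℕ) :
    ∑ y ∈ Finset.range (S.L n), S.Z n ^ S.pathWeight n adj x z y < S.Z n ^ wd n := by
  calc ∑ y ∈ Finset.range (S.L n), S.Z n ^ S.pathWeight n adj x z y
      ≤ ∑ y ∈ Finset.range (S.L n), S.Z n ^ (wd n - 1) := by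
        refine Finset.sum_le_sum fun y _ => Nat.pow_le_pow_right Z_pos ?_
        have := pathWeight_lt (S := S) (n := n) (adj := adj) x z y
        omega
    _ = S.L n * S.Z n ^ (wd n - 1) := by simp
    _ < S.Z n * S.Z n ^ (wd n - 1) :=
        Nat.mul_lt_mul_of_pos_right (Nat.lt_succ_self _) (Nat.pow_pos Z_pos)
    _ = S.Z n ^ wd n := by
        rw [← pow_succ']
        rfl

/-- In ZMod M both sides agree by the Kronecker power of the bilinear algorithm. Both are below M,
so they agree as natural numbers and the division by `DK` is exact. -/
theorem prodLevel_eq {p : ℕ} (hp : p < S.L n * S.L n) :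
    S.prodLevel n adj (S.k n) p = S.DK n *
      ∑ y ∈ Finset.range (S.L n), S.Z n ^ S.pathWeight n adj (S.row n p) (S.col n p) y := by
  have hN : 0 < 2 ^ S.e := by positivity
  have hscheme : ∀ a < 2 ^ S.e * 2 ^ S.e, ∀ b < 2 ^ S.e * 2 ^ S.e, ∀ c < 2 ^ S.e * 2 ^ S.e,
      ∑ q ∈ Finset.range S.r, (S.F q a : ZMod (S.M n)) * (S.G q b : ZMod (S.M n)) *
        (S.W c q : ZMod (S.M n)) =
      if a / 2 ^ S.e = c / 2 ^ S.e ∧ a % 2 ^ S.e = b / 2 ^ S.e ∧ b % 2 ^ S.e = c % 2 ^ S.e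
        then (S.D : ZMod (S.M n)) else 0 := by
    intro a ha b hb c hc
    have h := congrArg (Int.cast : ℤ → ZMod (S.M n)) (S.spec a ha b hb c hc)
    push_cast at h
    exact h
  have key := kron_matMul hN hscheme (S.k n) p (fun x y => (S.leftEntry n adj x y : ZMod (S.M n)))
    (fun y z => (S.rightEntry n adj y z : ZMod (S.M n)))
  have hcast : ((S.prodLevel n adj (S.k n) p : ℕ) : ZMod (S.M n)) = ((S.DK n *
      ∑ y ∈ Finset.range (S.L n), S.Z n ^ S.pathWeight n adj (S.row n p) (S.col n p) y : ℕ) :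
        ZMod (S.M n)) := by
    rw [prodLevel, yatesLevel_cast M_pos r_pos Q_pos _ _ _ (by rwa [Q_pow_k])]
    rw [DK]
    push_cast
    rw [← pow_e_k]
    convert key using 1
    · refine Finset.sum_congr rfl fun q hq => ?_
      rw [Finset.mem_range] at hq
      rw [prodSource, leftLevel, rightLevel]
      push_cast
      rw [yatesLevel_cast M_pos Q_pos r_pos _ _ _ hq, yatesLevel_cast M_pos Q_pos r_pos _ _ _ hq]
      rfl
    · congr 1
      refine Finset.sum_congr rfl fun y _ => ?_
      rw [leftEntry, rightEntry, pathWeight, pow_add]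
      push_cast
      rfl
  rw [ZMod.natCast_eq_natCast_iff'] at hcast
  rwa [Nat.mod_eq_of_lt (show S.prodLevel n adj (S.k n) p < S.M n from yatesLevel_lt M_pos _ _ _ _),
    Nat.mod_eq_of_lt] at hcast
  exact Nat.mul_lt_mul_of_pos_left (sum_pathWeight_lt _ _) DK_pos

theorem pairValue_eq {p : ℕ} (hp : p < S.L n * S.L n) : S.pairValue n adj p =
    classWeight adj (K n) n (S.m n) 2 (joinBlocks (S.m n) (S.row n p) 0 (S.col n p)) +
      (Finset.range (S.L n)).sup (S.pathWeight n adj (S.row n p) (S.col n p)) := by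
  rw [pairValue, prodLevel_eq hp, Nat.mul_div_cancel_left _ DK_pos,
    ← sum_indicator_pow_le L_pos (Nat.lt_succ_self _) _ fun y _ => pathWeight_lt _ _ y]
  congr 1
  refine Finset.sum_congr rfl fun d _ => ?_
  rw [← pow_succ]
  simp only [← not_lt, ite_not]
  rfl

/-- The mask is that of a cut with maximum weight. -/
theorem mask_maximal (X : ℕ) (hX : X < 2 ^ n) :
    cutWeight adj (K n) n X ≤ cutWeight adj (K n) n (S.mask n adj) := by
  have hLL : 0 < S.L n * S.L n := Nat.mul_pos L_pos L_pos
  obtain ⟨x, hx, y, hy, z, hz, rfl⟩ := exists_joinBlocks (m := S.m n)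
    (hX.trans_le (Nat.pow_le_pow_right (by norm_num) le_three_mul_m))
  have hmid : S.bestMid n adj < 2 ^ S.m n := Nat.mod_lt _ L_pos
  rw [cutWeight_joinBlocks hx hy, mask, cutWeight_joinBlocks (row_lt _) hmid]
  obtain ⟨p, hp, hpx, hpz⟩ := exists_rowIndex_colIndex (N := 2 ^ S.e) (by positivity)
    (k := S.k n) (x := x) (z := z) (by rwa [pow_e_k]) (by rwa [pow_e_k])
  have hp' : p < S.L n * S.L n := by rwa [← Q_pow_k]
  have h1 := sup_mul_add_spec hLL (S.pairValue n adj) p hp'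
  have h2 : (Finset.range (S.L n * S.L n)).sup
      (fun p => S.pairValue n adj p * (S.L n * S.L n) + p) % (S.L n * S.L n) =
        S.bestPair n adj := by
    rw [bestPair, pairMax, Nat.sub_add_cancel hLL]
  rw [h2, pairValue_eq hp', pairValue_eq (show S.bestPair n adj < S.L n * S.L n from
    Nat.mod_lt _ hLL)] at h1
  have h3 := Finset.le_sup (f := S.pathWeight n adj (S.row n p) (S.col n p))
    (Finset.mem_range.2 (show y < S.L n from hy))
  -- The matrix product yields the maximum over y but not a maximizer, which is found by a separate
  -- scan for the chosen pair alone.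
  have h4 : (Finset.range (S.L n)).sup (S.pathWeight n adj (S.row n (S.bestPair n adj))
      (S.col n (S.bestPair n adj))) ≤ S.pathWeight n adj (S.row n (S.bestPair n adj))
      (S.col n (S.bestPair n adj)) (S.bestMid n adj) := by
    refine Finset.sup_le fun y' hy' => ?_
    have h5 := sup_mul_add_spec L_pos (S.pathWeight n adj (S.row n (S.bestPair n adj))
      (S.col n (S.bestPair n adj))) y' (Finset.mem_range.1 hy')
    rwa [bestMid, midMax, Nat.sub_add_cancel L_pos]
  rw [row, col, hpx, hpz] at h1 h3
  simp only [pathWeight] at h1 h3 h4 ⊢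
  omega

end Scheme

namespace Scheme

/-! ### The program -/

section Program

variable (S : Scheme)

/-- The memory cell number `a` of array `t`. -/
def cellE (t : ℕ) (a : Exp) : Exp := load (const t * var 9 + a)

/-- The new number of the vertex in register `16`, with the mask in register `20`. -/
def relabelE : Exp :=
  ite (bitE 20 16) (sum 15 16 (bitE 20 15)) (sum 15 0 (bitE 20 15) + sum 15 16 (1 - bitE 20 15))

/-- The number of vertices in the mask in register `20`. -/
def sizeE : Exp := sum 15 0 (bitE 20 15)

/-- Compute the offset and the number of the vertices on one side of the cut. -/
def sideE (b : Bool) (e : Exp) : Exp :=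
  bind 20 (cellE 6 0) (bind 29 sizeE (bind 26 (if b then var 29 else 0)
    (bind 27 (if b then var 0 - var 29 else var 29) e)))

/-- The value of the pair of blocks in register `21`. -/
def pairE : Exp :=
  bind 20 (joinE (rowE S) 0 (colE S)) (weightE 2) +
    bind 22 (cellE 3 (var 1 * var 8 + var 21) / var 12)
      (sum 15 4 (ite (lt (var 22) (prod 14 15 (var 11) * var 11)) 0 1))

/-- The best pair of blocks. -/
def bestPairE : Exp := mod (cellE 4 (var 10 * var 10 - 1)) (var 10 * var 10)

/-- The weight for the middle block in register `31`. -/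
def midE : Exp :=
  bind 20 (joinE (var 18) (var 31) 0) (weightE 0) + bind 20 (joinE 0 (var 31) (var 19)) (weightE 1)

/-- One cell of the dynamic programming table `t`. -/
def orderE (t : ℕ) : Exp :=
  sup 17 0 (ite (lt (var 17) (var 27) * bitE 31 17) (bind 28 (var 31 - prod 14 17 2)
    ((cellE t (var 28) / (var 0 + 1) + sum 16 0 (bitE 28 16 *
      load (cellE 7 (var 26 + var 16) * var 0 + cellE 7 (var 26 + var 17))) + 1) * (var 0 + 1) +
        var 17)) 0)

/-- The number of the prefixes in array `t` that contain the vertex in register `x`. -/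
def countE (t x : ℕ) : Exp := sum 17 7 (mod (cellE t (var 17) / pow 2 (var x) 14 0) 2)

/-- The final position of the vertex in register `16`. -/
def positionE : Exp :=
  bind 20 (cellE 6 0) (bind 29 sizeE (bind 28 relabelE (ite (lt (var 28) (var 29))
    (var 29 - countE 10 28)
    (var 29 + (var 0 - var 29 - bind 30 (var 28 - var 29) (countE 11 30))))))

/-- The expression for the cell with the number in register `31` of array `t`. -/
def phaseExp : ℕ → Exp
  | 1 => yatesE (const 1 * var 9) (leftE S) S.F S.Q S.r 6 5
  | 2 => yatesE (const 2 * var 9) (rightE S) S.G S.Q S.r 6 5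
  | 3 => yatesE (const 3 * var 9) (cellE 1 (var 1 * var 8 + var 21) *
      cellE 2 (var 1 * var 8 + var 21)) S.W S.r S.Q 5 6
  | 4 => max (ite (eq (var 31) 0) 0 (cellE 4 (var 31 - 1)))
      (bind 21 (var 31) (pairE S * (var 10 * var 10) + var 21))
  | 5 => max (ite (eq (var 31) 0) 0 (cellE 5 (var 31 - 1)))
      (bind 21 bestPairE (bind 18 (rowE S) (bind 19 (colE S) (midE * var 10 + var 31))))
  | 6 => bind 21 bestPairE (joinE (rowE S) (mod (cellE 5 (var 10 - 1)) (var 10)) (colE S))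
  | 7 => bind 20 (cellE 6 0) (sum 16 0 (ite (eq relabelE (var 31)) (var 16) 0))
  | 8 => sideE false (orderE 8)
  | 9 => sideE true (orderE 9)
  | 10 => ite (eq (var 31) 0) (sideE false (pow 2 (var 27) 14 0 - 1))
      (bind 28 (cellE 10 (var 31 - 1))
        (var 28 - pow 2 (mod (cellE 8 (var 28)) (var 0 + 1)) 14 7))
  | 11 => ite (eq (var 31) 0) (sideE true (pow 2 (var 27) 14 0 - 1))
      (bind 28 (cellE 11 (var 31 - 1))
        (var 28 - pow 2 (mod (cellE 9 (var 28)) (var 0 + 1)) 14 7))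
  -- Renumbering iterates up to the vertex, and register 31 may not bound an iteration. The vertex
  -- is therefore matched with the loop counter 16, which may.
  | _ => sum 16 0 (ite (eq (var 16) (var 31)) positionE 0)

/-- The expression for the length of array `t`. -/
def lenExp : ℕ → Exp
  | 1 => var 9
  | 2 => var 9
  | 3 => var 9
  | 4 => var 10 * var 10
  | 5 => var 10
  | 6 => 1
  | 7 => var 0
  | 8 => sideE false (pow 2 (var 27) 14 0)
  | 9 => sideE true (pow 2 (var 27) 14 0)
  | 10 => var 0 + 1
  | 11 => var 0 + 1
  | _ => var 0

theorem phaseExp_wf (t : ℕ) : (S.phaseExp t).WF small := by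
  unfold phaseExp
  split <;> simp [small, cellE, relabelE, sizeE, sideE, pairE, bestPairE, midE, orderE, countE,
    positionE, yatesE, leftE, rightE, rowE, colE, joinE, weightE, bitE, wf_table]

theorem lenExp_wf (t : ℕ) : (lenExp t).WF small := by
  unfold lenExp
  split <;> simp [small, cellE, sizeE, sideE, bitE]

end Program

/-! ### Contents of the arrays -/

section Contents

variable (S : Scheme) (n : ℕ) (adj : ℕ → ℕ → ℕ)

/-- The number of vertices in the first part. -/
def cutCard : ℕ := maskSize n (S.mask n adj)

/-- The offset of the vertices on one side of the cut. -/
def sideOff (b : Bool) : ℕ := if b then S.cutCard n adj else 0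

/-- The number of vertices on one side of the cut. -/
def sideLen (b : Bool) : ℕ := if b then n - S.cutCard n adj else S.cutCard n adj

/-- Adjacency on one side of the cut. -/
def sideAdj (b : Bool) : ℕ → ℕ → ℕ := shiftedAdj adj n (S.mask n adj) (S.sideOff n adj b)

/-- The length of array `t`. -/
def len : ℕ → ℕ
  | 0 => n * n
  | 1 => S.H n
  | 2 => S.H n
  | 3 => S.H n
  | 4 => S.L n * S.L n
  | 5 => S.L n
  | 6 => 1
  | 7 => n
  | 8 => 2 ^ S.sideLen n adj false
  | 9 => 2 ^ S.sideLen n adj true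
  | 10 => n + 1
  | 11 => n + 1
  | _ => n

/-- The contents of array `t`. -/
def arr : ℕ → ℕ → ℕ
  | 0 => fun a => adj (a / n) (a % n)
  | 1 => fun a => S.leftLevel n adj (a / S.R n) (a % S.R n)
  | 2 => fun a => S.rightLevel n adj (a / S.R n) (a % S.R n)
  | 3 => fun a => S.prodLevel n adj (a / S.R n) (a % S.R n)
  | 4 => S.pairMax n adj
  | 5 => S.midMax n adj
  | 6 => fun _ => S.mask n adj
  | 7 => vertexAt n (S.mask n adj)
  | 8 => bestOrder (S.sideAdj n adj false) n (S.sideLen n adj false)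
  | 9 => bestOrder (S.sideAdj n adj true) n (S.sideLen n adj true)
  | 10 => prefixMask (S.sideAdj n adj false) n (S.sideLen n adj false)
  | 11 => prefixMask (S.sideAdj n adj true) n (S.sideLen n adj true)
  | _ => finalPosition adj n (S.mask n adj)

/-- The arrays with numbers below `t` have the right contents. -/
def Good (t : ℕ) (μ : ℕ → ℕ) : Prop :=
  ∀ ρ < t, ∀ i < S.len n adj ρ, μ (ρ * S.H n + i) = S.arr n adj ρ i

end Contents

/-! ### The expressions compute the contents of the arrays -/

section Evaluation

variable {S : Scheme} {n t : ℕ} {adj : ℕ → ℕ → ℕ} {env μ : ℕ → ℕ}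

theorem Good.adj_eq (hg : S.Good n adj t μ) (ht : 0 < t) : ∀ u < n, ∀ v < n,
    μ (u * n + v) = adj u v := by
  intro u hu v hv
  have h1 : u * n + v < n * n :=
    calc u * n + v < (u + 1) * n := by rw [Nat.succ_mul]; omega
      _ ≤ _ := Nat.mul_le_mul_right _ hu
  have h := hg 0 ht (u * n + v) h1
  rw [Nat.zero_mul, Nat.zero_add] at h
  rw [h, arr]
  simp only
  rw [Nat.add_comm, Nat.add_mul_div_right _ _ (by omega), Nat.div_eq_of_lt hv, Nat.zero_add,
    Nat.add_mul_mod_self_right, Nat.mod_eq_of_lt hv]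

theorem eval_cellE (h : S.Par n env) (t : ℕ) (a : Exp) :
    (cellE t a).eval μ env = μ (t * S.H n + a.eval μ env) := by
  simp [cellE, h.h9]

theorem Good.cell (hg : S.Good n adj t μ) (h : S.Par n env) {ρ : ℕ} (hρ : ρ < t) {a : Exp} {i : ℕ}
    (ha : a.eval μ env = i) (hi : i < S.len n adj ρ) :
    (cellE ρ a).eval μ env = S.arr n adj ρ i := by
  rw [eval_cellE h, ha, hg ρ hρ i hi]

theorem R_pos : 0 < S.R n := by
  have : 0 < S.r ^ S.k n := Nat.pow_pos r_pos
  rw [R]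
  positivity

theorem pow_mul_pow_le (x y j : ℕ) (hx : x ≤ S.r) (hy : y ≤ S.r) (hj : j ≤ S.k n) :
    x ^ (S.k n - j) * y ^ j ≤ S.R n := by
  calc x ^ (S.k n - j) * y ^ j ≤ S.r ^ (S.k n - j) * S.r ^ j :=
        Nat.mul_le_mul (Nat.pow_le_pow_left hx _) (Nat.pow_le_pow_left hy _)
    _ = S.r ^ S.k n := by rw [← pow_add, Nat.sub_add_cancel hj]
    _ ≤ S.R n := by
      rw [R]
      exact Nat.le_mul_of_pos_left _ (by positivity)

theorem eval_phase_left (hg : S.Good n adj 1 μ) (h : S.Par n env) {i : ℕ} (hi : i < S.H n)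
    (h31 : env 31 = i) (hμ : ∀ j < i, μ (1 * S.H n + j) = S.arr n adj 1 j) :
    (S.phaseExp 1).eval μ env = S.arr n adj 1 i :=
  eval_yatesE h (by norm_num) (by norm_num) h.h6 h.h5 Q_pos r_pos
    (fun j hj => pow_mul_pow_le _ _ _ S.le_r le_rfl hj) (fun env' h' => by simp [h'.h9])
    (fun env' h' _ => eval_leftE h' (hg.adj_eq one_pos)) hi h31 hμ

theorem eval_phase_right (hg : S.Good n adj 2 μ) (h : S.Par n env) {i : ℕ} (hi : i < S.H n)
    (h31 : env 31 = i) (hμ : ∀ j < i, μ (2 * S.H n + j) = S.arr n adj 2 j) :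
    (S.phaseExp 2).eval μ env = S.arr n adj 2 i :=
  eval_yatesE h (by norm_num) (by norm_num) h.h6 h.h5 Q_pos r_pos
    (fun j hj => pow_mul_pow_le _ _ _ S.le_r le_rfl hj) (fun env' h' => by simp [h'.h9])
    (fun env' h' _ => eval_rightE h' (hg.adj_eq two_pos)) hi h31 hμ

theorem level_index {q : ℕ} (hq : q < S.R n) : S.k n * S.R n + q < S.H n ∧
    (S.k n * S.R n + q) / S.R n = S.k n ∧ (S.k n * S.R n + q) % S.R n = q := by
  refine ⟨?_, ?_, ?_⟩
  · rw [H, Nat.succ_mul]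
    omega
  · rw [Nat.add_comm, Nat.add_mul_div_right _ _ R_pos, Nat.div_eq_of_lt hq, Nat.zero_add]
  · rw [Nat.add_comm, Nat.add_mul_mod_self_right, Nat.mod_eq_of_lt hq]

theorem eval_phase_prod (hg : S.Good n adj 3 μ) (h : S.Par n env) {i : ℕ} (hi : i < S.H n)
    (h31 : env 31 = i) (hμ : ∀ j < i, μ (3 * S.H n + j) = S.arr n adj 3 j) :
    (S.phaseExp 3).eval μ env = S.arr n adj 3 i := by
  refine eval_yatesE h (by norm_num) (by norm_num) h.h5 h.h6 r_pos Q_pos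
    (fun j hj => pow_mul_pow_le _ _ _ le_rfl S.le_r hj) (fun env' h' => by simp [h'.h9])
    (fun env' h' hq => ?_) hi h31 hμ
  have hR : env' 21 < S.R n := by
    have := pow_mul_pow_le (S := S) (n := n) S.r S.r 0 le_rfl le_rfl (Nat.zero_le _)
    rw [Nat.sub_zero, pow_zero, Nat.mul_one] at this
    omega
  obtain ⟨h1, h2, h3⟩ := level_index hR
  have he : (var 1 * var 8 + var 21 : Exp).eval μ env' = S.k n * S.R n + env' 21 := by
    simp [h'.h1, h'.h8]
  rw [eval_mul, hg.cell h' (ρ := 1) (by norm_num) he h1, hg.cell h' (ρ := 2) (by norm_num) he h1]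
  simp only [arr, h2, h3]
  rfl

/-- By L² = (N²)^k and N² ≤ r. The factor of order n² in `R` gives room for the remaining arrays,
including the tables over subsets. -/
theorem L_mul_L_le_R : 4 * ((n + 1) * (n + 1)) * (S.L n * S.L n) ≤ S.R n := by
  rw [R, ← Q_pow_k]
  exact Nat.mul_le_mul_left _ (Nat.pow_le_pow_left S.le_r _)

theorem R_le_H : S.R n ≤ S.H n := by
  rw [H]
  exact Nat.le_mul_of_pos_left _ (Nat.succ_pos _)

theorem L_mul_L_le_R' : S.L n * S.L n ≤ S.R n :=
  (Nat.le_mul_of_pos_left _ (by positivity)).trans L_mul_L_le_R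

theorem eval_pairE (hg : S.Good n adj 4 μ) (h : S.Par n env) {p : ℕ} (hp : p < S.L n * S.L n)
    (h21 : env 21 = p) : (pairE S).eval μ env = S.pairValue n adj p := by
  obtain ⟨h1, h2, h3⟩ := level_index (hp.trans_le L_mul_L_le_R')
  have he : (var 1 * var 8 + var 21 : Exp).eval μ env = S.k n * S.R n + p := by
    simp [h.h1, h.h8, h21]
  rw [pairE, eval_add, eval_bind, eval_weightE (h.update (by norm_num) _) (hg.adj_eq (by norm_num)),
    Function.update_self, eval_joinE h, eval_rowE h, eval_colE h, eval_zero, h21, pairValue,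
    eval_bind, eval_div, hg.cell h (ρ := 3) (by norm_num) he h1, eval_var, h.h12, eval_sum]
  simp only [arr, h2, h3]
  rw [Function.update_of_ne (by norm_num), h.h4]
  congr 1
  refine Finset.sum_congr rfl fun d _ => ?_
  rw [eval_ite, eval_lt]
  simp only [eval_var, eval_mul, eval_prod, eval_zero, eval_one]
  simp [h.h11]
  split_ifs <;> omega

theorem eval_runMax {t : ℕ} (h : S.Par n env) {f : ℕ → ℕ} {i : ℕ} (h31 : env 31 = i)
    (hμ : ∀ j < i, μ (t * S.H n + j) = (Finset.range (j + 1)).sup f) {e : Exp}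
    (he : e.eval μ env = f i) :
    (max (ite (eq (var 31) 0) 0 (cellE t (var 31 - 1))) e).eval μ env =
      (Finset.range (i + 1)).sup f := by
  rw [Finset.range_add_one, Finset.sup_insert, sup_comm, eval_max, he, eval_ite, eval_eq, eval_cellE h]
  simp only [eval_var, h31, eval_zero, eval_sub, eval_one]
  congr 1
  rcases i with _ | i
  · simp
  · rw [if_neg (Nat.succ_ne_zero i), if_pos rfl, Nat.add_sub_cancel, hμ i (Nat.lt_succ_self i)]

theorem eval_phase_pair (hg : S.Good n adj 4 μ) (h : S.Par n env) {i : ℕ}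
    (hi : i < S.L n * S.L n) (h31 : env 31 = i)
    (hμ : ∀ j < i, μ (4 * S.H n + j) = S.arr n adj 4 j) :
    (S.phaseExp 4).eval μ env = S.arr n adj 4 i := by
  refine eval_runMax h h31 hμ ?_
  have h' := h.update (x := 21) (by norm_num) i
  rw [eval_bind, eval_var, h31, eval_add, eval_mul, eval_mul,
    eval_pairE hg h' hi (Function.update_self _ _ _)]
  simp [h.h10]

theorem eval_bestPairE (hg : S.Good n adj t μ) (ht : 4 < t) (h : S.Par n env) :
    bestPairE.eval μ env = S.bestPair n adj := by
  have hLL : 0 < S.L n * S.L n := Nat.mul_pos L_pos L_pos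
  have he : (var 10 * var 10 - 1 : Exp).eval μ env = S.L n * S.L n - 1 := by simp [h.h10]
  rw [bestPairE, eval_mod, hg.cell h ht he (Nat.sub_lt hLL one_pos)]
  simp [h.h10, bestPair, arr]

theorem eval_phase_mid (hg : S.Good n adj 5 μ) (h : S.Par n env) {i : ℕ} (h31 : env 31 = i)
    (hμ : ∀ j < i, μ (5 * S.H n + j) = S.arr n adj 5 j) :
    (S.phaseExp 5).eval μ env = S.arr n adj 5 i := by
  refine eval_runMax h h31 hμ ?_
  rw [eval_bind, eval_bestPairE hg (by norm_num) h, eval_bind]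
  have h21 := h.update (x := 21) (by norm_num) (S.bestPair n adj)
  rw [eval_rowE h21, Function.update_self, eval_bind]
  have h18 := h21.update (x := 18) (by norm_num) (S.row n (S.bestPair n adj))
  rw [eval_colE h18]
  rw [Function.update_of_ne (by norm_num), Function.update_self]
  have h19 := h18.update (x := 19) (by norm_num) (S.col n (S.bestPair n adj))
  have hadj := hg.adj_eq (by norm_num)
  rw [eval_add, eval_mul, midE, eval_add, eval_bind, eval_bind,
    eval_weightE (h19.update (by norm_num) _) hadj, eval_weightE (h19.update (by norm_num) _) hadj,
    Function.update_self, Function.update_self, eval_joinE h19, eval_joinE h19]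
  simp [h31, h.h10, pathWeight]

theorem eval_phase_mask (hg : S.Good n adj 6 μ) (h : S.Par n env) (i : ℕ) :
    (S.phaseExp 6).eval μ env = S.arr n adj 6 i := by
  have h21 := h.update (x := 21) (by norm_num) (S.bestPair n adj)
  have he : (var 10 - 1 : Exp).eval μ (Function.update env 21 (S.bestPair n adj)) = S.L n - 1 := by
    simp [h.h10]
  rw [phaseExp, eval_bind, eval_bestPairE hg (by norm_num) h, eval_joinE h21, eval_rowE h21,
    eval_colE h21, Function.update_self, eval_mod,
    hg.cell h21 (by norm_num) he (Nat.sub_lt L_pos one_pos), eval_var, h21.h10]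
  rfl

theorem eval_maskE (hg : S.Good n adj t μ) (ht : 6 < t) (h : S.Par n env) :
    (cellE 6 0).eval μ env = S.mask n adj :=
  hg.cell h ht (eval_zero _ _) one_pos

theorem eval_relabelE (h : S.Par n env) :
    relabelE.eval μ env = relabel n (env 20) (env 16) := by
  have hb := bitn_le_one (env 20) (env 16)
  simp only [relabelE, eval_ite, eval_bitE, eval_sum, eval_add, eval_sub, eval_one, relabel, h.h0]
  simp only [ne_eq, show (20 : ℕ) ≠ 15 by norm_num, not_false_eq_true, Function.update_of_ne,
    Function.update_self]
  split_ifs <;> first | rfl | omega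

theorem eval_sizeE (h : S.Par n env) : sizeE.eval μ env = maskSize n (env 20) := by
  simp [sizeE, eval_bitE, maskSize, h.h0]

theorem eval_phase_vertex (hg : S.Good n adj 7 μ) (h : S.Par n env) {i : ℕ} (h31 : env 31 = i) :
    (S.phaseExp 7).eval μ env = S.arr n adj 7 i := by
  rw [phaseExp, eval_bind, eval_maskE hg (by norm_num) h, eval_sum,
    (h.update (by norm_num) _).h0, arr, vertexAt]
  refine Finset.sum_congr rfl fun v _ => ?_
  have h' := (h.update (x := 20) (by norm_num) (S.mask n adj)).update (x := 16) (by norm_num) v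
  rw [eval_ite, eval_eq, eval_relabelE h']
  simp [h31]

/-- Only these properties of the environment after the four bindings are used later, so the
environment itself is hidden. -/
theorem eval_sideE (hg : S.Good n adj t μ) (ht : 6 < t) (h : S.Par n env) (b : Bool) (e : Exp) :
    ∃ env', (sideE b e).eval μ env = e.eval μ env' ∧ S.Par n env' ∧ env' 31 = env 31 ∧
      env' 26 = S.sideOff n adj b ∧ env' 27 = S.sideLen n adj b := by
  have h20 := h.update (x := 20) (by norm_num) (S.mask n adj)
  have h29 := h20.update (x := 29) (by norm_num) (S.cutCard n adj)
  have h26 := h29.update (x := 26) (by norm_num) (S.sideOff n adj b)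
  have h27 := h26.update (x := 27) (by norm_num) (S.sideLen n adj b)
  refine ⟨_, ?_, h27, ?_, ?_, ?_⟩
  · rw [sideE, eval_bind, eval_maskE hg ht h, eval_bind, eval_sizeE h20, Function.update_self,
      eval_bind, eval_bind]
    have e26 : (if b = true then var 29 else 0 : Exp).eval μ (Function.update
        (Function.update env 20 (S.mask n adj)) 29 (maskSize n (S.mask n adj))) =
        S.sideOff n adj b := by
      cases b <;> simp [sideOff, cutCard]
    rw [e26]
    congr 2
    have := h26.h0
    cases b <;> simp [sideLen, cutCard, h.h0]
  all_goals simp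

theorem cutCard_le : S.cutCard n adj ≤ n := maskSize_le

theorem sideLen_le (b : Bool) : S.sideLen n adj b ≤ n := by
  have := cutCard_le (S := S) (n := n) (adj := adj)
  cases b <;> simp [sideLen, this]

theorem sideOff_add_sideLen_le (b : Bool) : S.sideOff n adj b + S.sideLen n adj b ≤ n := by
  have := cutCard_le (S := S) (n := n) (adj := adj)
  cases b <;> simp [sideOff, sideLen, this]

theorem eval_orderE (hg : S.Good n adj 8 μ) (h : S.Par n env) {b : Bool} {T ρ : ℕ}
    (h31 : env 31 = T) (h26 : env 26 = S.sideOff n adj b) (h27 : env 27 = S.sideLen n adj b)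
    (hT : T < 2 ^ S.sideLen n adj b)
    (hμ : ∀ j < T, μ (ρ * S.H n + j) = bestOrder (S.sideAdj n adj b) n (S.sideLen n adj b) j) :
    (orderE ρ).eval μ env = bestOrder (S.sideAdj n adj b) n (S.sideLen n adj b) T := by
  have hadj := hg.adj_eq (by norm_num)
  rw [bestOrder, orderE, eval_sup, h.h0]
  refine Finset.sup_congr rfl fun i hi => ?_
  have h17 := h.update (x := 17) (by norm_num) i
  have hc : (lt (var 17) (var 27) * bitE 31 17).eval μ (Function.update env 17 i) =
      if i < S.sideLen n adj b ∧ bitn T i = 1 then 1 else 0 := by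
    have := bitn_le_one T i
    rw [eval_mul, eval_lt, eval_bitE]
    simp only [eval_var, Function.update_self, ne_eq, show (27 : ℕ) ≠ 17 by norm_num,
      show (31 : ℕ) ≠ 17 by norm_num, not_false_eq_true, Function.update_of_ne, h27, h31]
    by_cases h1 : i < S.sideLen n adj b
    · by_cases h2 : bitn T i = 1
      · simp [h1, h2]
      · simp [h1, show bitn T i = 0 by omega]
    · simp [h1]
  rw [eval_ite, hc]
  by_cases hib : i < S.sideLen n adj b ∧ bitn T i = 1
  · have hpow : (prod 14 17 2).eval μ (Function.update env 17 i) = 2 ^ i := by simp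
    have hpos : 0 < 2 ^ i := by positivity
    have hle := two_pow_le_of_bitn hib.2
    have hlt : T - 2 ^ i < T := by omega
    rw [dif_pos hib, if_pos hib, if_neg one_ne_zero, eval_bind, eval_sub, hpow, eval_var,
      Function.update_of_ne (by norm_num), h31]
    have h28 := h17.update (x := 28) (by norm_num) (T - 2 ^ i)
    rw [eval_add, eval_mul, eval_add, eval_add, eval_div, eval_cellE h28, eval_var,
      Function.update_self, hμ _ hlt, eval_sum, h28.h0]
    simp only [eval_add, eval_var, eval_one, h28.h0]
    congr 4
    · refine Finset.sum_congr rfl fun j _ => ?_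
      have h16 := h28.update (x := 16) (by norm_num) j
      rw [eval_mul, eval_bitE]
      rw [Function.update_of_ne (by norm_num), Function.update_self, Function.update_self]
      -- For j outside the side the digit vanishes, so whatever is read from memory there is
      -- multiplied by 0; otherwise both renumbered indices are in range.
      rcases Nat.eq_zero_or_pos (bitn (T - 2 ^ i) j) with h0 | h0
      · rw [h0, Nat.zero_mul, Nat.zero_mul]
      · have hj : j < S.sideLen n adj b := by
          by_contra hge
          rw [bitn_of_lt (hlt.trans hT) (not_lt.1 hge)] at h0
          exact lt_irrefl _ h0
        have hoff := sideOff_add_sideLen_le (S := S) (n := n) (adj := adj) b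
        congr 1
        rw [eval_load, eval_add, eval_mul]
        rw [hg.cell h16 (ρ := 7) (by norm_num) (i := S.sideOff n adj b + j)
            (by simp [h26]) (by rw [len]; omega),
          hg.cell h16 (ρ := 7) (by norm_num) (i := S.sideOff n adj b + i)
            (by simp [h26]) (by rw [len]; omega), eval_var, h16.h0]
        change μ (vertexAt n (S.mask n adj) _ * n + vertexAt n (S.mask n adj) _) = _
        rw [hadj _ (vertexAt_lt (by omega)) _ (vertexAt_lt (by omega))]
        rfl
  · rw [dif_neg hib, if_neg hib, if_pos rfl, eval_zero]

theorem eval_phase_order (b : Bool) {ρ : ℕ} (hg : S.Good n adj ρ μ) (h : S.Par n env) {i : ℕ}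
    (hρ : 8 ≤ ρ) (hi : i < 2 ^ S.sideLen n adj b) (h31 : env 31 = i)
    (hμ : ∀ j < i, μ (ρ * S.H n + j) = bestOrder (S.sideAdj n adj b) n (S.sideLen n adj b) j) :
    (sideE b (orderE ρ)).eval μ env = bestOrder (S.sideAdj n adj b) n (S.sideLen n adj b) i := by
  obtain ⟨env', he, h', h31', h26, h27⟩ := eval_sideE hg (by omega) h b (orderE ρ)
  rw [he]
  exact eval_orderE (fun τ hτ => hg τ (by omega)) h' (h31'.trans h31) h26 h27 hi hμ

theorem eval_sidePow (hg : S.Good n adj t μ) (ht : 6 < t) (h : S.Par n env) (b : Bool) :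
    (sideE b (pow 2 (var 27) 14 0)).eval μ env = 2 ^ S.sideLen n adj b := by
  obtain ⟨env', he, h', -, -, h27⟩ := eval_sideE hg ht h b (pow 2 (var 27) 14 0)
  rw [he]
  refine eval_pow _ _ _ _ _ _ _ _ (fun i => by simp) (fun i => by simp [h27]) ?_
  rw [h'.h0]
  exact sideLen_le b

/-- The exponent is a remainder modulo n + 1, so register 7 suffices to bound the power. The table
is always read at a valid mask because every prefix mask stays below 2 to the size of the side. -/
theorem eval_phase_prefix (b : Bool) {ρ τ : ℕ} (hg : S.Good n adj ρ μ) (h : S.Par n env) {i : ℕ}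
    (hρ : 6 < ρ) (hτ : ∀ j < 2 ^ S.sideLen n adj b, μ (τ * S.H n + j) =
      bestOrder (S.sideAdj n adj b) n (S.sideLen n adj b) j) (h31 : env 31 = i)
    (hμ : ∀ j < i, μ (ρ * S.H n + j) = prefixMask (S.sideAdj n adj b) n (S.sideLen n adj b) j) :
    (ite (eq (var 31) 0) (sideE b (pow 2 (var 27) 14 0 - 1)) (bind 28 (cellE ρ (var 31 - 1))
      (var 28 - pow 2 (mod (cellE τ (var 28)) (var 0 + 1)) 14 7))).eval μ env =
      prefixMask (S.sideAdj n adj b) n (S.sideLen n adj b) i := by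
  rw [eval_ite, eval_eq, eval_var, eval_zero, h31]
  rcases i with _ | i
  · rw [if_pos rfl, if_neg one_ne_zero, prefixMask]
    obtain ⟨env', he, h', -, -, h27⟩ := eval_sideE hg hρ h b (pow 2 (var 27) 14 0 - 1)
    rw [he, eval_sub, eval_one]
    congr 1
    refine eval_pow _ _ _ _ _ _ _ _ (fun i => by simp) (fun i => by simp [h27]) ?_
    rw [h'.h0]
    exact sideLen_le b
  · rw [if_neg (Nat.succ_ne_zero i), if_pos rfl, eval_bind, eval_cellE h]
    simp only [eval_sub, eval_var, h31, eval_one, Nat.add_sub_cancel]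
    rw [hμ i (Nat.lt_succ_self i), Function.update_self, prefixMask]
    congr 1
    set T := prefixMask (S.sideAdj n adj b) n (S.sideLen n adj b) i with hT
    have h28 := h.update (x := 28) (by norm_num) T
    refine eval_pow _ _ _ _ _ _ _ _ (fun i => by simp) (fun i => ?_) ?_
    · have h14 := h28.update (x := 14) (by norm_num) i
      rw [eval_mod, eval_cellE h14, eval_var, Function.update_of_ne (by norm_num),
        Function.update_self, hτ T (prefixMask_lt _), eval_add, eval_var, eval_one, h14.h0]
      rfl
    · rw [h28.h7]
      exact (Nat.mod_lt _ (Nat.succ_pos n)).le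

theorem eval_countE (h : S.Par n env) {ρ x i : ℕ} {f : ℕ → ℕ} (hx : 18 ≤ x) (hi : env x = i)
    (hin : i ≤ n) (hμ : ∀ j < n + 1, μ (ρ * S.H n + j) = f j) :
    (countE ρ x).eval μ env = ∑ j ∈ Finset.range (n + 1), bitn (f j) i := by
  rw [countE, eval_sum, h.h7]
  refine Finset.sum_congr rfl fun j hj => ?_
  have h17 := h.update (x := 17) (by norm_num) j
  rw [eval_mod, eval_div, eval_cellE h17, eval_var, Function.update_self,
    hμ j (Finset.mem_range.1 hj), bitn, eval_ofNat]
  rw [eval_pow (A := 2) (B := i)]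
  · intro l
    simp
  · intro l
    rw [eval_var, Function.update_of_ne (by omega), Function.update_of_ne (by omega), hi]
  · rw [h17.h0]
    exact hin

theorem eval_positionE (hg : S.Good n adj 12 μ) (h : S.Par n env) {v : ℕ} (hv : v < n)
    (h16 : env 16 = v) :
    positionE.eval μ env = finalPosition adj n (S.mask n adj) v := by
  have h20 := h.update (x := 20) (by norm_num) (S.mask n adj)
  have h29 := h20.update (x := 29) (by norm_num) (S.cutCard n adj)
  have h28 := h29.update (x := 28) (by norm_num) (relabel n (S.mask n adj) v)
  have hrel := relabel_lt (X := S.mask n adj) hv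
  have hcut : maskSize n (S.mask n adj) = S.cutCard n adj := rfl
  rw [positionE, eval_bind, eval_maskE hg (by norm_num) h, eval_bind, eval_sizeE h20,
    Function.update_self, hcut, eval_bind, eval_relabelE h29]
  rw [show Function.update (Function.update env 20 (S.mask n adj)) 29 (S.cutCard n adj) 20 =
    S.mask n adj by simp, show Function.update (Function.update env 20 (S.mask n adj)) 29
    (S.cutCard n adj) 16 = v by simp [h16], eval_ite, eval_lt, finalPosition, hcut]
  simp only [eval_var, Function.update_self, ne_eq, show (29 : ℕ) ≠ 28 by norm_num,
    not_false_eq_true, Function.update_of_ne, eval_sub, eval_add, eval_bind, h28.h0]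
  by_cases hlt : relabel n (S.mask n adj) v < S.cutCard n adj
  · rw [if_pos hlt, if_neg one_ne_zero, if_pos hlt, bestRank,
      eval_countE h28 (by norm_num) (Function.update_self _ _ _) hrel.le
        (fun j hj => hg 10 (by norm_num) j hj)]
    rfl
  · have h30 := h28.update (x := 30) (by norm_num)
      (relabel n (S.mask n adj) v - S.cutCard n adj)
    rw [if_neg hlt, if_pos rfl, if_neg hlt, bestRank,
      eval_countE h30 (by norm_num) (Function.update_self _ _ _) (by omega)
        (fun j hj => hg 11 (by norm_num) j hj)]
    rfl

theorem eval_phase_final (hg : S.Good n adj 12 μ) (h : S.Par n env) {i : ℕ} (hi : i < n)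
    (h31 : env 31 = i) :
    (S.phaseExp 12).eval μ env = S.arr n adj 12 i := by
  change (sum 16 0 (ite (eq (var 16) (var 31)) positionE 0)).eval μ env =
    finalPosition adj n (S.mask n adj) i
  rw [eval_sum, h.h0, Finset.sum_eq_single i]
  · rw [eval_ite, eval_positionE hg (h.update (by norm_num) _) hi (Function.update_self _ _ _)]
    · simp [h31]
  · intro v _ hne
    simp [h31, hne]
  · intro hn
    exact absurd (Finset.mem_range.2 hi) hn

end Evaluation

end Scheme

namespace Scheme

/-! ### Lengths and sizes of the arrays -/

section Sizes

variable {S : Scheme} {n : ℕ} {adj : ℕ → ℕ → ℕ}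

theorem four_mul_sq_le_H : 4 * ((n + 1) * (n + 1)) ≤ S.H n := by
  refine le_trans ?_ R_le_H
  rw [R]
  exact Nat.le_mul_of_pos_right _ (Nat.pow_pos r_pos)

theorem L_mul_L_le_H : 2 * (S.L n * S.L n) ≤ S.H n := by
  refine le_trans (Nat.mul_le_mul_right _ ?_) (L_mul_L_le_R.trans R_le_H)
  nlinarith

theorem L_le_H : S.L n ≤ S.H n := by
  have h1 := Nat.le_mul_of_pos_left (S.L n) (L_pos (S := S) (n := n))
  have h2 := L_mul_L_le_H (S := S) (n := n)
  omega

theorem sideLen_le_half (hadj : ∀ u v, adj u v ≤ 1) (b : Bool) :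
    S.sideLen n adj b ≤ n / 2 + 1 := by
  have h := card_bitSet_of_maximal hadj (Nat.lt_succ_self (n * n))
    (fun X hX => mask_maximal (S := S) (adj := adj) X hX)
  rw [← maskSize_eq_card] at h
  cases b
  · exact h.1
  · exact h.2

/-- A side has at most n/2 + 1 ≤ 1 + 2m vertices, so its table has at most 2 L² cells. Balance of
the cut is used only for this. -/
theorem two_pow_sideLen_le (hadj : ∀ u v, adj u v ≤ 1) (b : Bool) :
    2 ^ S.sideLen n adj b ≤ S.H n := by
  have h1 := sideLen_le_half (S := S) (n := n) hadj b
  have h2 := le_three_mul_m (S := S) (n := n)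
  calc 2 ^ S.sideLen n adj b ≤ 2 ^ (1 + (S.m n + S.m n)) :=
        Nat.pow_le_pow_right (by norm_num) (by omega)
    _ = 2 * (S.L n * S.L n) := by rw [pow_add, pow_add, L, pow_one]
    _ ≤ _ := L_mul_L_le_H

theorem len_le (hadj : ∀ u v, adj u v ≤ 1) (t : ℕ) : S.len n adj t ≤ S.H n := by
  have h1 := four_mul_sq_le_H (S := S) (n := n)
  have h2 : n * n + n + 1 ≤ 4 * ((n + 1) * (n + 1)) := by nlinarith
  have h3 := L_mul_L_le_H (S := S) (n := n)
  have h4 := L_le_H (S := S) (n := n)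
  have h5 := two_pow_sideLen_le (S := S) (n := n) hadj
  unfold len
  split <;> first | exact h5 _ | omega

/-- Each vertex adds at most n arcs and 1 to the value. This keeps the table entries polynomial, and
hence short. -/
theorem bestOrder_div_le {s T : ℕ} {adj : ℕ → ℕ → ℕ} (hadj : ∀ u v, adj u v ≤ 1) (hs : s ≤ n)
    (hT : T < 2 ^ s) :
    bestOrder adj n s T / (n + 1) ≤ (n + 1) * (bitSet s T).card := by
  induction T using Nat.strong_induction_on with
  | _ T ih =>
    rcases eq_or_ne T 0 with rfl | h0
    · rw [bestOrder]
      refine (Nat.div_le_of_le_mul ?_)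
      exact Finset.sup_le fun i _ => by simp [bitn]
    · obtain ⟨h1, h2, h3⟩ := lastVertex_spec (adj := adj) hs hT h0
      set i := lastVertex adj n s T
      have hmem : i ∈ bitSet s T := mem_bitSet.2 ⟨h1, h2⟩
      have hpos : 0 < 2 ^ i := by positivity
      have hcard : (bitSet s T).card ≤ n :=
        ((Finset.card_le_card (bitSet_subset s T)).trans (Finset.card_range s).le).trans hs
      have hsum : ∑ j ∈ (bitSet s T).erase i, adj j i ≤ n := by
        refine (Finset.sum_le_card_nsmul _ _ 1 fun j _ => hadj j i).trans ?_
        rw [smul_eq_mul, mul_one]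
        exact (Finset.card_le_card (Finset.erase_subset _ _)).trans hcard
      have hi := ih (T - 2 ^ i) (by omega) (by omega)
      rw [bitSet_sub_two_pow h2] at hi
      have hc := Finset.card_erase_add_one hmem
      rw [h3, ← hc, Nat.mul_succ]
      omega

theorem bestOrder_le {s T : ℕ} {adj : ℕ → ℕ → ℕ} (hadj : ∀ u v, adj u v ≤ 1) (hs : s ≤ n)
    (hT : T < 2 ^ s) : bestOrder adj n s T ≤ (n + 1) ^ 3 := by
  have h := bestOrder_div_le hadj hs hT
  have hcard : (bitSet s T).card ≤ n :=
    ((Finset.card_le_card (bitSet_subset s T)).trans (Finset.card_range s).le).trans hs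
  have h2 : bestOrder adj n s T / (n + 1) ≤ (n + 1) * n := h.trans (Nat.mul_le_mul_left _ hcard)
  have h3 := Nat.lt_mul_of_div_lt (Nat.lt_succ_of_le h2) (Nat.succ_pos n)
  refine h3.le.trans ?_
  rw [show (n + 1) ^ 3 = (n + 1) * ((n + 1) * (n + 1)) by ring]
  nlinarith

/-- A bound for the bit lengths of all numbers, and for the numbers of iterations. -/
def bitBound (S : Scheme) (n : ℕ) : ℕ :=
  (S.M n).size + (S.H n).size + (2 * wd n + 1) + K n + 3 * S.m n + S.k n + S.r + S.Q + (n + 1) ^ 3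

theorem succ_le_cube : n + 1 ≤ (n + 1) ^ 3 := Nat.le_self_pow (by norm_num) _

theorem pairMax_lt {p : ℕ} (hp : p < S.L n * S.L n) :
    S.pairMax n adj p < (2 * wd n + 1) * (S.L n * S.L n) := by
  have hLL : 0 < S.L n * S.L n := Nat.mul_pos L_pos L_pos
  rw [pairMax, Finset.sup_lt_iff (by rw [bot_eq_zero]; positivity)]
  intro q hq
  have hq' : q < S.L n * S.L n := (Finset.mem_range_succ_iff.1 hq).trans_lt hp
  have h : S.pairValue n adj q ≤ 2 * wd n := by
    rw [pairValue, two_mul]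
    refine Nat.add_le_add (classWeight_le_wd _ _) ?_
    refine (Finset.sum_le_card_nsmul _ _ 1 fun d _ => ?_).trans (by simp)
    split_ifs <;> norm_num
  rw [Nat.succ_mul]
  have := Nat.mul_le_mul_right (S.L n * S.L n) h
  omega

theorem midMax_lt {y : ℕ} (hy : y < S.L n) : S.midMax n adj y < wd n * S.L n := by
  have hwd : 0 < wd n := Nat.succ_pos _
  rw [midMax, Finset.sup_lt_iff (by rw [bot_eq_zero]; exact Nat.mul_pos hwd L_pos)]
  intro q hq
  have hq' : q < S.L n := (Finset.mem_range_succ_iff.1 hq).trans_lt hy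
  have h := pathWeight_lt (S := S) (adj := adj) (n := n) (S.row n (S.bestPair n adj))
    (S.col n (S.bestPair n adj)) q
  have := Nat.mul_le_mul_right (S.L n) (Nat.succ_le_of_lt h)
  rw [Nat.succ_mul] at this
  omega

theorem mask_lt : S.mask n adj < 2 ^ (3 * S.m n) := by
  have h1 : S.row n (S.bestPair n adj) < 2 ^ S.m n := row_lt _
  have h2 : S.bestMid n adj < 2 ^ S.m n := Nat.mod_lt _ L_pos
  have h3 : S.col n (S.bestPair n adj) < 2 ^ S.m n := col_lt _
  rw [mask, joinBlocks, show 3 * S.m n = S.m n + (S.m n + S.m n) by ring, pow_add, pow_add]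
  generalize 2 ^ S.m n = A at *
  nlinarith [Nat.mul_le_mul_left A (Nat.succ_le_of_lt h2),
    Nat.mul_le_mul_left (A * A) (Nat.succ_le_of_lt h3)]

theorem size_arr_le (hadj : ∀ u v, adj u v ≤ 1) (t i : ℕ) (hi : i < S.len n adj t) :
    (S.arr n adj t i).size ≤ S.bitBound n := by
  have hM : ∀ x, x < S.M n → x.size ≤ S.bitBound n := fun x hx => by
    have := Nat.size_le_size hx.le
    rw [bitBound]
    omega
  have hval : ∀ x, x ≤ (n + 1) ^ 3 → x.size ≤ S.bitBound n := fun x hx => by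
    have := Nat.size_le_self x
    rw [bitBound]
    omega
  have hH : ∀ x a c, x < a * c → a ≤ 2 * wd n + 1 → c ≤ S.H n → x.size ≤ S.bitBound n :=
    fun x a c hx ha hc => by
      have h1 := Nat.size_le_size hx.le
      have h2 := Nat.size_mul_le a c
      have h3 := Nat.size_le_size hc
      have h4 := Nat.size_le_self a
      rw [bitBound]
      omega
  have hc := succ_le_cube (n := n)
  have hside : ∀ b u v, S.sideAdj n adj b u v ≤ 1 := fun b u v => hadj _ _
  have hpre : ∀ b j, (prefixMask (S.sideAdj n adj b) n (S.sideLen n adj b) j).size ≤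
      S.bitBound n := fun b j => by
    have h1 := (prefixMask_lt (adj := S.sideAdj n adj b) (n := n) (s := S.sideLen n adj b) j)
    have h2 := Nat.size_le.2 h1
    have h3 := sideLen_le (S := S) (n := n) (adj := adj) b
    rw [bitBound]
    omega
  have hLL := L_mul_L_le_H (S := S) (n := n)
  unfold arr
  unfold len at hi
  split at hi
  · exact hval _ ((hadj _ _).trans (by omega))
  · exact hM _ (yatesLevel_lt M_pos _ _ _ _)
  · exact hM _ (yatesLevel_lt M_pos _ _ _ _)
  · exact hM _ (yatesLevel_lt M_pos _ _ _ _)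
  · exact hH _ _ _ (pairMax_lt hi) le_rfl (by omega)
  · exact hH _ _ _ (midMax_lt hi) (by omega) L_le_H
  · have := Nat.size_le.2 (mask_lt (S := S) (n := n) (adj := adj))
    simp only [bitBound]
    omega
  · exact hval _ ((vertexAt_lt hi).le.trans (by omega))
  · exact hval _ (bestOrder_le (hside _) (sideLen_le _) hi)
  · exact hval _ (bestOrder_le (hside _) (sideLen_le _) hi)
  · exact hpre _ _
  · exact hpre _ _
  · exact hval _ ((finalPosition_lt hi).le.trans (by omega))

theorem size_regs_le (i : ℕ) : (S.regs n i).size ≤ S.bitBound n := by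
  have hval : ∀ x, x ≤ S.bitBound n → x.size ≤ S.bitBound n := fun x hx =>
    (Nat.size_le_self x).trans hx
  have hM : ∀ x, x ≤ S.M n → x.size ≤ S.bitBound n := fun x hx => by
    have := Nat.size_le_size hx
    rw [bitBound]
    omega
  have hH : ∀ x, x ≤ S.H n → x.size ≤ S.bitBound n := fun x hx => by
    have := Nat.size_le_size hx
    rw [bitBound]
    omega
  have hc := succ_le_cube (n := n)
  have hZ : S.Z n ≤ S.M n := by
    rw [M]
    exact (Nat.le_self_pow (Nat.succ_ne_zero _) _).trans (Nat.le_mul_of_pos_left _ DK_pos)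
  have hDK : S.DK n ≤ S.M n := Nat.le_mul_of_pos_right _ (Nat.pow_pos Z_pos)
  unfold regs
  split
  iterate 8 (refine hval _ ?_; rw [bitBound]; omega)
  · exact hH _ R_le_H
  · exact hH _ le_rfl
  · exact hH _ L_le_H
  · exact hM _ hZ
  · exact hM _ hDK
  · exact hM _ le_rfl
  · simp

theorem regs_small {i : ℕ} (hi : i ∈ small) : S.regs n i ≤ S.bitBound n := by
  have hc := succ_le_cube (n := n)
  simp only [small, List.mem_cons, List.not_mem_nil, or_false] at hi
  rcases hi with rfl | rfl | rfl | rfl | rfl | rfl | rfl | rfl <;>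
    simp only [regs, bitBound] <;> omega

theorem k_le : S.k n ≤ n / (3 * S.e) + 1 := by
  have he := S.e_pos
  rw [k, ← Nat.add_div_right _ (by omega)]
  exact Nat.div_le_div_right (by omega)

end Sizes

end Scheme

theorem RAM.exec_skip (env μ : ℕ → ℕ) : Exec .skip env μ 1 env μ := fun s hs =>
  ⟨_, _, .skip s, le_rfl, hs⟩

namespace Scheme

/-! ### Running the program -/

section Run

variable {S : Scheme} {n t : ℕ} {adj : ℕ → ℕ → ℕ} {env μ : ℕ → ℕ}

theorem Good.overlay_arr (hadj : ∀ u v, adj u v ≤ 1) (hg : S.Good n adj t μ) (L : ℕ) :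
    S.Good n adj t (overlay μ (t * S.H n) L (S.arr n adj t)) := by
  intro ρ hρ i hi
  rw [overlay_apply_of_not, hg ρ hρ i hi]
  left
  have h1 := len_le (S := S) (n := n) hadj ρ
  have h2 := Nat.mul_le_mul_right (S.H n) (Nat.succ_le_of_lt hρ)
  rw [Nat.succ_mul] at h2
  omega

/-- Arrays start at multiples of `H` and none is longer than `H`, so filling one leaves the earlier
ones intact. -/
theorem Good.succ (hadj : ∀ u v, adj u v ≤ 1) (hg : S.Good n adj t μ) :
    S.Good n adj (t + 1) (overlay μ (t * S.H n) (S.len n adj t) (S.arr n adj t)) := by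
  intro ρ hρ i hi
  rcases Nat.lt_succ_iff_lt_or_eq.1 hρ with h | rfl
  · exact hg.overlay_arr hadj _ ρ h i hi
  · exact overlay_apply_of_lt hi

theorem eval_phaseExp (ht : t < 12) (hg : S.Good n adj (t + 1) μ) (h : S.Par n env) {i : ℕ}
    (hi : i < S.len n adj (t + 1)) (h31 : env 31 = i)
    (hμ : ∀ j < i, μ ((t + 1) * S.H n + j) = S.arr n adj (t + 1) j) :
    (S.phaseExp (t + 1)).eval μ env = S.arr n adj (t + 1) i := by
  interval_cases t
  · exact eval_phase_left hg h hi h31 hμ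
  · exact eval_phase_right hg h hi h31 hμ
  · exact eval_phase_prod hg h hi h31 hμ
  · exact eval_phase_pair hg h hi h31 hμ
  · exact eval_phase_mid hg h h31 hμ
  · exact eval_phase_mask hg h i
  · exact eval_phase_vertex hg h h31
  · exact eval_phase_order false hg h le_rfl hi h31 hμ
  · exact eval_phase_order true hg h (by norm_num) hi h31 hμ
  · exact eval_phase_prefix false hg h (by norm_num) (hg 8 (by norm_num)) h31 hμ
  · exact eval_phase_prefix true hg h (by norm_num) (hg 9 (by norm_num)) h31 hμ
  · exact eval_phase_final hg h hi h31

theorem eval_lenExp (ht : t < 12) (hg : S.Good n adj (t + 1) μ) (h : S.Par n env) :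
    (lenExp (t + 1)).eval μ env = S.len n adj (t + 1) := by
  interval_cases t
  · exact h.h9
  · exact h.h9
  · exact h.h9
  · simp [lenExp, len, h.h10]
  · exact h.h10
  · rfl
  · exact h.h0
  · exact eval_sidePow hg (by norm_num) h false
  · exact eval_sidePow hg (by norm_num) h true
  · simp [lenExp, len, h.h0]
  · simp [lenExp, len, h.h0]
  · exact h.h0

variable (S) in
/-- The program that computes the parameters. -/
def setup : ℕ → Prog
  | 0 => .skip
  | t + 1 => .seq (setup t) (setReg (t + 1) (S.setupExp (t + 1)))

variable (S) in
/-- The program that computes the arrays. -/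
def fills : ℕ → Prog
  | 0 => .skip
  | t + 1 => .seq (fills t) (fill (const (t + 1) * var 9) (lenExp (t + 1)) 31 (S.phaseExp (t + 1)))

/-- The cell of the last array with the number in register `31`. -/
def resultE : Exp := cellE 12 (var 31)

variable (S) in
/-- The approximation algorithm for Feedback Arc Set. -/
def program : Prog := .seq (S.setup 13) (.seq (S.fills 12) (fill 0 (var 0) 31 resultE))

variable (S n) in
/-- The contents of the registers after `t` steps of the setup. -/
def setupRegs (t : ℕ) : ℕ → ℕ := fun i => if i ≤ t then S.regs n i else 0

theorem setupRegs_succ (t : ℕ) :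
    S.setupRegs n (t + 1) = Function.update (S.setupRegs n t) (t + 1) (S.regs n (t + 1)) := by
  funext i
  rcases eq_or_ne i (t + 1) with rfl | hne
  · simp [setupRegs]
  · rw [Function.update_of_ne hne, setupRegs, setupRegs]
    congr 1
    exact propext ⟨fun _ => by omega, fun _ => by omega⟩

theorem setupRegs_thirteen : S.setupRegs n 13 = S.regs n := by
  funext i
  rw [setupRegs]
  split_ifs with h
  · rfl
  · unfold regs
    split <;> first | rfl | omega

theorem bounded_setupRegs (t : ℕ) (hμ : ∀ a, (μ a).size ≤ S.bitBound n) :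
    Exp.Bounded (S.bitBound n) small (S.setupRegs n t) μ := by
  refine ⟨fun i _ => ?_, fun i hi => ?_, hμ⟩ <;> rw [setupRegs] <;> split_ifs
  · exact size_regs_le i
  · simp
  · exact regs_small hi
  · exact Nat.zero_le _

theorem bounded_regs (hμ : ∀ a, (μ a).size ≤ S.bitBound n) :
    Exp.Bounded (S.bitBound n) small (S.regs n) μ :=
  setupRegs_thirteen (S := S) (n := n) ▸ bounded_setupRegs 13 hμ

theorem exec_setup (hμ : ∀ a, (μ a).size ≤ S.bitBound n) (t : ℕ) (ht : t ≤ 13) :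
    Exec (S.setup t) (S.setupRegs n 0) μ
      (1 + ∑ i ∈ Finset.range t, setTime (S.setupExp (i + 1)) (S.bitBound n))
      (S.setupRegs n t) μ := by
  induction t with
  | zero => exact exec_skip _ _
  | succ t ih =>
    have h := exec_setReg (x := t + 1) (S.setupExp_wf (t + 1)) (bounded_setupRegs t hμ)
    rw [show (S.setupExp (t + 1)).eval μ (S.setupRegs n t) = S.regs n (t + 1) from
      S.eval_setupExp n μ t (by omega), ← setupRegs_succ] at h
    rw [Finset.sum_range_succ, ← Nat.add_assoc]
    exact (ih (by omega)).seq h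

theorem exec_fill_arr (hadj : ∀ u v, adj u v ≤ 1) (ht : t < 12) (hg : S.Good n adj (t + 1) μ)
    (hμ : ∀ a, (μ a).size ≤ S.bitBound n) :
    Exec (fill (const (t + 1) * var 9) (lenExp (t + 1)) 31 (S.phaseExp (t + 1))) (S.regs n) μ
      ((S.H n + 1) * fillTime (const (t + 1) * var 9) (lenExp (t + 1)) (S.phaseExp (t + 1))
        (S.bitBound n)) (S.regs n)
      (overlay μ ((t + 1) * S.H n) (S.len n adj (t + 1)) (S.arr n adj (t + 1))) := by
  have hlen := len_le (S := S) (n := n) hadj (t + 1)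
  refine (exec_fill (S.arr n adj (t + 1)) (Y := small) (by simp) (lenExp_wf _) (S.phaseExp_wf _)
    (by norm_num) (by simp [small]) (bounded_regs hμ) rfl (eval_lenExp ht hg (S.par_regs n))
    ((Nat.size_le_size hlen).trans (by rw [bitBound]; omega)) (fun i hi => size_arr_le hadj _ i hi)
    fun i hi => ?_).mono (Nat.mul_le_mul_right _ (by omega))
  exact eval_phaseExp ht (hg.overlay_arr hadj i) ((S.par_regs n).update (by norm_num) _) hi
    (Function.update_self _ _ _) fun j hj => overlay_apply_of_lt hj

theorem exec_fills (hadj : ∀ u v, adj u v ≤ 1) (hg : S.Good n adj 1 μ)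
    (hμ : ∀ a, (μ a).size ≤ S.bitBound n) (t : ℕ) (ht : t ≤ 12) :
    ∃ μ', Exec (S.fills t) (S.regs n) μ (1 + ∑ i ∈ Finset.range t, (S.H n + 1) *
      fillTime (const (i + 1) * var 9) (lenExp (i + 1)) (S.phaseExp (i + 1)) (S.bitBound n))
      (S.regs n) μ' ∧ S.Good n adj (t + 1) μ' ∧ ∀ a, (μ' a).size ≤ S.bitBound n := by
  induction t with
  | zero => exact ⟨μ, exec_skip _ _, hg, hμ⟩
  | succ t ih =>
    obtain ⟨μ', h, hg', hμ'⟩ := ih (by omega)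
    refine ⟨_, ?_, hg'.succ hadj, size_overlay_le hμ' fun i hi => size_arr_le hadj _ i hi⟩
    rw [Finset.sum_range_succ, ← Nat.add_assoc]
    exact h.seq (exec_fill_arr hadj (by omega) hg' hμ')

variable (S) in
/-- The time of the program per cell, for a given bound on all bit lengths. -/
def cellTime (b : ℕ) : ℕ :=
  (1 + ∑ i ∈ Finset.range 13, setTime (S.setupExp (i + 1)) b) +
    (1 + ∑ i ∈ Finset.range 12,
      fillTime (const (i + 1) * var 9) (lenExp (i + 1)) (S.phaseExp (i + 1)) b) +
    fillTime 0 (var 0) resultE b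

theorem exec_program (hadj : ∀ u v, adj u v ≤ 1) (hg : S.Good n adj 1 μ)
    (hμ : ∀ a, (μ a).size ≤ S.bitBound n) :
    ∃ μ', Exec S.program (S.setupRegs n 0) μ ((S.H n + 1) * S.cellTime (S.bitBound n))
      (S.regs n) μ' ∧ ∀ v < n, μ' v = finalPosition adj n (S.mask n adj) v := by
  obtain ⟨μ', h, hg', hμ'⟩ := exec_fills hadj hg hμ 12 le_rfl
  have hn : n ≤ S.H n := len_le (S := S) hadj 12
  have hw : resultE.WF small := by simp [resultE, cellE]
  -- The positions are copied to address 0, where the output is expected, over the input matrix. The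
  -- cell read at step i, number 12 H + i, lies outside the i cells written so far.
  have hf := exec_fill (lo := 0) (len := var 0) (e := resultE) (x := 31) (μ := μ') (l := 0) (L := n)
    (S.arr n adj 12) (by simp) (by simp) hw (by norm_num) (by simp [small]) (bounded_regs hμ') rfl rfl
    ((Nat.size_le_size hn).trans (by rw [bitBound]; omega)) (fun i hi => size_arr_le hadj 12 i hi)
    fun i hi => by
      rw [resultE, eval_cellE ((S.par_regs n).update (by norm_num) _), eval_var,
        Function.update_self, overlay_apply_of_not (by omega)]
      exact hg' 12 (by norm_num) i hi
  have hs := exec_setup hμ 13 le_rfl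
  rw [setupRegs_thirteen] at hs
  refine ⟨_, (hs.seq (h.seq hf)).mono ?_, fun v hv => ?_⟩
  · rw [← Finset.mul_sum, cellTime]
    set A := ∑ i ∈ Finset.range 13, setTime (S.setupExp (i + 1)) (S.bitBound n)
    set B := ∑ i ∈ Finset.range 12, fillTime (const (i + 1) * var 9) (lenExp (i + 1))
      (S.phaseExp (i + 1)) (S.bitBound n)
    set C := fillTime 0 (var 0) resultE (S.bitBound n)
    have h1 : (n + 1) * C ≤ (S.H n + 1) * C := Nat.mul_le_mul_right _ (by omega)
    have h2 : 1 + A ≤ (S.H n + 1) * (1 + A) := Nat.le_mul_of_pos_left _ (Nat.succ_pos _)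
    have h3 : (S.H n + 1) * (1 + A + (1 + B) + C) = (S.H n + 1) * (1 + A) + (S.H n + 1) +
      (S.H n + 1) * B + (S.H n + 1) * C := by ring
    omega
  · have := overlay_apply_of_lt (μ := μ') (lo := 0) (v := S.arr n adj 12) hv
    rwa [Nat.zero_add] at this

end Run

end Scheme

namespace Scheme

/-! ### The running time -/

/-- `H` and `M` are exponentially large, but they are products of powers with polynomial exponents
whose bases have polynomial bit length, so their own bit lengths are polynomial. -/
theorem bitBound_polyBounded (S : Scheme) : PolyBounded S.bitBound := by
  have hn1 : PolyBounded fun n => n + 1 := PolyBounded.id.add (.const 1)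
  have hk : PolyBounded S.k := hn1.mono fun n => k_le.trans (by
    have := Nat.div_le_self n (3 * S.e)
    omega)
  have hm : PolyBounded S.m := (PolyBounded.const S.e).mul hk
  have hK : PolyBounded K := (PolyBounded.id.mul .id).add (.const 1)
  have hwd : PolyBounded wd :=
    ((PolyBounded.const 2).mul (PolyBounded.id.mul (PolyBounded.id.mul hK))).add (.const 1)
  have hR : PolyBounded fun n => (S.R n).size :=
    ((((PolyBounded.const 4).mul (hn1.mul hn1)).add (hk.mul (.const S.r.size))).add (.const 1)).mono
      fun n => by
        have h1 := Nat.size_mul_le (4 * ((n + 1) * (n + 1))) (S.r ^ S.k n)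
        have h2 := Nat.size_le_self (4 * ((n + 1) * (n + 1)))
        have h3 := Nat.size_pow_le S.r (S.k n)
        rw [R]
        omega
  have hH : PolyBounded fun n => (S.H n).size := ((hk.add (.const 1)).add hR).mono fun n => by
    have h1 := Nat.size_mul_le (S.k n + 1) (S.R n)
    have h2 := Nat.size_le_self (S.k n + 1)
    rw [H]
    omega
  have hZ : PolyBounded fun n => (S.Z n).size := (hm.add (.const 2)).mono fun n => by
    rw [Nat.size_le, Z, L, pow_add]
    have : 0 < 2 ^ S.m n := by positivity
    omega
  have hM : PolyBounded fun n => (S.M n).size :=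
    ((hk.mul (.const S.D.size)).add ((hwd.mul hZ).add (.const 2))).mono fun n => by
      have h1 := Nat.size_mul_le (S.DK n) (S.Z n ^ wd n)
      have h2 := Nat.size_pow_le S.D (S.k n)
      have h3 := Nat.size_pow_le (S.Z n) (wd n)
      rw [M]
      rw [DK] at h1 ⊢
      omega
  exact (((((((hM.add hH).add (((PolyBounded.const 2).mul hwd).add (.const 1))).add hK).add
    ((PolyBounded.const 3).mul hm)).add hk).add (.const S.r)).add (.const S.Q)).add (hn1.pow 3)

theorem _root_.PolyBounded.finset_sum (l : ℕ) {f : ℕ → ℕ → ℕ} (hf : ∀ i, PolyBounded (f i)) :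
    PolyBounded fun b => ∑ i ∈ Finset.range l, f i b := by
  induction l with
  | zero => simpa using PolyBounded.const 0
  | succ l ih => simpa only [Finset.sum_range_succ] using ih.add (hf l)

theorem cellTime_polyBounded (S : Scheme) : PolyBounded S.cellTime :=
  (((PolyBounded.const 1).add (.finset_sum 13 fun _ => setTime_polyBounded _)).add
    ((PolyBounded.const 1).add (.finset_sum 12 fun _ => fillTime_polyBounded _ _ _))).add
    (fillTime_polyBounded _ _ _)

/-- The number of cells is r^k up to a polynomial factor, and r^k ≤ 2^(w e k) with e k ≤ e + n/3.
Rounding up `k` costs the constant factor 2^(w e). -/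
theorem exists_time_le (S : Scheme) {w : ℝ} (hr : (S.r : ℝ) ≤ (2 ^ S.e : ℝ) ^ w) :
    ∃ (C : ℝ) (k : ℕ), ∀ n : ℕ, (((S.H n + 1) * S.cellTime (S.bitBound n) : ℕ) : ℝ) ≤
      C * ((n : ℝ) + 1) ^ k * 2 ^ (w * n / 3) := by
  have hn1 : PolyBounded fun n => n + 1 := PolyBounded.id.add (.const 1)
  obtain ⟨c, d, hc⟩ : PolyBounded fun n => ((n + 2) * (4 * ((n + 1) * (n + 1))) + 1) *
      S.cellTime (S.bitBound n) :=
    (((PolyBounded.id.add (.const 2)).mul ((PolyBounded.const 4).mul (hn1.mul hn1))).add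
      (.const 1)).mul (S.cellTime_polyBounded.comp S.bitBound_polyBounded)
  have hr1 : (1 : ℝ) ≤ S.r := by exact_mod_cast r_pos
  have he : (1 : ℝ) < 2 ^ S.e := one_lt_pow₀ (by norm_num) S.e_pos.ne'
  -- Needed for monotonicity in the exponent; a negative w would contradict 1 ≤ r.
  have hw : 0 ≤ w := by
    by_contra! h
    exact absurd (hr1.trans hr) (not_le.2 (Real.rpow_lt_one_of_one_lt_of_neg he h))
  refine ⟨c * 2 ^ (w * S.e), d, fun n => ?_⟩
  have hpow : (S.r : ℝ) ^ S.k n ≤ 2 ^ (w * S.e) * 2 ^ (w * n / 3) := by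
    have hk : ((S.e * S.k n : ℕ) : ℝ) ≤ S.e + n / 3 := by
      have h1 : S.k n * (3 * S.e) ≤ n + (3 * S.e - 1) := Nat.div_mul_le_self _ _
      have h2 : (3 * (S.e * S.k n) : ℕ) ≤ n + 3 * S.e := by
        rw [show 3 * (S.e * S.k n) = S.k n * (3 * S.e) by ring]
        omega
      have h3 : ((3 * (S.e * S.k n) : ℕ) : ℝ) ≤ ((n + 3 * S.e : ℕ) : ℝ) := by exact_mod_cast h2
      push_cast at h3 ⊢
      linarith
    calc (S.r : ℝ) ^ S.k n ≤ ((2 ^ S.e : ℝ) ^ w) ^ S.k n := pow_le_pow_left₀ (by positivity) hr _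
      _ = 2 ^ (w * ((S.e * S.k n : ℕ) : ℝ)) := by
        rw [← Real.rpow_natCast, ← Real.rpow_natCast, ← Real.rpow_mul (by norm_num),
          ← Real.rpow_mul (by norm_num)]
        congr 1
        push_cast
        ring
      _ ≤ 2 ^ (w * (S.e + n / 3)) :=
        Real.rpow_le_rpow_of_exponent_le (by norm_num) (mul_le_mul_of_nonneg_left hk hw)
      _ = _ := by
        rw [← Real.rpow_add (by norm_num)]
        congr 1
        ring
  have hH : S.H n + 1 ≤ ((n + 2) * (4 * ((n + 1) * (n + 1))) + 1) * S.r ^ S.k n := by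
    have h1 : S.k n + 1 ≤ n + 2 := by
      have := k_le (S := S) (n := n)
      have := Nat.div_le_self n (3 * S.e)
      omega
    have h2 : 1 ≤ S.r ^ S.k n := Nat.pow_pos r_pos
    rw [H, R, Nat.add_mul _ 1 (S.r ^ S.k n), one_mul, ← mul_assoc]
    exact Nat.add_le_add (Nat.mul_le_mul_right _ (Nat.mul_le_mul_right _ h1)) h2
  have hT : (S.H n + 1) * S.cellTime (S.bitBound n) ≤ c * (n + 1) ^ d * S.r ^ S.k n :=
    calc _ ≤ ((n + 2) * (4 * ((n + 1) * (n + 1))) + 1) * S.r ^ S.k n *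
          S.cellTime (S.bitBound n) := Nat.mul_le_mul_right _ hH
      _ = ((n + 2) * (4 * ((n + 1) * (n + 1))) + 1) * S.cellTime (S.bitBound n) *
          S.r ^ S.k n := by ring
      _ ≤ _ := Nat.mul_le_mul_right _ (hc n)
  calc (((S.H n + 1) * S.cellTime (S.bitBound n) : ℕ) : ℝ)
      ≤ ((c * (n + 1) ^ d * S.r ^ S.k n : ℕ) : ℝ) := by exact_mod_cast hT
    _ = c * ((n : ℝ) + 1) ^ d * (S.r : ℝ) ^ S.k n := by push_cast; ring
    _ ≤ c * ((n : ℝ) + 1) ^ d * (2 ^ (w * S.e) * 2 ^ (w * n / 3)) :=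
      mul_le_mul_of_nonneg_left hpow (by positivity)
    _ = _ := by ring

/-- Some τ < ω + ε has ranks at most C N^τ. For N = 2^(l+1) with l large, C ≤ N^δ with δ = ω + ε -
τ, so one fixed size meets the bound without a constant. -/
theorem exists_rank_le {ε : ℝ} (hε : 0 < ε) :
    ∃ S : Scheme, (S.r : ℝ) ≤ (2 ^ S.e : ℝ) ^ (matMulExponent + ε) := by
  have hne : {τ : ℝ | ∃ C : ℝ, ∀ N : ℕ, 1 ≤ N →
      ∃ r : ℕ, HasBilinearMatMul N r ∧ (r : ℝ) ≤ C * (N : ℝ) ^ τ}.Nonempty := by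
    refine ⟨(3 : ℕ), 1, fun N _ => ⟨_, hasBilinearMatMul_cube N, ?_⟩⟩
    rw [Real.rpow_natCast]
    push_cast
    exact le_of_eq (by ring)
  obtain ⟨τ, ⟨C, hC⟩, hτ⟩ := exists_lt_of_csInf_lt hne
    (show sInf _ < matMulExponent + ε from lt_add_of_pos_right _ hε)
  set δ := matMulExponent + ε - τ with hδ
  have hδ0 : 0 < δ := sub_pos.2 hτ
  have hx : (1 : ℝ) < 2 ^ δ := Real.one_lt_rpow (by norm_num) hδ0
  obtain ⟨l, hl⟩ := pow_unbounded_of_one_lt C hx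
  have hl' : C ≤ ((2 : ℝ) ^ (l + 1)) ^ δ := by
    refine (hl.trans (pow_lt_pow_right₀ hx (Nat.lt_succ_self l))).le.trans (le_of_eq ?_)
    rw [← Real.rpow_natCast, ← Real.rpow_natCast, ← Real.rpow_mul (by norm_num),
      ← Real.rpow_mul (by norm_num), mul_comm]
  obtain ⟨r, hr, hrC⟩ := hC (2 ^ (l + 1)) Nat.one_le_two_pow
  obtain ⟨D, F, G, W, hD, hspec⟩ := hr.exists_scheme (by positivity)
  refine ⟨⟨l + 1, r, D, F, G, W, Nat.succ_pos l, hr.mul_self_le, hD, hspec⟩, ?_⟩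
  push_cast at hrC
  refine hrC.trans ((mul_le_mul_of_nonneg_right hl' (by positivity)).trans (le_of_eq ?_))
  rw [← Real.rpow_add (by positivity)]
  congr 1
  rw [hδ]
  ring

end Scheme

/-! ### Digraphs on initial segments of the natural numbers -/

open Classical in
/-- The adjacency matrix of a digraph, with natural numbers as indices. -/
noncomputable def Digraph.natAdj {n : ℕ} (G : Digraph (Fin n)) (u v : ℕ) : ℕ :=
  if ∃ a b : Fin n, u = a ∧ v = b ∧ G.Adj a b then 1 else 0

section Digraph

variable {n : ℕ} (G : Digraph (Fin n))

theorem Digraph.natAdj_le_one (u v : ℕ) : G.natAdj u v ≤ 1 := by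
  rw [natAdj]
  split_ifs <;> norm_num

open Classical in
theorem Digraph.natAdj_coe (u v : Fin n) : G.natAdj u v = if G.Adj u v then 1 else 0 := by
  rw [natAdj]
  congr 1
  refine propext ⟨?_, fun h => ⟨u, v, rfl, rfl, h⟩⟩
  rintro ⟨a, b, ha, hb, h⟩
  rwa [Fin.ext ha, Fin.ext hb]

theorem Digraph.natAdj_self (hG : ∀ v, ¬ G.Adj v v) (u : ℕ) : G.natAdj u u = 0 := by
  rw [natAdj, if_neg]
  rintro ⟨a, b, rfl, hb, h⟩
  exact hG a (by rwa [← Fin.ext hb] at h)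

/-- Without loops, an arc that is not forward has its head strictly before its tail, since an
ordering is injective. -/
theorem numBackward_eq (hG : ∀ v, ¬ G.Adj v v) (π : Fin n ≃ Fin n) {ρ : ℕ → ℕ}
    (hρ : ∀ v : Fin n, ρ v = π v) :
    numBackward G π = backwardArcs G.natAdj ρ (Finset.range n) (Finset.range n) := by
  classical
  rw [numBackward, Set.ncard_eq_toFinset_card', Set.toFinset_ofPred, Finset.card_filter,
    Fintype.sum_prod_type, backwardArcs, Finset.sum_range]
  refine Finset.sum_congr rfl fun u _ => ?_
  rw [Finset.sum_range]
  refine Finset.sum_congr rfl fun v _ => ?_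
  rw [hρ, hρ, G.natAdj_coe, ← ite_and]
  refine if_congr ?_ rfl rfl
  rw [and_comm]
  refine and_congr_left fun h => ?_
  rw [not_lt, Fin.val_fin_lt]
  exact ⟨fun h' => lt_of_le_of_ne h' fun he => hG u (by rwa [π.injective he] at h), le_of_lt⟩

theorem encodeDigraph_mem_le_one (a : ℕ) : (encodeDigraph G).mem a ≤ 1 := by
  simp only [encodeDigraph]
  split_ifs <;> norm_num

theorem encodeDigraph_mem (i : ℕ) (hi : i < n * n) :
    (encodeDigraph G).mem i = G.natAdj (i / n) (i % n) := by
  have hn : 0 < n := by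
    by_contra h
    rw [show n = 0 by omega] at hi
    omega
  simp only [encodeDigraph, Digraph.natAdj]
  congr 1
  refine propext (exists_congr fun u => exists_congr fun v => ?_)
  rw [← and_assoc]
  refine and_congr_left fun _ => ⟨?_, fun ⟨h1, h2⟩ => ?_⟩
  · rintro rfl
    rw [Nat.add_comm, Nat.add_mul_div_right _ _ hn, Nat.div_eq_of_lt v.2, Nat.zero_add,
      Nat.add_mul_mod_self_right, Nat.mod_eq_of_lt v.2]
    exact ⟨rfl, rfl⟩
  · rw [← h1, ← h2, Nat.div_add_mod']

end Digraph

/-! ### The approximation algorithm and its running time -/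

theorem Scheme.approximatesFAS (S : Scheme) {T : ℕ → ℝ}
    (hT : ∀ n, (((S.H n + 1) * S.cellTime (S.bitBound n) : ℕ) : ℝ) ≤ T n) :
    ApproximatesFAS S.program 2 T := by
  intro n G hG
  have hadj := G.natAdj_le_one
  have hgood : S.Good n G.natAdj 1 (encodeDigraph G).mem := by
    intro ρ hρ i hi
    obtain rfl : ρ = 0 := by omega
    rw [Nat.zero_mul, Nat.zero_add]
    exact encodeDigraph_mem G i hi
  have hsize : ∀ a, ((encodeDigraph G).mem a).size ≤ S.bitBound n := fun a =>
    ((Nat.size_le_self _).trans (encodeDigraph_mem_le_one G a)).trans (by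
      have := succ_le_cube (n := n)
      rw [bitBound]
      omega)
  obtain ⟨μ', hexec, hμ'⟩ := exec_program hadj hgood hsize
  obtain ⟨t, s, hrun, ht, hs⟩ := hexec (encodeDigraph G) ⟨fun i _ => by
    simp only [encodeDigraph, setupRegs, Nat.le_zero]
    split_ifs with h
    · rw [h, regs]
    · rfl, rfl⟩
  have hinj : Function.Injective fun v : Fin n =>
      (⟨finalPosition G.natAdj n (S.mask n G.natAdj) v, finalPosition_lt v.2⟩ : Fin n) :=
    fun u v h => Fin.ext (finalPosition_injOn (by simp) (by simp) (Fin.mk.inj h))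
  refine ⟨t, s, Equiv.ofBijective _ (Finite.injective_iff_bijective.1 hinj), hrun,
    le_trans (by exact_mod_cast ht) (hT n), fun v => ?_, fun σ => ?_⟩
  · rw [hs.2, hμ' v v.2]
    rfl
  · set ρ : ℕ → ℕ := fun v => if h : v < n then σ ⟨v, h⟩ else 0 with hρ
    rw [numBackward_eq G hG _ (ρ := finalPosition G.natAdj n (S.mask n G.natAdj)) fun v => rfl,
      numBackward_eq G hG σ (ρ := ρ) fun v => by simp [hρ]]
    exact_mod_cast backwardArcs_finalPosition_le (K := K n) (G.natAdj_self hG)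
      (fun u v => (hadj u v).trans (Nat.succ_le_succ (Nat.zero_le _)))
      (fun X hX => mask_maximal X hX)
      (fun u hu v hv h => by
        have hu' : u < n := by simpa using hu
        have hv' : v < n := by simpa using hv
        simp only [hρ, dif_pos hu', dif_pos hv'] at h
        exact congrArg Fin.val (σ.injective (Fin.ext h)))
      (fun v hv => by simp [hρ, hv])

theorem mainTheorem12 :
    ∀ ε : ℝ, 0 < ε → ∃ (P : RAM.Prog) (C : ℝ) (k : ℕ),
      ApproximatesFAS P 2 (fun n : ℕ =>
        C * ((n : ℝ) + 1) ^ k * (2 : ℝ) ^ ((matMulExponent + ε) * (n : ℝ) / 3)) := by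
  intro ε hε
  obtain ⟨S, hS⟩ := Scheme.exists_rank_le hε
  obtain ⟨C, k, h⟩ := S.exists_time_le hS
  exact ⟨S.program, C, k, S.approximatesFAS h⟩
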